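/- Let $\rho:\mathbb R^3\to\mathbb R$ belong to the Sobolev space $H^2(\mathbb R^3)$, be compactly supported and spherically symmetric, and satisfy the Wiener condition $$\hat\rho(k):=(2\pi)^{-3/2}\int e^{ik\cdot x}\rho(x)\,dx\neq 0\qquad\text{for all }k\in\mathbb R^3\setminus\{0\}.$$ Let $v\in\mathbb R^3$ with $|v|<1$. Put $B_v=\sqrt{1-|v|^2}\,(I_3-v\otimes v)$ and, for $\operatorname{Re}\lambda>0$ and $i,j=1,2,3$, $$K_{ij}=\int\frac{k_ik_j|\hat\rho(k)|^2}{k^2-(k\cdot v)^2}\,dk,\qquad H_{ij}(\lambda)=\int\frac{k_ik_j|\hat\rho(k)|^2}{k^2+(i\,k\cdot v+\lambda)^2}\,dk,\qquad F(\lambda)=H(\lambda)-K,$$ $$M(\lambda)=\begin{pmatrix}\lambda I_3&-B_v\\-F(\lambda)&\lambda I_3\end{pmatrix}\in\mathbb C^{6\times 6}.$$ Then for every real $\omega\ne0$ the limit $M(i\omega):=\lim_{\varepsilon\to0+}M(i\omega+\varepsilon)$ exists and is an invertible matrix, and the matrix function $\omega\mapsto M(i\omega)^{-1}$ is real-analytic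 on $\mathbb R\setminus\{0\}$. Moreover, let $\psi_v$ be the solution of $(-\Delta+(v\cdot\nabla)^2)\psi_v=-\rho$ given by $\hat\psi_v(k)=-\hat\rho(k)/(k^2-(k\cdot v)^2)$, and let $$A_{v,v}(\Psi,\Pi,Q,P)=\bigl(v\cdot\nabla\Psi+\Pi,\ \Delta\Psi+v\cdot\nabla\Pi+Q\cdot\nabla\rho,\ B_vP,\ \langle\Psi,\nabla\rho\rangle+\langle\nabla\psi_v,Q\cdot\nabla\rho\rangle\bigr)$$ be the operator of the linearized system, with derivatives in the sense of distributions and $\langle f,g\rangle=\int fg\,dx$. Then no $\lambda\in(i\mathbb R\cup\mathbb R)\setminus\{0\}$ is an eigenvalue of $A_{v,v}$, i.e. there is no nonzero $X=(\Psi,\Pi,Q,P)$ in the complexified space $\dot H^1(\mathbb R^3)\oplus L^2(\mathbb R^3)\oplus\mathbb C^3\oplus\mathbb C^3$, where $\dot H^1=\{\Psi\in L^6:\nabla\Psi\in L^2\}$, with $A_{v,v}X=\lambda X$. -/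

import Mathlib

open MeasureTheory Filter Topology

namespace WaveParticle

open scoped ContDiff InnerProductSpace Laplacian

noncomputable section

/-- Euclidean space `ℝ³`. -/
abbrev E3 : Type := EuclideanSpace ℝ (Fin 3)

/-! ### Weak derivatives -/

/-- Real test functions: smooth functions with compact support on `ℝ³`. -/
def IsTest (φ : E3 → ℝ) : Prop := ContDiff ℝ ∞ φ ∧ HasCompactSupport φ

/-- The classical partial derivative `∂_j φ`. -/
def partialD {F : Type*} [NormedAddCommGroup F] [NormedSpace ℝ F]
    (j : Fin 3) (φ : E3 → F) (x : E3) : F :=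
  fderiv ℝ φ x (EuclideanSpace.single j 1)

/-- `g` is the weak (distributional) partial derivative `∂_j f`. -/
structure HasWeakPartial {F : Type*} [NormedAddCommGroup F] [NormedSpace ℝ F]
    (j : Fin 3) (f g : E3 → F) : Prop where
  left_int : LocallyIntegrable f
  right_int : LocallyIntegrable g
  parts : ∀ φ : E3 → ℝ, IsTest φ → ∫ x, partialD j φ x • f x = -∫ x, φ x • g x

open Classical in
/-- The weak partial derivative `∂_j f` (unique almost everywhere when it exists). -/
def weakPartial {F : Type*} [NormedAddCommGroup F] [NormedSpace ℝ F]
    (j : Fin 3) (f : E3 → F) : E3 → F :=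
  if h : ∃ g, HasWeakPartial j f g then h.choose else 0

/-! ### The charge distribution -/

/-- The conditions on the charge distribution: `ρ` is real-valued, belongs to `H²(ℝ³)`, has compact
support, and is spherically symmetric. -/
structure IsCharge (ρ : E3 → ℝ) : Prop where
  memLp : MemLp ρ 2
  sobolev : ∃ (g : Fin 3 → E3 → ℝ) (h : Fin 3 → Fin 3 → E3 → ℝ),
    (∀ i, HasWeakPartial i ρ (g i) ∧ MemLp (g i) 2) ∧
    (∀ i j, HasWeakPartial j (g i) (h i j) ∧ MemLp (h i j) 2)
  support : ∃ R : ℝ, ∀ x, R ≤ ‖x‖ → ρ x = 0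
  radial : ∃ ρ₁ : ℝ → ℝ, ∀ x, ρ x = ρ₁ ‖x‖

/-- `ρ̂(k) = (2π)^{-3/2} ∫ e^{ikx} ρ(x) dx`. -/
def hat (ρ : E3 → ℝ) (k : E3) : ℂ :=
  (((2 * Real.pi) ^ (-(3 / 2) : ℝ) : ℝ) : ℂ) *
    ∫ x, Complex.exp (Complex.I * ((⟪k, x⟫_ℝ : ℝ) : ℂ)) * (ρ x : ℂ)

/-- The Wiener condition: `ρ̂(k) ≠ 0` for all `k ≠ 0`. -/
def Wiener (ρ : E3 → ℝ) : Prop := ∀ k : E3, k ≠ 0 → hat ρ k ≠ 0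

/-! ### The reduced linearized system -/

/-- `B_v = ν (I - v ⊗ v)` with `ν = √(1 - v²)`. -/
def B (v : E3) : Matrix (Fin 3) (Fin 3) ℂ :=
  Matrix.of fun i j =>
    ((Real.sqrt (1 - ‖v‖ ^ 2) * ((if i = j then 1 else 0) - v i * v j) : ℝ) : ℂ)

/-- `K_ij = ∫ k_i k_j |ρ̂(k)|² / (k² - (k·v)²) dk`. -/
def K (ρ : E3 → ℝ) (v : E3) : Matrix (Fin 3) (Fin 3) ℂ :=
  Matrix.of fun i j =>
    ((∫ k : E3, k i * k j * ‖hat ρ k‖ ^ 2 / (‖k‖ ^ 2 - ⟪k, v⟫_ℝ ^ 2) : ℝ) : ℂ)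

/-- `H_ij(λ) = ∫ k_i k_j |ρ̂(k)|² / (k² + (i k·v + λ)²) dk`, used for `Re λ > 0`. -/
def H (ρ : E3 → ℝ) (v : E3) (lam : ℂ) : Matrix (Fin 3) (Fin 3) ℂ :=
  Matrix.of fun i j =>
    ∫ k : E3, ((k i * k j * ‖hat ρ k‖ ^ 2 : ℝ) : ℂ) /
      (((‖k‖ ^ 2 : ℝ) : ℂ) + (Complex.I * ((⟪k, v⟫_ℝ : ℝ) : ℂ) + lam) ^ 2)

/-- `F(λ) = H(λ) - K`. -/
def F (ρ : E3 → ℝ) (v : E3) (lam : ℂ) : Matrix (Fin 3) (Fin 3) ℂ := H ρ v lam - K ρ v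

/-- The `6 × 6` matrix `M(λ) = ((λ I, -B_v), (-F(λ), λ I))`, used for `Re λ > 0`. -/
def M (ρ : E3 → ℝ) (v : E3) (lam : ℂ) : Matrix (Fin 3 ⊕ Fin 3) (Fin 3 ⊕ Fin 3) ℂ :=
  Matrix.fromBlocks (lam • 1) (-B v) (-F ρ v lam) (lam • 1)

/-! ### The linearized operator -/

/-- The field `ψ_v` of the soliton with velocity `v`, i.e. the solution of
`(-Δ + (v·∇)²) ψ_v = -ρ`, given by `ψ̂_v(k) = -ρ̂(k) / (k² - (k·v)²)`. -/
def soliton (ρ : E3 → ℝ) (v : E3) (x : E3) : ℂ :=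
  (((2 * Real.pi) ^ (-(3 / 2) : ℝ) : ℝ) : ℂ) *
    ∫ k : E3, Complex.exp (-Complex.I * ((⟪k, x⟫_ℝ : ℝ) : ℂ)) *
      (-hat ρ k / ((‖k‖ ^ 2 - ⟪k, v⟫_ℝ ^ 2 : ℝ) : ℂ))

/-- Membership in the (complexified) space `Ḣ¹ = {ψ ∈ L⁶ : ∇ψ ∈ L²}`. -/
def MemDotH1 (Ψ : E3 → ℂ) : Prop :=
  MemLp Ψ 6 ∧ ∀ j, ∃ g : E3 → ℂ, HasWeakPartial j Ψ g ∧ MemLp g 2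

/-- `(Ψ, Π, Q, P)`, an element of the complexified phase space `Ḣ¹ ⊕ L² ⊕ ℂ³ ⊕ ℂ³`, satisfies
`A_{v,v} X = λ X`, where `A_{v,v}` is the linearization at the soliton with velocity `v`:
* `v·∇Ψ + Π = λ Ψ` and `ΔΨ + v·∇Π + Q·∇ρ = λ Π` in the sense of distributions,
* `B_v P = λ Q`,
* `⟨Ψ, ∇ρ⟩ + ⟨∇ψ_v, Q·∇ρ⟩ = λ P`. -/
structure IsEigenpair (ρ : E3 → ℝ) (v : E3) (lam : ℂ)
    (Ψ Pi : E3 → ℂ) (Q P : Fin 3 → ℂ) : Prop where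
  memΨ : MemDotH1 Ψ
  memPi : MemLp Pi 2
  eqΨ : ∀ φ : E3 → ℝ, IsTest φ →
    -(∫ x, fderiv ℝ φ x v • Ψ x) + ∫ x, φ x • Pi x = lam * ∫ x, φ x • Ψ x
  eqPi : ∀ φ : E3 → ℝ, IsTest φ →
    (∫ x, (Δ φ) x • Ψ x) - (∫ x, fderiv ℝ φ x v • Pi x)
      - (∑ j, Q j * ∫ x, ((partialD j φ x * ρ x : ℝ) : ℂ)) = lam * ∫ x, φ x • Pi x
  eqQ : (B v).mulVec P = lam • Q
  eqP : ∀ j, (∫ x, Ψ x * ((weakPartial j ρ x : ℝ) : ℂ))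
      + (∑ l, Q l * ∫ x, partialD j (soliton ρ v) x * ((weakPartial l ρ x : ℝ) : ℂ)) = lam * P j

/-- `λ` is an eigenvalue of the linearized operator `A_{v,v}`. -/
def IsEigenvalue (ρ : E3 → ℝ) (v : E3) (lam : ℂ) : Prop :=
  ∃ (Ψ Pi : E3 → ℂ) (Q P : Fin 3 → ℂ), IsEigenpair ρ v lam Ψ Pi Q P ∧
    ¬ (Ψ =ᵐ[volume] 0 ∧ Pi =ᵐ[volume] 0 ∧ Q = 0 ∧ P = 0)

end

end WaveParticle

open scoped FourierTransform SchwartzMap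

namespace WaveParticle

open scoped ContDiff InnerProductSpace Laplacian

/-! ### Weak derivatives of square integrable functions and the Fourier transform -/

/-! Everything is governed by the function `beta v k = |k| - k·v`, which is homogeneous of degree
one and at least `(1 - |v|)|k|`, so that its positive level sets are ellipsoids around the origin.

Continuation. The denominator of `H` factors as `(β_v + iλ)(β_{-v} - iλ)`. After symmetrization
under `k ↦ -k`, `H` becomes the integral of `k_i k_j |ρ̂|² / |k|` against `β / (β² + λ²)`, which is
the Laplace transform of `sin (tβ)`. Hence `H` is the Laplace transform of a memory kernel
(`H_eq_laplace`). In polar coordinates the kernel is built from sine transforms of `r³ |ρ̂|²`. Since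
`|ρ̂|²` is the Fourier transform of an autocorrelation supported in a ball of radius `2R`, these
vanish at large arguments. This is the strong Huygens principle (`fourier_lineProfile_eq_zero`,
`memory_eq_zero`). The kernel has bounded support in time, so `H` and `M` extend to entire functions
(`exists_Hext`, `differentiable_Hext`). The boundary limit therefore exists, and the inverse is
analytic wherever the continuation is invertible.

Invertibility. A kernel vector `(Q, P)` of `M(iω)` forces `Q̄·F(iω)Q` to be real, because `B_v` is
hermitian, and `K` contributes only a real form. On the other hand, `Im Q̄·H(iω + ε)Q / (-ω)` is the
integral of a nonnegative density against a kernel of height of order `1/ε` on the shell of width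
`ε` around `β = |ω|`. The shell has `|Q·k|²`-mass at least `cε`, and the Wiener condition bounds
`|ρ̂|` below there, so the imaginary part does not vanish in the limit unless `Q = 0`
(`exists_im_hform_lower`).

Eigenvalues. For `λ ≠ 0` the field equations give `Ψ ∈ L²` and a multiplication equation: symbol
times `Ψ̂` equals a multiple of `(Q·ξ) ρ̂` (`IsEigenpair.fourier`). On the imaginary axis the symbol
vanishes to first order on an ellipsoid, and `Q ≠ 0` would make `Ψ̂` fail to be square integrable
there. On the real axis the real part of the symbol exceeds its value at `λ = 0`, so `λ Q̄·P` has
nonpositive real part, against the positivity of `B_v`. In both cases `Q = 0`, and then everything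
else vanishes because the symbol is nonzero almost everywhere. -/

lemma integrable_mul_of_memLp_two {f g : E3 → ℂ} (hf : MemLp f 2) (hg : MemLp g 2) :
    Integrable (fun x => f x * g x) :=
  hf.integrable_mul hg

lemma integrable_smul_of_memLp_two {f : E3 → ℝ} {g : E3 → ℂ} (hf : MemLp f 2) (hg : MemLp g 2) :
    Integrable (fun x => f x • g x) := by
  have := integrable_mul_of_memLp_two hf.ofReal hg
  simpa [Complex.real_smul] using this

/-- A weak divergence identity extends from test functions to smooth real functions that are square
integrable together with their first derivatives. -/
lemma weak_div_smooth_real {f : Fin 3 → E3 → ℂ} {h : E3 → ℂ} (hf : ∀ j, MemLp (f j) 2)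
    (hh : MemLp h 2)
    (hw : ∀ φ : E3 → ℝ, IsTest φ → ∑ j, ∫ x, partialD j φ x • f j x = -∫ x, φ x • h x)
    {u : E3 → ℝ} (hu : ContDiff ℝ ∞ u) (hu2 : MemLp u 2) (hdu : ∀ j, MemLp (partialD j u) 2) :
    ∑ j, ∫ x, partialD j u x • f j x = -∫ x, u x • h x := by
  -- The cut-offs `χ(x/(n+1))` tend to 1 pointwise and their partial derivatives are at most
  -- `C/(n+1)`, so the extra term in the product rule disappears in the limit.
  let χ : ContDiffBump (0 : E3) := ⟨1, 2, one_pos, one_lt_two⟩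
  have hχ : ContDiff ℝ ∞ χ := χ.contDiff
  obtain ⟨C, hC⟩ : ∃ C, ∀ x, ‖fderiv ℝ χ x‖ ≤ C :=
    (hχ.continuous_fderiv (by simp)).bounded_above_of_compact_support
      (χ.hasCompactSupport.fderiv (𝕜 := ℝ))
  have hC0 : 0 ≤ C := (norm_nonneg _).trans (hC 0)
  let c : ℕ → ℝ := fun n => ((n : ℝ) + 1)⁻¹
  have hc0 : ∀ n, 0 < c n := fun n => by positivity
  have hc1 : ∀ n, c n ≤ 1 := fun n => inv_le_one_of_one_le₀ (by simp)
  have hct : Tendsto c atTop (𝓝 0) := by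
    simpa [c, one_div] using tendsto_one_div_add_atTop_nhds_zero_nat (𝕜 := ℝ)
  let χn : ℕ → E3 → ℝ := fun n x => χ (c n • x)
  have hχn : ∀ n, ContDiff ℝ ∞ (χn n) := fun n => hχ.comp (contDiff_const_smul (c n))
  have hχn1 : ∀ n x, ‖χn n x‖ ≤ 1 := fun n x => by
    rw [Real.norm_of_nonneg χ.nonneg]; exact χ.le_one
  have hdχ : ∀ n x j, partialD j (χn n) x = c n * partialD j χ (c n • x) := by
    intro n x j
    have h1 : HasFDerivAt (χn n) ((fderiv ℝ χ (c n • x)).comp (c n • ContinuousLinearMap.id ℝ E3)) x :=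
      ((hχ.differentiable (by simp) _).hasFDerivAt).comp x
        ((hasFDerivAt_id x).const_smul (c n))
    simp only [partialD, h1.fderiv]
    simp
  have hdχb : ∀ n x j, ‖partialD j (χn n) x‖ ≤ c n * C := by
    intro n x j
    rw [hdχ, norm_mul, Real.norm_of_nonneg (hc0 n).le]
    refine mul_le_mul_of_nonneg_left ?_ (hc0 n).le
    refine ((fderiv ℝ χ (c n • x)).le_opNorm _).trans ?_
    simpa using hC (c n • x)
  have hcomp : ∀ n, HasCompactSupport (χn n) := fun n =>
    χ.hasCompactSupport.comp_smul (hc0 n).ne'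
  have hprod : ∀ n x j, partialD j (fun y => χn n y * u y) x
      = χn n x * partialD j u x + partialD j (χn n) x * u x := by
    intro n x j
    have h1 := ((hχn n).differentiable (by simp) x)
    have h2 := (hu.differentiable (by simp) x)
    simp only [partialD]
    rw [show (fun y => χn n y * u y) = χn n * u from rfl, fderiv_mul h1 h2]
    simp [mul_comm]
  have key : ∀ n, ∑ j, ∫ x, partialD j (fun y => χn n y * u y) x • f j x
      = -∫ x, (χn n x * u x) • h x := fun n =>
    hw _ ⟨(hχn n).mul hu, (hcomp n).mul_right⟩
  have hlim : ∀ x, Tendsto (fun n => χn n x) atTop (𝓝 1) := by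
    intro x
    have : Tendsto (fun n => χ (c n • x)) atTop (𝓝 (χ ((0:ℝ) • x))) :=
      (hχ.continuous.tendsto _).comp (hct.smul_const x)
    rw [zero_smul] at this
    simpa [χn, χ.one_of_mem_closedBall (Metric.mem_closedBall_self χ.rIn_pos.le)] using this
  have hdlim : ∀ x j, Tendsto (fun n => partialD j (χn n) x) atTop (𝓝 0) := by
    intro x j
    refine squeeze_zero_norm (fun n => hdχb n x j) ?_
    simpa using hct.mul_const C
  have L1 : Tendsto (fun n => ∑ j, ∫ x, partialD j (fun y => χn n y * u y) x • f j x) atTop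
      (𝓝 (∑ j, ∫ x, partialD j u x • f j x)) := by
    refine tendsto_finsetSum _ fun j _ => ?_
    refine tendsto_integral_of_dominated_convergence
      (fun x => ‖partialD j u x • f j x‖ + C * ‖u x • f j x‖) ?_ ?_ ?_ ?_
    · intro n
      have hs : ContDiff ℝ ∞ (fun y => χn n y * u y) := (hχn n).mul hu
      have : Continuous (partialD j (fun y => χn n y * u y)) :=
        (hs.continuous_fderiv (by simp)).clm_apply continuous_const
      exact this.aestronglyMeasurable.smul (hf j).1
    · exact ((integrable_smul_of_memLp_two (hdu j) (hf j)).norm).add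
        ((integrable_smul_of_memLp_two hu2 (hf j)).norm.const_mul C)
    · intro n
      refine Eventually.of_forall fun x => ?_
      simp only [hprod, norm_smul]
      rw [← mul_assoc, ← add_mul]
      gcongr
      refine (norm_add_le _ _).trans ?_
      rw [norm_mul, norm_mul]
      gcongr
      · exact mul_le_of_le_one_left (norm_nonneg _) (hχn1 n x)
      · exact (hdχb n x j).trans (mul_le_of_le_one_left hC0 (hc1 n))
    · refine Eventually.of_forall fun x => ?_
      simp only [hprod]
      have := (((hlim x).mul_const (partialD j u x)).add ((hdlim x j).mul_const (u x))).smul_const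
        (f j x)
      simpa using this
  have L2 : Tendsto (fun n => -∫ x, (χn n x * u x) • h x) atTop (𝓝 (-∫ x, u x • h x)) := by
    refine Tendsto.neg (tendsto_integral_of_dominated_convergence (fun x => ‖u x • h x‖) ?_ ?_ ?_ ?_)
    · intro n
      exact (((hχn n).mul hu).continuous.aestronglyMeasurable).smul hh.1
    · exact (integrable_smul_of_memLp_two hu2 hh).norm
    · intro n
      refine Eventually.of_forall fun x => ?_
      rw [norm_smul, norm_smul, norm_mul]
      gcongr
      exact mul_le_of_le_one_left (norm_nonneg _) (hχn1 n x)
    · refine Eventually.of_forall fun x => ?_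
      simpa using ((hlim x).mul_const (u x)).smul_const (h x)
  simp only [key] at L1
  exact tendsto_nhds_unique L1 L2

/-- A weak divergence identity extends to complex Schwartz functions. -/
lemma weak_div_schwartz {f : Fin 3 → E3 → ℂ} {h : E3 → ℂ} (hf : ∀ j, MemLp (f j) 2)
    (hh : MemLp h 2)
    (hw : ∀ φ : E3 → ℝ, IsTest φ → ∑ j, ∫ x, partialD j φ x • f j x = -∫ x, φ x • h x)
    (u : 𝓢(E3, ℂ)) :
    ∑ j, ∫ x, partialD j u x * f j x = -∫ x, u x * h x := by
  have hus : ContDiff ℝ ∞ u := u.smooth ⊤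
  have hdiff : Differentiable ℝ u := hus.differentiable (by simp)
  have hu2 : MemLp u 2 := u.memLp 2
  have hdu : ∀ j, MemLp (partialD j u) 2 := fun j =>
    (LineDeriv.lineDerivOp (EuclideanSpace.single j (1:ℝ)) u : 𝓢(E3, ℂ)).memLp 2 volume
  have hL : ∀ (L : ℂ →L[ℝ] ℝ) (j : Fin 3) x,
      partialD j (fun y => L (u y)) x = L (partialD j u x) := by
    intro L j x
    have h1 : HasFDerivAt (fun y => L (u y)) (L.comp (fderiv ℝ u x)) x :=
      L.hasFDerivAt.comp x (hdiff x).hasFDerivAt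
    simp [partialD, h1.fderiv]
  -- The hypothesis concerns real test functions only, so real and imaginary parts are treated
  -- separately.
  have hre := weak_div_smooth_real hf hh hw (u := fun x => (u x).re)
    (Complex.reCLM.contDiff.comp hus) hu2.re
    (fun j => by
      have := (hdu j).re
      refine this.congr_norm (Continuous.aestronglyMeasurable ?_) ?_
      · exact (((Complex.reCLM.contDiff (n := ∞)).comp hus).continuous_fderiv (by simp)).clm_apply
          continuous_const
      · refine Eventually.of_forall fun x => ?_
        rw [show partialD j (fun x => (u x).re) x = (partialD j u x).re from hL Complex.reCLM j x]
        rfl)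
  have him := weak_div_smooth_real hf hh hw (u := fun x => (u x).im)
    (Complex.imCLM.contDiff.comp hus) hu2.im
    (fun j => by
      have := (hdu j).im
      refine this.congr_norm (Continuous.aestronglyMeasurable ?_) ?_
      · exact (((Complex.imCLM.contDiff (n := ∞)).comp hus).continuous_fderiv (by simp)).clm_apply
          continuous_const
      · refine Eventually.of_forall fun x => ?_
        rw [show partialD j (fun x => (u x).im) x = (partialD j u x).im from hL Complex.imCLM j x]
        rfl)
  have hsplit : ∀ (a b : E3 → ℂ), MemLp a 2 → MemLp b 2 →
      ∫ x, a x * b x = (∫ x, (a x).re • b x) + Complex.I * ∫ x, (a x).im • b x := by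
    intro a b ha hb
    rw [← integral_const_mul, ← integral_add
      (f := fun x => (a x).re • b x) (g := fun x => Complex.I * (a x).im • b x)
      (integrable_smul_of_memLp_two ha.re hb)
      ((integrable_smul_of_memLp_two ha.im hb).const_mul _)]
    refine integral_congr_ae (Eventually.of_forall fun x => ?_)
    simp only [Complex.real_smul]
    conv_lhs => rw [← Complex.re_add_im (a x)]
    ring
  rw [hsplit _ _ hu2 hh, neg_add, ← mul_neg, ← hre, ← him, Finset.mul_sum, ← Finset.sum_add_distrib]
  refine Finset.sum_congr rfl fun j _ => ?_
  rw [hsplit _ _ (hdu j) (hf j)]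
  congr 2
  · simp only [show ∀ x, partialD j (fun x => (u x).re) x = (partialD j u x).re from
      hL Complex.reCLM j]
  · simp only [show ∀ x, partialD j (fun x => (u x).im) x = (partialD j u x).im from
      hL Complex.imCLM j]

/-- The Fourier transform on `L²` is self-adjoint with respect to the bilinear pairing. -/
lemma integral_fourier_mul_Lp (u : 𝓢(E3, ℂ)) (f : Lp (α := E3) ℂ 2) :
    ∫ x, 𝓕 u x * f x = ∫ x, u x * (𝓕 f : Lp (α := E3) ℂ 2) x := by
  have h1 := congrArg (fun T => T u) (Lp.fourier_toTemperedDistribution_eq f)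
  simpa [TemperedDistribution.fourier_apply] using h1

lemma locallyIntegrable_of_memLp_two {f : E3 → ℂ} (hf : MemLp f 2) : LocallyIntegrable f :=
  hf.locallyIntegrable (by norm_num)

/-- A real test function, as a complex Schwartz function. -/
noncomputable def testSchwartz (φ : E3 → ℝ) (h1 : ContDiff ℝ ∞ φ) (h2 : HasCompactSupport φ) :
    𝓢(E3, ℂ) :=
  (h2.comp_left (g := fun r : ℝ => (r : ℂ)) Complex.ofReal_zero).toSchwartzMap
    (Complex.ofRealCLM.contDiff.comp h1)

lemma testSchwartz_apply (φ : E3 → ℝ) (h1 : ContDiff ℝ ∞ φ) (h2 : HasCompactSupport φ) (x : E3) :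
    testSchwartz φ h1 h2 x = φ x := rfl

/-- The Fourier transform of a square integrable function. -/
noncomputable def fourierL2 {f : E3 → ℂ} (hf : MemLp f 2) : Lp ℂ 2 (volume : Measure E3) :=
  𝓕 (hf.toLp f)

lemma memLp_fourierL2 {f : E3 → ℂ} (hf : MemLp f 2) : MemLp (fourierL2 hf) 2 := Lp.memLp _

lemma integral_fourier_mul_eq_fourierL2 (u : 𝓢(E3, ℂ)) {f : E3 → ℂ} (hf : MemLp f 2) :
    ∫ x, 𝓕 u x * f x = ∫ x, u x * fourierL2 hf x := by
  rw [fourierL2, ← integral_fourier_mul_Lp]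
  refine integral_congr_ae ?_
  filter_upwards [hf.coeFn_toLp] with x hx
  rw [hx]

/-- The Fourier transform of a weak divergence identity. -/
lemma fourier_weak_div {f : Fin 3 → E3 → ℂ} {h : E3 → ℂ} (hf : ∀ j, MemLp (f j) 2)
    (hh : MemLp h 2)
    (hw : ∀ φ : E3 → ℝ, IsTest φ → ∑ j, ∫ x, partialD j φ x • f j x = -∫ x, φ x • h x) :
    ∀ᵐ ξ : E3, ∑ j, 2 * Real.pi * Complex.I * (ξ j : ℂ) * fourierL2 (hf j) ξ
      = fourierL2 hh ξ := by
  have hcont : ∀ j : Fin 3, Continuous (fun ξ : E3 => 2 * Real.pi * Complex.I * (ξ j : ℂ)) := by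
    intro j; fun_prop
  have hloc : ∀ j, LocallyIntegrable
      (fun ξ : E3 => 2 * Real.pi * Complex.I * (ξ j : ℂ) * fourierL2 (hf j) ξ) := by
    intro j
    have := locallyIntegrable_of_memLp_two (memLp_fourierL2 (hf j))
    rw [← locallyIntegrableOn_univ] at this ⊢
    exact this.continuousOn_mul (hcont j).continuousOn isClosed_univ.isLocallyClosed
  refine ae_eq_of_integral_contDiff_smul_eq ?_
    (locallyIntegrable_of_memLp_two (memLp_fourierL2 hh)) fun φ h1 h2 => ?_
  · have := locallyIntegrable_finsetSum (Finset.univ) (fun j _ => hloc j)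
    exact this
  -- Testing against `𝓕 φ` turns `∂_j` into multiplication of `φ` by `-2πi ξ_j`; self-adjointness
  -- then moves `𝓕` onto `f j` and `h`.
  have key := weak_div_schwartz hf hh hw (𝓕 (testSchwartz φ h1 h2))
  rw [integral_fourier_mul_eq_fourierL2 _ hh, ← neg_eq_iff_eq_neg] at key
  simp only [testSchwartz_apply] at key
  simp only [Complex.real_smul]
  rw [← key, ← Finset.sum_neg_distrib]
  simp only [Finset.mul_sum]
  rw [integral_finsetSum]
  · refine Finset.sum_congr rfl fun j _ => ?_
    have hg : (fun x : E3 => inner ℝ x (EuclideanSpace.single j (1:ℝ))).HasTemperateGrowth := by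
      fun_prop
    have e1 : ∀ x, partialD j (⇑(𝓕 (testSchwartz φ h1 h2) : 𝓢(E3, ℂ))) x = 𝓕 (-(2 * Real.pi * Complex.I) •
        SchwartzMap.smulLeftCLM ℂ (fun x : E3 => inner ℝ x (EuclideanSpace.single j (1:ℝ)))
          (testSchwartz φ h1 h2)) x := by
      intro x
      rw [← SchwartzMap.lineDerivOp_fourier_eq]
      rfl
    simp only [e1]
    rw [integral_fourier_mul_eq_fourierL2 _ (hf j), ← integral_neg]
    refine integral_congr_ae (Eventually.of_forall fun x => ?_)
    beta_reduce
    rw [_root_.smul_apply, SchwartzMap.smulLeftCLM_apply_apply hg, testSchwartz_apply,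
      EuclideanSpace.inner_single_right]
    simp only [smul_eq_mul, Complex.real_smul, one_mul, conj_trivial]
    ring
  · intro j _
    have := (hloc j).integrable_smul_left_of_hasCompactSupport h1.continuous h2
    simpa only [Complex.real_smul] using this

/-- The Fourier transform on `L¹ ∩ L²` is given by the Fourier integral. -/
lemma fourierL2_ae_eq {f : E3 → ℂ} (hf1 : Integrable f) (hf : MemLp f 2) :
    fourierL2 hf =ᵐ[volume] 𝓕 f := by
  have hcont : Continuous (𝓕 f) :=
    VectorFourier.fourierIntegral_continuous Real.continuous_fourierChar continuous_inner hf1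
  refine ae_eq_of_integral_contDiff_smul_eq
    (locallyIntegrable_of_memLp_two (memLp_fourierL2 hf)) hcont.locallyIntegrable fun φ h1 h2 => ?_
  have e1 := integral_fourier_mul_eq_fourierL2 (testSchwartz φ h1 h2) hf
  simp only [testSchwartz_apply] at e1
  have e2 := VectorFourier.integral_fourierIntegral_smul_eq_flip (μ := volume) (ν := volume)
    (L := innerₗ E3) (f := testSchwartz φ h1 h2) (g := f) Real.continuous_fourierChar
    continuous_inner (testSchwartz φ h1 h2).integrable hf1
  simp only [Complex.real_smul]
  rw [← e1]
  refine Eq.trans ?_ (e2.trans ?_)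
  · rfl
  · simp only [testSchwartz_apply, flip_innerₗ]
    rfl

/-- Plancherel's theorem. -/
lemma integral_conj_mul_fourierL2 {f g : E3 → ℂ} (hf : MemLp f 2) (hg : MemLp g 2) :
    ∫ ξ, (starRingEnd ℂ) (fourierL2 hf ξ) * fourierL2 hg ξ = ∫ x, (starRingEnd ℂ) (f x) * g x := by
  have h := Lp.inner_fourier_eq (hf.toLp f) (hg.toLp g)
  rw [L2.inner_def, L2.inner_def] at h
  simp only [RCLike.inner_apply] at h
  refine Eq.trans ?_ (h.trans ?_)
  · refine integral_congr_ae (Eventually.of_forall fun x => ?_)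
    exact mul_comm _ _
  · refine integral_congr_ae ?_
    filter_upwards [hf.coeFn_toLp, hg.coeFn_toLp] with x hx hy
    rw [hx, hy, mul_comm]

lemma ae_eq_zero_of_fourierL2 {f : E3 → ℂ} (hf : MemLp f 2) (h : fourierL2 hf =ᵐ[volume] 0) :
    f =ᵐ[volume] 0 := by
  have h0 : fourierL2 hf = 0 := Lp.ext (h.trans (Lp.coeFn_zero _ _ _).symm)
  have h1 : ‖hf.toLp f‖ = 0 := by
    rw [← Lp.norm_fourier_eq]
    exact norm_eq_zero.2 h0
  have h2 : hf.toLp f = 0 := norm_eq_zero.1 h1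
  exact (hf.coeFn_toLp.symm.trans (by rw [h2])).trans (Lp.coeFn_zero _ _ _)

lemma fourierL2_congr {f g : E3 → ℂ} (hf : MemLp f 2) (hg : MemLp g 2) (h : f =ᵐ[volume] g) :
    fourierL2 hf = fourierL2 hg := by
  unfold fourierL2
  rw [(MemLp.toLp_eq_toLp_iff hf hg).2 h]

lemma fourierL2_add {f g : E3 → ℂ} (hf : MemLp f 2) (hg : MemLp g 2) :
    fourierL2 (hf.add hg) =ᵐ[volume] fun ξ => fourierL2 hf ξ + fourierL2 hg ξ := by
  have : fourierL2 (hf.add hg) = fourierL2 hf + fourierL2 hg := by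
    unfold fourierL2
    rw [MemLp.toLp_add, FourierTransform.fourier_add]
  rw [this]
  exact Lp.coeFn_add _ _

lemma fourierL2_const_mul {f : E3 → ℂ} (c : ℂ) (hf : MemLp f 2) (hcf : MemLp (fun x => c * f x) 2) :
    fourierL2 hcf =ᵐ[volume] fun ξ => c * fourierL2 hf ξ := by
  have : fourierL2 hcf = c • fourierL2 hf := by
    unfold fourierL2
    rw [← FourierTransform.fourier_smul, ← MemLp.toLp_const_smul]
    rfl
  rw [this]
  exact Lp.coeFn_smul _ _

/-! ### Shells of a homogeneous function -/

/-- The function `k ↦ |k| - k·v`, whose level sets are ellipsoids. -/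
noncomputable def beta (v k : E3) : ℝ := ‖k‖ - ⟪k, v⟫_ℝ

lemma continuous_beta (v : E3) : Continuous (beta v) := by unfold beta; fun_prop

lemma beta_smul (v k : E3) {s : ℝ} (hs : 0 ≤ s) : beta v (s • k) = s * beta v k := by
  rw [beta, beta, norm_smul, real_inner_smul_left, Real.norm_of_nonneg hs]; ring

lemma abs_inner_le_mul_norm (v k : E3) : |⟪k, v⟫_ℝ| ≤ ‖v‖ * ‖k‖ := by
  rw [mul_comm]; exact abs_real_inner_le_norm k v

lemma le_beta (v k : E3) : (1 - ‖v‖) * ‖k‖ ≤ beta v k := by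
  have := abs_le.1 (abs_inner_le_mul_norm v k)
  unfold beta; nlinarith

lemma beta_le (v k : E3) : beta v k ≤ (1 + ‖v‖) * ‖k‖ := by
  have := abs_le.1 (abs_inner_le_mul_norm v k)
  unfold beta; nlinarith

lemma measurableSet_beta_lt (v : E3) (s : ℝ) : MeasurableSet {k | beta v k < s} :=
  (isOpen_lt (continuous_beta v) continuous_const).measurableSet

lemma measurableSet_shell (v : E3) (a b : ℝ) : MeasurableSet {k | a ≤ beta v k ∧ beta v k < b} :=
  (isClosed_le continuous_const (continuous_beta v)).measurableSet.inter
    (measurableSet_beta_lt v b)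

lemma lintegral_eq_smul (f : E3 → ENNReal) (hf : Measurable f) {s : ℝ} (hs : 0 < s) :
    ∫⁻ k, f k = ENNReal.ofReal (s ^ 3) * ∫⁻ k, f (s • k) := by
  have h := Measure.map_addHaar_smul (volume : Measure E3) hs.ne'
  have h1 : ∫⁻ k, f (s • k) = ∫⁻ k, f k ∂(Measure.map (fun x : E3 => s • x) volume) :=
    (lintegral_map hf (measurable_const_smul s)).symm
  rw [h1, h, lintegral_smul_measure, smul_eq_mul, ← mul_assoc,
    ← ENNReal.ofReal_mul (by positivity)]
  have : s ^ 3 * |(s ^ Module.finrank ℝ E3)⁻¹| = 1 := by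
    rw [abs_of_pos (by positivity)]
    simp [hs.ne']
  rw [this]; simp

/-- Scaling of the integral of a homogeneous weight over the sublevel sets of `beta`. -/
lemma lintegral_beta_lt (v : E3) {w : E3 → ENNReal} (hw : Measurable w) (p : ℕ)
    (hhom : ∀ s : ℝ, 0 < s → ∀ k, w (s • k) = ENNReal.ofReal (s ^ p) * w k) {s : ℝ} (hs : 0 < s) :
    ∫⁻ k in {k | beta v k < s}, w k
      = ENNReal.ofReal (s ^ (p + 3)) * ∫⁻ k in {k | beta v k < 1}, w k := by
  rw [← lintegral_indicator (measurableSet_beta_lt v s),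
    ← lintegral_indicator (measurableSet_beta_lt v 1),
    lintegral_eq_smul _ (hw.indicator (measurableSet_beta_lt v s)) hs]
  have : ∀ k, ({k | beta v k < s}.indicator w (s • k))
      = ENNReal.ofReal (s ^ p) * ({k | beta v k < 1}.indicator w k) := by
    intro k
    simp only [Set.indicator, Set.mem_ofPred_eq, beta_smul v k hs.le, mul_ite, mul_zero, hhom s hs]
    congr 1
    rw [mul_lt_iff_lt_one_right hs]
  simp only [this]
  rw [lintegral_const_mul _ (hw.indicator (measurableSet_beta_lt v 1)), ← mul_assoc,
    ← ENNReal.ofReal_mul (by positivity), ← pow_add, add_comm 3 p]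

/-- The shell is a difference of two sublevel sets, whose masses scale like `s ^ (p + 3)`;
finiteness of the unit mass makes the subtraction in `ENNReal` legitimate. -/
lemma lintegral_shell (v : E3) {w : E3 → ENNReal} (hw : Measurable w) (p : ℕ)
    (hhom : ∀ s : ℝ, 0 < s → ∀ k, w (s • k) = ENNReal.ofReal (s ^ p) * w k)
    (hfin : ∫⁻ k in {k | beta v k < 1}, w k ≠ ⊤) {a b : ℝ} (ha : 0 < a) (hab : a ≤ b) :
    ∫⁻ k in {k | a ≤ beta v k ∧ beta v k < b}, w k
      = ENNReal.ofReal ((b ^ (p + 3) - a ^ (p + 3)) *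
        (∫⁻ k in {k | beta v k < 1}, w k).toReal) := by
  have hun : {k | beta v k < b} = {k | beta v k < a} ∪ {k | a ≤ beta v k ∧ beta v k < b} := by
    ext k; simp only [Set.mem_ofPred_eq, Set.mem_union]
    constructor
    · intro h; rcases lt_or_ge (beta v k) a with h1 | h1
      · exact Or.inl h1
      · exact Or.inr ⟨h1, h⟩
    · rintro (h | h)
      · exact h.trans_le hab
      · exact h.2
  have hd : Disjoint {k | beta v k < a} {k | a ≤ beta v k ∧ beta v k < b} :=
    Set.disjoint_left.2 fun k h1 h2 => not_lt.2 h2.1 h1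
  have h := lintegral_union (μ := volume) (f := w) (measurableSet_shell v a b) hd
  rw [← hun, lintegral_beta_lt v hw p hhom (ha.trans_le hab), lintegral_beta_lt v hw p hhom ha] at h
  set I := ∫⁻ k in {k | beta v k < 1}, w k with hI
  rw [← ENNReal.ofReal_toReal hfin, ← ENNReal.ofReal_mul (pow_nonneg (ha.trans_le hab).le _),
    ← ENNReal.ofReal_mul (pow_nonneg ha.le _)] at h
  rw [sub_mul, ENNReal.ofReal_sub _ (by positivity), h, ENNReal.add_sub_cancel_left (by simp)]

lemma volume_beta_lt_one_ne_top {v : E3} (hv : ‖v‖ < 1) : volume {k | beta v k < 1} ≠ ⊤ := by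
  have hsub : {k | beta v k < 1} ⊆ Metric.closedBall 0 (1 / (1 - ‖v‖)) := by
    intro k hk
    rw [mem_closedBall_zero_iff, le_div_iff₀ (by linarith)]
    have := le_beta v k
    simp only [Set.mem_ofPred_eq] at hk
    linarith
  exact ((measure_mono hsub).trans_lt measure_closedBall_lt_top).ne

/-- The level sets of `beta` are null sets. -/
lemma ae_beta_ne {v : E3} (hv : ‖v‖ < 1) {s : ℝ} (hs : 0 < s) : ∀ᵐ k, beta v k ≠ s := by
  have hfin : ∫⁻ k in {k | beta v k < 1}, (1 : ENNReal) ≠ ⊤ := by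
    simpa using volume_beta_lt_one_ne_top hv
  -- The level set lies in every shell `s ≤ β < b`, and the volume of that shell tends to zero as `b
  -- ↓ s`.
  have hb : ∀ b, s < b → volume {k | beta v k = s} ≤ ENNReal.ofReal ((b ^ (0 + 3) - s ^ (0 + 3)) *
        (∫⁻ k in {k | beta v k < 1}, (1 : ENNReal)).toReal) := by
    intro b hb
    rw [← lintegral_shell v measurable_const 0 (by simp) hfin hs hb.le]
    simp only [lintegral_const, Measure.restrict_apply MeasurableSet.univ, Set.univ_inter, one_mul]
    refine measure_mono fun k hk => ?_
    simp only [Set.mem_ofPred_eq] at hk ⊢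
    exact ⟨hk.ge, hk.trans_lt hb⟩
  have hlim : Tendsto (fun b : ℝ => ENNReal.ofReal ((b ^ (0 + 3) - s ^ (0 + 3)) *
        (∫⁻ k in {k | beta v k < 1}, (1 : ENNReal)).toReal)) (𝓝[>] s) (𝓝 0) := by
    have : Continuous (fun b : ℝ => ENNReal.ofReal ((b ^ (0 + 3) - s ^ (0 + 3)) *
        (∫⁻ k in {k | beta v k < 1}, (1 : ENNReal)).toReal)) :=
      ENNReal.continuous_ofReal.comp (by fun_prop)
    have h := (this.tendsto s).mono_left (nhdsWithin_le_nhds (s := Set.Ioi s))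
    simpa using h
  have h0 : volume {k | beta v k = s} ≤ 0 :=
    ge_of_tendsto hlim (eventually_mem_nhdsWithin.mono fun b hb' => hb b hb')
  rw [ae_iff]
  simpa using h0

/-- The complex bilinear product `Q·k`. -/
noncomputable def dotQ (Q : Fin 3 → ℂ) (k : E3) : ℂ := ∑ j, Q j * (k j : ℂ)

lemma continuous_dotQ (Q : Fin 3 → ℂ) : Continuous (dotQ Q) := by unfold dotQ; fun_prop

lemma dotQ_smul (Q : Fin 3 → ℂ) (s : ℝ) (k : E3) : dotQ Q (s • k) = s * dotQ Q k := by
  simp only [dotQ, Finset.mul_sum, PiLp.smul_apply, smul_eq_mul, Complex.ofReal_mul]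
  exact Finset.sum_congr rfl fun _ _ => by ring

lemma norm_dotQ_le (Q : Fin 3 → ℂ) (k : E3) : ‖dotQ Q k‖ ≤ (∑ j, ‖Q j‖) * ‖k‖ := by
  rw [dotQ, Finset.sum_mul]
  refine (norm_sum_le _ _).trans (Finset.sum_le_sum fun j _ => ?_)
  rw [norm_mul, Complex.norm_real]
  exact mul_le_mul_of_nonneg_left (PiLp.norm_apply_le k j) (norm_nonneg _)

/-- The weight `|Q·k|²` has mass of order `ε` in the shell of width `ε` around a level set. -/
lemma exists_shell_lower_bound {v : E3} (hv : ‖v‖ < 1) {Q : Fin 3 → ℂ} (hQ : Q ≠ 0) {s : ℝ}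
    (hs : 0 < s) :
    ∃ c : ℝ, 0 < c ∧ ∀ ε : ℝ, 0 < ε → ε < s → ENNReal.ofReal (c * ε) ≤
      ∫⁻ k in {k | s - ε ≤ beta v k ∧ beta v k < s + ε}, ENNReal.ofReal (‖dotQ Q k‖ ^ 2) := by
  set w : E3 → ENNReal := fun k => ENNReal.ofReal (‖dotQ Q k‖ ^ 2) with hwdef
  have hwc : Continuous w :=
    ENNReal.continuous_ofReal.comp ((continuous_dotQ Q).norm.pow 2)
  have hhom : ∀ s : ℝ, 0 < s → ∀ k, w (s • k) = ENNReal.ofReal (s ^ 2) * w k := by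
    intro s hs k
    simp only [hwdef]
    rw [dotQ_smul, norm_mul, mul_pow, ENNReal.ofReal_mul (by positivity), Complex.norm_real,
      Real.norm_of_nonneg hs.le]
  have hfin : ∫⁻ k in {k | beta v k < 1}, w k ≠ ⊤ := by
    refine ne_top_of_le_ne_top ?_ (setLIntegral_mono' (measurableSet_beta_lt v 1)
      (g := fun _ => ENNReal.ofReal (((∑ j, ‖Q j‖) * (1 / (1 - ‖v‖))) ^ 2)) fun k hk => ?_)
    · rw [setLIntegral_const]
      exact ENNReal.mul_ne_top (by simp) (volume_beta_lt_one_ne_top hv)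
    · refine ENNReal.ofReal_le_ofReal ?_
      refine pow_le_pow_left₀ (norm_nonneg _) ((norm_dotQ_le Q k).trans ?_) 2
      refine mul_le_mul_of_nonneg_left ?_ (by positivity)
      rw [le_div_iff₀ (by linarith)]
      have := le_beta v k
      simp only [Set.mem_ofPred_eq] at hk
      linarith
  have hpos : ∫⁻ k in {k | beta v k < 1}, w k ≠ 0 := by
    obtain ⟨j, hj⟩ : ∃ j, Q j ≠ 0 := Function.ne_iff.1 hQ
    have hopen : IsOpen ({k | beta v k < 1} ∩ {k | dotQ Q k ≠ 0}) :=
      (isOpen_lt (continuous_beta v) continuous_const).inter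
        (isOpen_ne_fun (continuous_dotQ Q) continuous_const)
    have hne : ({k | beta v k < 1} ∩ {k | dotQ Q k ≠ 0}).Nonempty := by
      -- At `e_j / 3` one has `β ≤ (1 + |v|)/3 < 1` and `Q·k = Q_j / 3 ≠ 0`.
      refine ⟨EuclideanSpace.single j (1 / 3 : ℝ), ?_, ?_⟩
      · have := beta_le v (EuclideanSpace.single j (1 / 3 : ℝ))
        simp only [PiLp.norm_single] at this
        simp only [Set.mem_ofPred_eq]
        norm_num at this
        linarith
      · simp [dotQ, hj, PiLp.single_apply, apply_ite]
    have h1 := hopen.measure_pos volume hne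
    intro h0
    rw [setLIntegral_eq_zero_iff (measurableSet_beta_lt v 1) hwc.measurable] at h0
    have : volume ({k | beta v k < 1} ∩ {k | dotQ Q k ≠ 0}) = 0 := by
      refine measure_mono_null ?_ (ae_iff.1 h0)
      rintro k ⟨h1, h2⟩
      simp only [Set.mem_ofPred_eq] at h1 h2 ⊢
      simp [h1, hwdef, h2]
    exact h1.ne' this
  have hI : 0 < (∫⁻ k in {k | beta v k < 1}, w k).toReal := ENNReal.toReal_pos hpos hfin
  -- By homogeneity the mass is proportional to `(s+ε)⁵ - (s-ε)⁵`, whose leading term is `10 s⁴ ε`;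
  -- the coefficient 2 suffices.
  refine ⟨2 * s ^ 4 * (∫⁻ k in {k | beta v k < 1}, w k).toReal, by positivity, fun ε h0 h1 => ?_⟩
  rw [lintegral_shell v hwc.measurable 2 hhom hfin (by linarith) (by linarith)]
  refine ENNReal.ofReal_le_ofReal ?_
  have : 2 * s ^ 4 * ε ≤ (s + ε) ^ (2 + 3) - (s - ε) ^ (2 + 3) := by
    have e : (s + ε) ^ (2 + 3) - (s - ε) ^ (2 + 3)
        = 2 * s ^ 4 * ε + (8 * s ^ 4 * ε + 20 * s ^ 2 * ε ^ 3 + 2 * ε ^ 5) := by ring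
    rw [e]
    have : 0 ≤ 8 * s ^ 4 * ε + 20 * s ^ 2 * ε ^ 3 + 2 * ε ^ 5 := by positivity
    linarith
  nlinarith

/-! ### The Fourier transform of the charge distribution -/

/-- The charge distribution as a complex function. -/
noncomputable def chargeC (ρ : E3 → ℝ) (x : E3) : ℂ := (ρ x : ℂ)

lemma fourier_weak_partial {f g : E3 → ℂ} (hf : MemLp f 2) (hg : MemLp g 2) (j : Fin 3)
    (hw : ∀ φ : E3 → ℝ, IsTest φ → ∫ x, partialD j φ x • f x = -∫ x, φ x • g x) :
    ∀ᵐ ξ : E3, fourierL2 hg ξ = 2 * Real.pi * Complex.I * (ξ j : ℂ) * fourierL2 hf ξ := by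
  -- The divergence identity is applied to the vector field whose only nonzero component is the
  -- `j`-th one, equal to `f`.
  have hf' : ∀ i : Fin 3, MemLp (fun x => (if i = j then (1:ℂ) else 0) * f x) 2 :=
    fun i => hf.const_mul _
  have key := fourier_weak_div hf' hg (fun φ hφ => by
    rw [← hw φ hφ, Finset.sum_eq_single j]
    · simp
    · intro i _ hij; simp [hij]
    · simp)
  have h2 : ∀ᵐ ξ : E3, ∀ i : Fin 3,
      fourierL2 (hf' i) ξ = (if i = j then (1:ℂ) else 0) * fourierL2 hf ξ :=
    ae_all_iff.2 fun i => fourierL2_const_mul _ hf (hf' i)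
  filter_upwards [key, h2] with ξ h1 h2
  rw [← h1, Finset.sum_eq_single j]
  · rw [h2]; simp
  · intro i _ hij; rw [h2]; simp [hij]
  · simp

lemma IsCharge.integrable {ρ : E3 → ℝ} (hρ : IsCharge ρ) : Integrable ρ := by
  obtain ⟨R, hR⟩ := hρ.support
  have h1 : IntegrableOn ρ (Metric.closedBall 0 R) := by
    have hfin : IsFiniteMeasure (volume.restrict (Metric.closedBall (0 : E3) R)) :=
      ⟨by simpa using measure_closedBall_lt_top (μ := volume) (x := (0 : E3)) (r := R)⟩
    exact (hρ.memLp.restrict _).integrable one_le_two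
  refine (integrableOn_iff_integrable_of_support_subset fun x hx => ?_).1 h1
  rw [mem_closedBall_zero_iff]
  by_contra h
  exact hx (hR x (not_le.1 h).le)

lemma IsCharge.integrableC {ρ : E3 → ℝ} (hρ : IsCharge ρ) : Integrable (chargeC ρ) :=
  hρ.integrable.ofReal

lemma IsCharge.memLpC {ρ : E3 → ℝ} (hρ : IsCharge ρ) : MemLp (chargeC ρ) 2 :=
  hρ.memLp.ofReal

lemma IsCharge.hasWeakPartial {ρ : E3 → ℝ} (hρ : IsCharge ρ) (j : Fin 3) :
    HasWeakPartial j ρ (weakPartial j ρ) := by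
  obtain ⟨g, h, hg, -⟩ := hρ.sobolev
  have hex : ∃ g, HasWeakPartial j ρ g := ⟨g j, (hg j).1⟩
  rw [weakPartial, dif_pos hex]
  exact hex.choose_spec

/-- `weakPartial` is an unspecified choice, so square integrability is transferred from the
derivative supplied by `sobolev`, with which it agrees almost everywhere. -/
lemma IsCharge.memLp_weakPartial {ρ : E3 → ℝ} (hρ : IsCharge ρ) (j : Fin 3) :
    MemLp (weakPartial j ρ) 2 := by
  obtain ⟨g, h, hg, -⟩ := hρ.sobolev
  have hw := hρ.hasWeakPartial j
  refine MemLp.ae_eq ?_ (hg j).2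
  refine ae_eq_of_integral_contDiff_smul_eq (hg j).1.right_int hw.right_int fun φ h1 h2 => ?_
  have e1 := hw.parts φ ⟨h1, h2⟩
  have e2 := (hg j).1.parts φ ⟨h1, h2⟩
  rw [← neg_inj, ← e1, ← e2]

/-- The weak gradient of the charge distribution as a complex function. -/
noncomputable def gradC (ρ : E3 → ℝ) (j : Fin 3) (x : E3) : ℂ := ((weakPartial j ρ x : ℝ) : ℂ)

lemma IsCharge.memLp_gradC {ρ : E3 → ℝ} (hρ : IsCharge ρ) (j : Fin 3) : MemLp (gradC ρ j) 2 :=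
  (hρ.memLp_weakPartial j).ofReal

lemma continuous_fourier_chargeC {ρ : E3 → ℝ} (hρ : IsCharge ρ) : Continuous (𝓕 (chargeC ρ)) :=
  VectorFourier.fourierIntegral_continuous Real.continuous_fourierChar continuous_inner
    hρ.integrableC

lemma IsCharge.fourier_gradC {ρ : E3 → ℝ} (hρ : IsCharge ρ) (j : Fin 3) :
    ∀ᵐ ξ : E3, fourierL2 (hρ.memLp_gradC j) ξ
      = 2 * Real.pi * Complex.I * (ξ j : ℂ) * 𝓕 (chargeC ρ) ξ := by
  have h := fourier_weak_partial hρ.memLpC (hρ.memLp_gradC j) j (fun φ hφ => by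
    have := congrArg (fun r : ℝ => (r : ℂ)) ((hρ.hasWeakPartial j).parts φ hφ)
    simp only [smul_eq_mul] at this
    rw [Complex.ofReal_neg, ← integral_complex_ofReal, ← integral_complex_ofReal] at this
    simpa [chargeC, gradC] using this)
  filter_upwards [h, fourierL2_ae_eq hρ.integrableC hρ.memLpC] with ξ h1 h2
  rw [h1, h2]

lemma IsCharge.integrable_sq_fourier {ρ : E3 → ℝ} (hρ : IsCharge ρ) :
    Integrable (fun ξ => ‖𝓕 (chargeC ρ) ξ‖ ^ 2) := by
  have : MemLp (𝓕 (chargeC ρ)) 2 :=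
    (memLp_fourierL2 hρ.memLpC).ae_eq (fourierL2_ae_eq hρ.integrableC hρ.memLpC)
  exact this.integrable_norm_pow (by norm_num)

/-- Plancherel for each component of the weak gradient, summed over the components. -/
lemma IsCharge.integrable_sq_norm_mul_fourier {ρ : E3 → ℝ} (hρ : IsCharge ρ) :
    Integrable (fun ξ => ‖ξ‖ ^ 2 * ‖𝓕 (chargeC ρ) ξ‖ ^ 2) := by
  have h1 : ∀ j : Fin 3, Integrable (fun ξ => (ξ j) ^ 2 * ‖𝓕 (chargeC ρ) ξ‖ ^ 2) := by
    intro j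
    have : Integrable (fun ξ => ‖2 * Real.pi * Complex.I * (ξ j : ℂ) * 𝓕 (chargeC ρ) ξ‖ ^ 2) :=
      ((memLp_fourierL2 (hρ.memLp_gradC j)).ae_eq (hρ.fourier_gradC j)).integrable_norm_pow
        (by norm_num)
    have h2 := this.const_mul ((2 * Real.pi) ^ 2)⁻¹
    refine h2.congr (Eventually.of_forall fun ξ => ?_)
    simp only [norm_mul, Complex.norm_I, Complex.norm_real, Complex.norm_ofNat, mul_pow,
      Real.norm_eq_abs, sq_abs, mul_one]
    field_simp
  have := integrable_finsetSum Finset.univ (fun j _ => h1 j)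
  refine this.congr (Eventually.of_forall fun ξ => ?_)
  simp only [← Finset.sum_mul, EuclideanSpace.norm_sq_eq, Real.norm_eq_abs, sq_abs]

/-- The normalization constant `(2π)^{-3/2}`. -/
noncomputable def c0 : ℝ := (2 * Real.pi) ^ (-(3 / 2) : ℝ)

lemma c0_pos : 0 < c0 := by unfold c0; positivity

lemma c0_sq : c0 ^ 2 * (2 * Real.pi) ^ 3 = 1 := by
  have h : (0 : ℝ) < 2 * Real.pi := by positivity
  rw [c0, ← Real.rpow_natCast, ← Real.rpow_mul h.le, ← Real.rpow_natCast (2 * Real.pi) 3,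
    ← Real.rpow_add h]
  norm_num

/-- `hat` uses the kernel `e^{ik·x}` with a prefactor, Mathlib's `𝓕` uses `e^{-2πi x·ξ}`; the
substitution `k = -2πξ` reconciles them. -/
lemma hat_eq_fourier (ρ : E3 → ℝ) (ξ : E3) :
    hat ρ (-(2 * Real.pi) • ξ) = c0 * 𝓕 (chargeC ρ) ξ := by
  rw [hat, Real.fourier_eq']
  congr 1
  refine integral_congr_ae (Eventually.of_forall fun x => ?_)
  simp only [real_inner_smul_left, chargeC, smul_eq_mul]
  congr 2
  rw [real_inner_comm]
  push_cast
  ring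

lemma hat_eq_fourier' (ρ : E3 → ℝ) (k : E3) :
    hat ρ k = c0 * 𝓕 (chargeC ρ) ((-(2 * Real.pi))⁻¹ • k) := by
  rw [← hat_eq_fourier, smul_inv_smul₀ (by simp)]

lemma IsCharge.continuous_hat {ρ : E3 → ℝ} (hρ : IsCharge ρ) : Continuous (hat ρ) := by
  have : hat ρ = fun k => c0 * 𝓕 (chargeC ρ) ((-(2 * Real.pi))⁻¹ • k) :=
    funext (hat_eq_fourier' ρ)
  rw [this]
  exact continuous_const.mul ((continuous_fourier_chargeC hρ).comp (continuous_const_smul _))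

lemma IsCharge.integrable_sq_hat {ρ : E3 → ℝ} (hρ : IsCharge ρ) :
    Integrable (fun k => ‖hat ρ k‖ ^ 2) := by
  have h := (hρ.integrable_sq_fourier.comp_smul (R := (-(2 * Real.pi))⁻¹)
    (by simp)).const_mul (c0 ^ 2)
  refine h.congr (Eventually.of_forall fun k => ?_)
  simp only [hat_eq_fourier', norm_mul, Complex.norm_real, Real.norm_of_nonneg c0_pos.le, mul_pow]

lemma IsCharge.integrable_sq_norm_mul_hat {ρ : E3 → ℝ} (hρ : IsCharge ρ) :
    Integrable (fun k => ‖k‖ ^ 2 * ‖hat ρ k‖ ^ 2) := by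
  have h := (hρ.integrable_sq_norm_mul_fourier.comp_smul (R := (-(2 * Real.pi))⁻¹)
    (by simp)).const_mul ((2 * Real.pi) ^ 2 * c0 ^ 2)
  refine h.congr (Eventually.of_forall fun k => ?_)
  simp only [hat_eq_fourier', norm_mul, Complex.norm_real, Real.norm_of_nonneg c0_pos.le, mul_pow,
    norm_smul, norm_inv, norm_neg, Real.norm_eq_abs, sq_abs, inv_pow]
  field_simp

/-- Interpolation through `2|k| ≤ 1 + |k|²`. The weight `|k|` is the one needed for `dens`, and for
`r³` in polar coordinates. -/
lemma IsCharge.integrable_norm_mul_hat {ρ : E3 → ℝ} (hρ : IsCharge ρ) :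
    Integrable (fun k => ‖k‖ * ‖hat ρ k‖ ^ 2) := by
  refine (hρ.integrable_sq_hat.add hρ.integrable_sq_norm_mul_hat).mono'
    ((continuous_norm.mul (hρ.continuous_hat.norm.pow 2)).aestronglyMeasurable)
    (Eventually.of_forall fun k => ?_)
  rw [Real.norm_of_nonneg (by positivity)]
  simp only [Pi.add_apply]
  nlinarith [sq_nonneg (‖k‖ - 1), sq_nonneg (‖hat ρ k‖)]

/-- The Fourier transform of a radial function is radial. -/
lemma IsCharge.hat_eq_of_norm_eq {ρ : E3 → ℝ} (hρ : IsCharge ρ) {k l : E3} (h : ‖k‖ = ‖l‖) :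
    hat ρ k = hat ρ l := by
  obtain ⟨ρ₁, hρ₁⟩ := hρ.radial
  -- Reflection in the hyperplane orthogonal to `k - l` exchanges `k` and `l`, because their norms
  -- agree, and leaves the radial `ρ` invariant.
  let A : E3 ≃ₗᵢ[ℝ] E3 := (ℝ ∙ (k - l))ᗮ.reflection
  have hA : A k = l := Submodule.reflection_sub h
  rw [hat, hat]
  congr 1
  rw [← A.measurePreserving.integral_comp A.toHomeomorph.measurableEmbedding
    (fun x => Complex.exp (Complex.I * ((⟪l, x⟫_ℝ : ℝ) : ℂ)) * (ρ x : ℂ))]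
  refine integral_congr_ae (Eventually.of_forall fun x => ?_)
  simp only
  rw [← hA, A.inner_map_map, hρ₁ x, hρ₁ (A x), A.norm_map]

lemma IsCharge.hat_neg {ρ : E3 → ℝ} (hρ : IsCharge ρ) (k : E3) : hat ρ (-k) = hat ρ k :=
  hρ.hat_eq_of_norm_eq (norm_neg k)

/-- The squared Fourier transform of the charge is bounded below on annuli. -/
lemma IsCharge.exists_hat_lower_bound {ρ : E3 → ℝ} (hρ : IsCharge ρ) (hW : Wiener ρ) {a b : ℝ}
    (ha : 0 < a) : ∃ m : ℝ, 0 < m ∧ ∀ k : E3, a ≤ ‖k‖ → ‖k‖ ≤ b → m ≤ ‖hat ρ k‖ ^ 2 := by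
  have hcomp : IsCompact (Metric.closedBall (0 : E3) b ∩ {k | a ≤ ‖k‖}) :=
    (isCompact_closedBall 0 b).inter_right (isClosed_le continuous_const continuous_norm)
  rcases Set.eq_empty_or_nonempty (Metric.closedBall (0 : E3) b ∩ {k | a ≤ ‖k‖}) with he | hne
  · refine ⟨1, one_pos, fun k h1 h2 => ?_⟩
    have : k ∈ Metric.closedBall (0 : E3) b ∩ {k | a ≤ ‖k‖} :=
      ⟨mem_closedBall_zero_iff.2 h2, h1⟩
    rw [he] at this
    exact this.elim
  · obtain ⟨k0, hk0, hmin⟩ := hcomp.exists_isMinOn hne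
      (hρ.continuous_hat.norm.pow 2).continuousOn
    refine ⟨‖hat ρ k0‖ ^ 2, ?_, fun k h1 h2 => hmin ⟨mem_closedBall_zero_iff.2 h2, h1⟩⟩
    have : k0 ≠ 0 := norm_pos_iff.1 (ha.trans_le hk0.2)
    exact pow_pos (norm_pos_iff.2 (hW k0 this)) 2

/-! ### The eigenvalue equation in Fourier variables -/

lemma IsTest.partialD {φ : E3 → ℝ} (hφ : IsTest φ) (j : Fin 3) :
    IsTest (WaveParticle.partialD j φ) := by
  refine ⟨?_, ?_⟩
  · have h1 : ContDiff ℝ ∞ (fderiv ℝ φ) := hφ.1.fderiv_right (by simp)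
    exact h1.clm_apply contDiff_const
  · exact (hφ.2.fderiv (𝕜 := ℝ)).comp_left
      (g := fun L : E3 →L[ℝ] ℝ => L (EuclideanSpace.single j 1)) rfl

lemma IsTest.memLp {φ : E3 → ℝ} (hφ : IsTest φ) (p : ENNReal) : MemLp φ p :=
  hφ.1.continuous.memLp_of_hasCompactSupport hφ.2

lemma sum_smul_single (v : E3) : ∑ j, v j • EuclideanSpace.single j (1 : ℝ) = v := by
  ext i
  simp [Pi.single_apply]

lemma fderiv_apply_eq_sum (φ : E3 → ℝ) (x v : E3) :
    fderiv ℝ φ x v = ∑ j, v j * partialD j φ x := by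
  conv_lhs => rw [← sum_smul_single v]
  simp [partialD]

lemma IsTest.laplacian_eq {φ : E3 → ℝ} (hφ : IsTest φ) (x : E3) :
    (Δ φ) x = ∑ j, WaveParticle.partialD j (WaveParticle.partialD j φ) x := by
  rw [InnerProductSpace.laplacian_eq_iteratedFDeriv_orthonormalBasis φ
    (EuclideanSpace.basisFun (Fin 3) ℝ)]
  refine Finset.sum_congr rfl fun j _ => ?_
  rw [iteratedFDeriv_two_apply]
  have h1 : ContDiff ℝ ∞ (fderiv ℝ φ) := hφ.1.fderiv_right (by simp)
  have h2 : DifferentiableAt ℝ (fderiv ℝ φ) x := h1.differentiable (by simp) x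
  rw [WaveParticle.partialD, show WaveParticle.partialD j φ
    = fun y => fderiv ℝ φ y (EuclideanSpace.single j 1) from rfl, fderiv_clm_apply h2 (differentiableAt_const _)]
  simp

/-- The symbol of the operator `-Δ + (λ - v·∇)²`. -/
noncomputable def symb (v : E3) (lam : ℂ) (ξ : E3) : ℂ :=
  4 * Real.pi ^ 2 * (‖ξ‖ : ℂ) ^ 2 + (lam - 2 * Real.pi * Complex.I * (⟪ξ, v⟫_ℝ : ℂ)) ^ 2

lemma inner_eq_sum (ξ v : E3) : ⟪ξ, v⟫_ℝ = ∑ j, ξ j * v j := by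
  simp [PiLp.inner_apply, mul_comm]

lemma fderiv_integral_eq_sum {φ : E3 → ℝ} (hφ : IsTest φ) {f : E3 → ℂ}
    (hf : LocallyIntegrable f) (v : E3) :
    ∫ x, fderiv ℝ φ x v • f x = ∑ j, (v j : ℂ) * ∫ x, partialD j φ x • f x := by
  have hi : ∀ j, Integrable (fun x => partialD j φ x • f x) := fun j =>
    hf.integrable_smul_left_of_hasCompactSupport (hφ.partialD j).1.continuous (hφ.partialD j).2
  simp only [← integral_const_mul]
  rw [← integral_finsetSum _ fun j _ => (hi j).const_mul _]
  refine integral_congr_ae (Eventually.of_forall fun x => ?_)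
  simp only [fderiv_apply_eq_sum, Complex.real_smul, Complex.ofReal_sum, Finset.sum_mul,
    Complex.ofReal_mul]
  exact Finset.sum_congr rfl fun _ _ => by ring

/-- An eigenfunction for a nonzero eigenvalue is square integrable. -/
lemma IsEigenpair.ae_eq {ρ : E3 → ℝ} {v : E3} {lam : ℂ} {Ψ Pi : E3 → ℂ}
    {Q P : Fin 3 → ℂ} (h : IsEigenpair ρ v lam Ψ Pi Q P) {g : Fin 3 → E3 → ℂ}
    (hg : ∀ j, HasWeakPartial j Ψ (g j)) :
    ∀ᵐ x, lam * Ψ x = (∑ j, (v j : ℂ) * g j x) + Pi x := by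
  have hΨl : LocallyIntegrable Ψ := (hg 0).left_int
  have hPil := locallyIntegrable_of_memLp_two h.memPi
  have hgl : ∀ j, LocallyIntegrable (fun x => (v j : ℂ) * g j x) := fun j =>
    (hg j).right_int.smul (v j : ℂ)
  have hsl : LocallyIntegrable (fun x => ∑ j, (v j : ℂ) * g j x) :=
    locallyIntegrable_finsetSum _ fun j _ => hgl j
  refine ae_eq_of_integral_contDiff_smul_eq (hΨl.smul lam) (hsl.add hPil) fun φ h1 h2 => ?_
  have hφ : IsTest φ := ⟨h1, h2⟩
  have hI : ∀ {f : E3 → ℂ}, LocallyIntegrable f → Integrable (fun x => φ x • f x) := fun hf =>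
    hf.integrable_smul_left_of_hasCompactSupport h1.continuous h2
  have e := h.eqΨ φ hφ
  rw [fderiv_integral_eq_sum hφ hΨl] at e
  simp only [(hg _).parts φ hφ, mul_neg, Finset.sum_neg_distrib, neg_neg] at e
  have e1 : ∫ x, φ x • (lam * Ψ x) = lam * ∫ x, φ x • Ψ x := by
    rw [← integral_const_mul]
    simp only [mul_smul_comm]
  have e2 : ∫ x, φ x • ((∑ j, (v j : ℂ) * g j x) + Pi x)
      = (∑ j, (v j : ℂ) * ∫ x, φ x • g j x) + ∫ x, φ x • Pi x := by
    simp only [smul_add, ← integral_const_mul]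
    rw [integral_add (hI hsl) (hI hPil), ← integral_finsetSum]
    · simp only [Finset.smul_sum, mul_smul_comm]
    · intro j _
      simpa only [mul_smul_comm] using hI (hgl j)
  rw [e1, ← e, ← e2]

/-- The eigenvalue equation in Fourier variables. -/
lemma IsEigenpair.fourier {ρ : E3 → ℝ} (hρ : IsCharge ρ) {v : E3} {lam : ℂ} (hlam : lam ≠ 0)
    {Ψ Pi : E3 → ℂ} {Q P : Fin 3 → ℂ} (h : IsEigenpair ρ v lam Ψ Pi Q P) :
    ∃ hΨ : MemLp Ψ 2, ∀ᵐ ξ : E3,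
      symb v lam ξ * fourierL2 hΨ ξ
        = 2 * Real.pi * Complex.I * dotQ Q ξ * 𝓕 (chargeC ρ) ξ ∧
      fourierL2 h.memPi ξ
        = (lam - 2 * Real.pi * Complex.I * (⟪ξ, v⟫_ℝ : ℂ)) * fourierL2 hΨ ξ := by
  choose g hg hg2 using h.memΨ.2
  have hae := h.ae_eq hg
  have hsum : MemLp (fun x => ∑ j, (v j : ℂ) * g j x) 2 :=
    memLp_finsetSum _ fun j _ => (hg2 j).const_mul _
  -- The space `Ḣ¹` only gives `Ψ ∈ L⁶`; dividing the first equation by `λ ≠ 0` expresses `Ψ`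
  -- through `L²` functions.
  have hΨ : MemLp Ψ 2 := by
    refine MemLp.ae_eq ?_ ((hsum.add h.memPi).const_mul lam⁻¹)
    filter_upwards [hae] with x hx
    change lam⁻¹ * ((∑ j, (v j : ℂ) * g j x) + Pi x) = Ψ x
    rw [← hx]
    field_simp
  refine ⟨hΨ, ?_⟩
  have hΨl : LocallyIntegrable Ψ := (hg 0).left_int
  have hPil := locallyIntegrable_of_memLp_two h.memPi
  -- the first equation
  have hgF : ∀ᵐ ξ : E3, ∀ j, fourierL2 (hg2 j) ξ
      = 2 * Real.pi * Complex.I * (ξ j : ℂ) * fourierL2 hΨ ξ :=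
    ae_all_iff.2 fun j => fourier_weak_partial hΨ (hg2 j) j (hg j).parts
  have hvg : ∀ j, MemLp (fun x => (v j : ℂ) * g j x) 2 := fun j => (hg2 j).const_mul _
  have hF1 : ∀ᵐ ξ : E3, lam * fourierL2 hΨ ξ
      = (∑ j, (v j : ℂ) * fourierL2 (hg2 j) ξ) + fourierL2 h.memPi ξ := by
    have h012 : MemLp (fun x => ((v 0 : ℂ) * g 0 x + (v 1 : ℂ) * g 1 x) + (v 2 : ℂ) * g 2 x) 2 :=
      ((hvg 0).add (hvg 1)).add (hvg 2)
    have e1 := fourierL2_const_mul lam hΨ (hΨ.const_mul lam)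
    have e2 := fourierL2_congr (hΨ.const_mul lam) (h012.add h.memPi) (by
      filter_upwards [hae] with x hx
      simp only [Fin.sum_univ_three] at hx
      exact hx)
    have e3 := fourierL2_add h012 h.memPi
    have e4 := fourierL2_add ((hvg 0).add (hvg 1)) (hvg 2)
    have e5 := fourierL2_add (hvg 0) (hvg 1)
    have e6 : ∀ᵐ ξ : E3, ∀ j, fourierL2 (hvg j) ξ = (v j : ℂ) * fourierL2 (hg2 j) ξ :=
      ae_all_iff.2 fun j => fourierL2_const_mul _ (hg2 j) (hvg j)
    rw [e2] at e1
    filter_upwards [e1, e3, e4, e5, e6] with ξ e1 e3 e4 e5 e6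
    rw [← e1, e3, Fin.sum_univ_three, ← e6 0, ← e6 1, ← e6 2, ← e5, ← e4]
  -- the second equation
  have hvP : ∀ j, MemLp (fun x => (v j : ℂ) * Pi x) 2 := fun j => h.memPi.const_mul _
  have hQr : ∀ j, MemLp (fun x => Q j * chargeC ρ x) 2 := fun j => hρ.memLpC.const_mul _
  -- The second equation in divergence form: `div (∇Ψ + vΠ + Qρ) = λΠ`.
  have hf : ∀ j, MemLp (fun x => (g j x + (v j : ℂ) * Pi x) + Q j * chargeC ρ x) 2 := fun j =>
    ((hg2 j).add (hvP j)).add (hQr j)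
  have hlP : MemLp (fun x => lam * Pi x) 2 := h.memPi.const_mul lam
  have hdiv := fourier_weak_div hf hlP (fun φ hφ => by
    have e := h.eqPi φ hφ
    rw [fderiv_integral_eq_sum hφ hPil] at e
    have eL : ∫ x, (Δ φ) x • Ψ x = -∑ j, ∫ x, partialD j φ x • g j x := by
      have hi : ∀ j, Integrable (fun x => partialD j (partialD j φ) x • Ψ x) := fun j =>
        hΨl.integrable_smul_left_of_hasCompactSupport ((hφ.partialD j).partialD j).1.continuous
          ((hφ.partialD j).partialD j).2
      simp only [hφ.laplacian_eq, Finset.sum_smul]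
      rw [integral_finsetSum _ fun j _ => hi j, ← Finset.sum_neg_distrib]
      exact Finset.sum_congr rfl fun j _ => (hg j).parts _ (hφ.partialD j)
    have e1 : ∫ x, φ x • (lam * Pi x) = lam * ∫ x, φ x • Pi x := by
      rw [← integral_const_mul]
      simp only [mul_smul_comm]
    rw [e1, ← e, eL]
    have e2 : ∀ j, ∫ x, partialD j φ x • ((g j x + (v j : ℂ) * Pi x) + Q j * chargeC ρ x)
        = (∫ x, partialD j φ x • g j x) + (v j : ℂ) * (∫ x, partialD j φ x • Pi x)
          + Q j * ∫ x, ((partialD j φ x * ρ x : ℝ) : ℂ) := by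
      intro j
      have hd := (hφ.partialD j).memLp 2
      have i1 := integrable_smul_of_memLp_two hd (hg2 j)
      have i2 := integrable_smul_of_memLp_two hd (hvP j)
      have i3 := integrable_smul_of_memLp_two hd (hQr j)
      have i12 : Integrable (fun x => partialD j φ x • g j x
        + partialD j φ x • ((v j : ℂ) * Pi x)) := i1.add i2
      simp only [smul_add]
      rw [integral_add i12 i3, integral_add i1 i2, ← integral_const_mul, ← integral_const_mul]
      congr 2
      · simp only [mul_smul_comm]
      · funext x
        simp only [chargeC, Complex.real_smul, Complex.ofReal_mul]
        ring
    simp only [e2, Finset.sum_add_distrib]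
    ring)
  have hF2 : ∀ᵐ ξ : E3, ∀ j, fourierL2 (hf j) ξ = fourierL2 (hg2 j) ξ
      + (v j : ℂ) * fourierL2 h.memPi ξ + Q j * 𝓕 (chargeC ρ) ξ := by
    refine ae_all_iff.2 fun j => ?_
    filter_upwards [fourierL2_add ((hg2 j).add (hvP j)) (hQr j), fourierL2_add (hg2 j) (hvP j),
      fourierL2_const_mul (v j : ℂ) h.memPi (hvP j), fourierL2_const_mul (Q j) hρ.memLpC (hQr j),
      fourierL2_ae_eq hρ.integrableC hρ.memLpC] with ξ e1 e2 e3 e4 e5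
    rw [← e5, ← e4, ← e3, ← e2, ← e1]
  filter_upwards [hgF, hF1, hdiv, hF2, fourierL2_const_mul lam h.memPi hlP] with ξ h1 h2 h3 h4 h5
  rw [h5] at h3
  simp only [h4, h1] at h3
  simp only [h1] at h2
  have hin : (⟪ξ, v⟫_ℝ : ℂ) = ∑ j, (ξ j : ℂ) * (v j : ℂ) := by
    rw [inner_eq_sum]; push_cast; rfl
  have hnorm : (‖ξ‖ : ℂ) ^ 2 = ∑ j, (ξ j : ℂ) ^ 2 := by
    rw [← Complex.ofReal_pow, EuclideanSpace.norm_sq_eq]; simp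
  have hPi : fourierL2 h.memPi ξ
      = (lam - 2 * Real.pi * Complex.I * (⟪ξ, v⟫_ℝ : ℂ)) * fourierL2 hΨ ξ := by
    rw [hin]
    simp only [Fin.sum_univ_three] at h2 ⊢
    linear_combination -h2
  refine ⟨?_, hPi⟩
  rw [hPi, hin] at h3
  rw [symb, hin, hnorm, dotQ]
  simp only [Fin.sum_univ_three] at h3 ⊢
  have hI : Complex.I ^ 2 = -1 := Complex.I_sq
  generalize fourierL2 hΨ ξ = y at *
  generalize 𝓕 (chargeC ρ) ξ = r at *
  linear_combination -h3 + (4 * Real.pi ^ 2 *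
    ((ξ 0 : ℂ) ^ 2 + (ξ 1 : ℂ) ^ 2 + (ξ 2 : ℂ) ^ 2) * y) * hI

/-! ### The field of the soliton -/

/-- The inverse Fourier transform on `L¹ ∩ L²` is given by the inverse Fourier integral. -/
lemma fourierInv_toLp_ae_eq {N : E3 → ℂ} (hN1 : Integrable N) (hN : MemLp N 2) :
    (𝓕⁻ (hN.toLp N : Lp ℂ 2 (volume : Measure E3)) : Lp ℂ 2 (volume : Measure E3))
      =ᵐ[volume] 𝓕⁻ N := by
  have hN' : Integrable (fun x => N (-x)) := hN1.comp_neg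
  have hinv : 𝓕⁻ N = 𝓕 (fun x => N (-x)) := Real.fourierInv_eq_fourier_comp_neg N
  have hcont : Continuous (𝓕⁻ N) := by
    rw [hinv]
    exact VectorFourier.fourierIntegral_continuous Real.continuous_fourierChar continuous_inner hN'
  refine ae_eq_of_integral_contDiff_smul_eq
    (locallyIntegrable_of_memLp_two (Lp.memLp _)) hcont.locallyIntegrable fun φ h1 h2 => ?_
  set u := testSchwartz φ h1 h2 with hu
  have e0 := congrArg (fun T => T u) (Lp.fourierInv_toTemperedDistribution_eq (hN.toLp N))
  simp only [TemperedDistribution.fourierInv_apply, Lp.toTemperedDistribution_apply,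
    smul_eq_mul] at e0
  simp only [hu, testSchwartz_apply] at e0
  have e2 := VectorFourier.integral_fourierIntegral_smul_eq_flip (μ := volume) (ν := volume)
    (L := innerₗ E3) (f := u) (g := fun x => N (-x)) Real.continuous_fourierChar
    continuous_inner u.integrable hN'
  simp only [Complex.real_smul]
  rw [← e0, hinv]
  refine Eq.trans ?_ (Eq.trans e2 ?_)
  · rw [← integral_neg_eq_self (fun ξ => VectorFourier.fourierIntegral Real.fourierChar volume
      (innerₗ E3) u ξ • N (-ξ))]
    refine integral_congr_ae ?_
    filter_upwards [hN.coeFn_toLp] with x hx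
    rw [hx, neg_neg, smul_eq_mul, ← hu]
    congr 1
  · simp only [hu, testSchwartz_apply, flip_innerₗ]
    rfl

/-- Parseval's identity for an inverse Fourier integral. -/
lemma integral_conj_mul_fourierInv {f N : E3 → ℂ} (hf : MemLp f 2) (hN1 : Integrable N)
    (hN : MemLp N 2) :
    ∫ x, (starRingEnd ℂ) (f x) * 𝓕⁻ N x = ∫ ξ, (starRingEnd ℂ) (fourierL2 hf ξ) * N ξ := by
  have hae := fourierInv_toLp_ae_eq hN1 hN
  have hI : MemLp (𝓕⁻ N) 2 := (Lp.memLp _).ae_eq hae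
  rw [← integral_conj_mul_fourierL2 hf hI]
  have : fourierL2 hI = hN.toLp N := by
    rw [fourierL2]
    have : hI.toLp (𝓕⁻ N) = 𝓕⁻ (hN.toLp N : Lp ℂ 2 (volume : Measure E3)) :=
      Lp.ext (hI.coeFn_toLp.trans hae.symm)
    rw [this, FourierTransform.fourier_fourierInv_eq]
  rw [this]
  refine integral_congr_ae ?_
  filter_upwards [hN.coeFn_toLp] with x hx
  rw [hx]

/-- The inverse transform of `N` is the transform of its reflection, to which the derivative formula
for `𝓕` applies once the first moment is integrable. -/
lemma hasFDerivAt_fourierInv {N : E3 → ℂ} (hN : Integrable N)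
    (hN' : Integrable (fun ξ => ‖ξ‖ * ‖N ξ‖)) (j : Fin 3) (x : E3) :
    partialD j (𝓕⁻ N) x = 𝓕⁻ (fun ξ => 2 * Real.pi * Complex.I * (ξ j : ℂ) * N ξ) x := by
  have hneg : Integrable (fun ξ => N (-ξ)) := hN.comp_neg
  have hneg' : Integrable (fun ξ => ‖ξ‖ * ‖N (-ξ)‖) := by
    have := hN'.comp_neg
    simpa using this
  rw [Real.fourierInv_eq_fourier_comp_neg, Real.fourierInv_eq_fourier_comp_neg]
  have h := Real.hasFDerivAt_fourier hneg hneg' x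
  rw [partialD, h.fderiv]
  have hint : Integrable (VectorFourier.fourierSMulRight (innerSL ℝ) (fun ξ : E3 => N (-ξ))) := by
    refine (hneg'.const_mul (2 * Real.pi * ‖innerSL ℝ (E := E3)‖)).mono'
      hneg.1.fourierSMulRight (Eventually.of_forall fun ξ => ?_)
    refine (VectorFourier.norm_fourierSMulRight_le _ _ _).trans (le_of_eq ?_)
    ring
  rw [Real.fourier_continuousLinearMap_apply hint]
  refine congrArg (fun f : E3 → ℂ => 𝓕 f x) (funext fun ξ => ?_)
  simp [VectorFourier.fourierSMulRight_apply, innerSL_apply_apply ℝ]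
  rw [EuclideanSpace.inner_single_right]
  simp
  ring

/-- The quadratic form `|ξ|² - (ξ·v)²`. -/
noncomputable def qform (v ξ : E3) : ℝ := ‖ξ‖ ^ 2 - ⟪ξ, v⟫_ℝ ^ 2

lemma le_qform (v ξ : E3) : (1 - ‖v‖ ^ 2) * ‖ξ‖ ^ 2 ≤ qform v ξ := by
  have h := abs_inner_le_mul_norm v ξ
  have : ⟪ξ, v⟫_ℝ ^ 2 ≤ (‖v‖ * ‖ξ‖) ^ 2 := sq_le_sq' (by linarith [abs_le.1 h |>.1])
    (abs_le.1 h).2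
  unfold qform
  nlinarith

lemma qform_smul (v ξ : E3) (s : ℝ) : qform v (s • ξ) = s ^ 2 * qform v ξ := by
  rw [qform, qform, norm_smul, real_inner_smul_left, mul_pow, Real.norm_eq_abs, sq_abs]; ring

lemma one_sub_sq_pos {v : E3} (hv : ‖v‖ < 1) : 0 < 1 - ‖v‖ ^ 2 := by
  nlinarith [norm_nonneg v]

lemma qform_pos {v : E3} (hv : ‖v‖ < 1) {ξ : E3} (hξ : ξ ≠ 0) : 0 < qform v ξ :=
  lt_of_lt_of_le (mul_pos (one_sub_sq_pos hv) (pow_pos (norm_pos_iff.2 hξ) 2)) (le_qform v ξ)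

lemma continuous_qform (v : E3) : Continuous (qform v) := by unfold qform; fun_prop

/-- The Fourier transform of the soliton field, up to a factor, in Mathlib's normalization. -/
noncomputable def solitonF (ρ : E3 → ℝ) (v ξ : E3) : ℂ :=
  -𝓕 (chargeC ρ) ξ / ((4 * Real.pi ^ 2 * qform v ξ : ℝ) : ℂ)

/-- Substitution `k = -2πξ` with Jacobian `(2π)³ = c0⁻²`, which cancels one factor `c0` from the
prefactor of `soliton` and one from `hat`. -/
lemma soliton_eq (ρ : E3 → ℝ) (v : E3) : soliton ρ v = 𝓕⁻ (solitonF ρ v) := by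
  funext x
  rw [soliton, Real.fourierInv_eq']
  have hc := Measure.integral_comp_smul (volume : Measure E3)
    (fun k : E3 => Complex.exp (-Complex.I * ((⟪k, x⟫_ℝ : ℝ) : ℂ)) *
      (-hat ρ k / ((‖k‖ ^ 2 - ⟪k, v⟫_ℝ ^ 2 : ℝ) : ℂ))) (-(2 * Real.pi))
  have h3 : |((-(2 * Real.pi)) ^ Module.finrank ℝ E3)⁻¹| = c0 ^ 2 := by
    rw [finrank_euclideanSpace_fin, abs_inv, abs_pow, abs_neg, abs_of_pos (by positivity)]
    exact (eq_inv_of_mul_eq_one_left c0_sq).symm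
  rw [h3] at hc
  have hI : ∫ k : E3, Complex.exp (-Complex.I * ((⟪k, x⟫_ℝ : ℝ) : ℂ)) *
      (-hat ρ k / ((‖k‖ ^ 2 - ⟪k, v⟫_ℝ ^ 2 : ℝ) : ℂ)) = ((c0 ^ 2)⁻¹ : ℝ) •
      ∫ ξ : E3, Complex.exp (-Complex.I * ((⟪-(2 * Real.pi) • ξ, x⟫_ℝ : ℝ) : ℂ)) *
      (-hat ρ (-(2 * Real.pi) • ξ) / ((‖-(2 * Real.pi) • ξ‖ ^ 2
        - ⟪-(2 * Real.pi) • ξ, v⟫_ℝ ^ 2 : ℝ) : ℂ)) := by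
    rw [hc, smul_smul, inv_mul_cancel₀ (pow_ne_zero 2 c0_pos.ne'), one_smul]
  rw [hI, show (((2 * Real.pi) ^ (-(3 / 2) : ℝ) : ℝ) : ℂ) = (c0 : ℂ) from rfl, Complex.real_smul,
    ← mul_assoc, ← integral_const_mul]
  refine integral_congr_ae (Eventually.of_forall fun ξ => ?_)
  have hq : ‖-(2 * Real.pi) • ξ‖ ^ 2 - ⟪-(2 * Real.pi) • ξ, v⟫_ℝ ^ 2 = 4 * Real.pi ^ 2 * qform v ξ := by
    have := qform_smul v ξ (-(2 * Real.pi))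
    rw [qform] at this
    rw [this]; ring
  beta_reduce
  rw [hq]
  simp only [hat_eq_fourier, solitonF, real_inner_smul_left, smul_eq_mul]
  have hc0 : (c0 : ℂ) ≠ 0 := Complex.ofReal_ne_zero.2 c0_pos.ne'
  have hexp : Complex.exp (-Complex.I * ((-(2 * Real.pi) * ⟪ξ, x⟫_ℝ : ℝ) : ℂ))
      = Complex.exp (((2 * Real.pi * ⟪ξ, x⟫_ℝ : ℝ) : ℂ) * Complex.I) := by
    congr 1; push_cast; ring
  rw [hexp]
  push_cast
  field_simp

/-- In dimension three the polar Jacobian `r²` cancels the singularity `|ξ|⁻²`. This controls the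
low frequencies of the soliton field. -/
lemma integrable_dominator : Integrable (fun ξ : E3 =>
    (Metric.ball (0 : E3) 1).indicator (fun ξ => (‖ξ‖ ^ 2)⁻¹) ξ) := by
  rw [integrable_indicator_iff Metric.isOpen_ball.measurableSet]
  refine (integrableOn_fun_norm_addHaar (E := E3) volume (f := fun y => (y ^ 2)⁻¹)).2 ?_
  have : Set.EqOn (fun y : ℝ => y ^ (Module.finrank ℝ E3 - 1) • (y ^ 2)⁻¹) (fun _ => 1)
      (Set.Ioo 0 1) := by
    intro y hy
    have : y ≠ 0 := hy.1.ne'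
    simp only [finrank_euclideanSpace_fin, smul_eq_mul]
    norm_num
    field_simp
  rw [integrableOn_congr_fun this measurableSet_Ioo]
  simp

lemma integrable_one_add_norm_inv : Integrable (fun ξ : E3 => ((1 + ‖ξ‖) ^ 4)⁻¹) := by
  have := integrable_one_add_norm (E := E3) (μ := volume) (r := 4)
    (by simp; norm_num)
  refine this.congr (Eventually.of_forall fun ξ => ?_)
  beta_reduce
  rw [Real.rpow_neg (by positivity), show (4 : ℝ) = ((4 : ℕ) : ℝ) by norm_num, Real.rpow_natCast]

lemma inv_pow_four_le {t : ℝ} (ht : 1 ≤ t) : ((t ^ 2)⁻¹) ^ 2 ≤ 16 * ((1 + t) ^ 4)⁻¹ := by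
  rw [inv_pow, ← pow_mul, ← div_eq_mul_inv, inv_eq_one_div, div_le_div_iff₀ (by positivity)
    (by positivity), one_mul]
  have : (1 + t) ^ 4 ≤ (2 * t) ^ 4 := pow_le_pow_left₀ (by linarith) (by linarith) 4
  calc (1 + t) ^ 4 ≤ (2 * t) ^ 4 := this
    _ = 16 * t ^ (2 * 2) := by ring

lemma norm_solitonF_le {ρ : E3 → ℝ} {v : E3} (hv : ‖v‖ < 1) (ξ : E3) :
    ‖solitonF ρ v ξ‖ ≤ (4 * Real.pi ^ 2 * (1 - ‖v‖ ^ 2))⁻¹ * (‖𝓕 (chargeC ρ) ξ‖ * (‖ξ‖ ^ 2)⁻¹) := by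
  -- At the origin both sides are zero, by the convention for division by zero.
  rcases eq_or_ne ξ 0 with rfl | hξ
  · simp [solitonF, qform]
  have hq := qform_pos hv hξ
  have h1 := one_sub_sq_pos hv
  have h2 : 0 < ‖ξ‖ := norm_pos_iff.2 hξ
  rw [solitonF, norm_div, norm_neg, Complex.norm_real, Real.norm_of_nonneg (by positivity),
    div_eq_mul_inv, mul_left_comm, ← mul_inv]
  refine mul_le_mul_of_nonneg_left ?_ (norm_nonneg _)
  refine inv_anti₀ (by positivity) ?_
  have := le_qform v ξ
  have hp : 0 < 4 * Real.pi ^ 2 := by positivity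
  nlinarith

lemma exists_bound_fourier {ρ : E3 → ℝ} : ∃ C, 0 ≤ C ∧ ∀ ξ, ‖𝓕 (chargeC ρ) ξ‖ ≤ C :=
  ⟨∫ x, ‖chargeC ρ x‖, integral_nonneg fun _ => norm_nonneg _, fun _ =>
    VectorFourier.norm_fourierIntegral_le_integral_norm _ _ _ _ _⟩

lemma measurable_solitonF {ρ : E3 → ℝ} (hρ : IsCharge ρ) (v : E3) : Measurable (solitonF ρ v) := by
  have h1 := (continuous_fourier_chargeC hρ).measurable
  have h2 := (continuous_qform v).measurable
  unfold solitonF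
  fun_prop

/-- Inside the unit ball `ρ̂` is bounded and `|ξ|⁻²` is integrable. Outside, `|ρ̂| |ξ|⁻²` is
dominated by `|ρ̂|² + |ξ|⁻⁴`; the factor 16 comes from replacing `|ξ|⁻⁴` by `(1 + |ξ|)⁻⁴`. -/
lemma integrable_solitonF {ρ : E3 → ℝ} (hρ : IsCharge ρ) {v : E3} (hv : ‖v‖ < 1) :
    Integrable (solitonF ρ v) := by
  obtain ⟨C, hC0, hC⟩ := exists_bound_fourier (ρ := ρ)
  have hA := one_sub_sq_pos hv
  have hdom := ((integrable_dominator.const_mul C).add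
    (hρ.integrable_sq_fourier.add (integrable_one_add_norm_inv.const_mul 16))).const_mul
      (4 * Real.pi ^ 2 * (1 - ‖v‖ ^ 2))⁻¹
  refine hdom.mono' (measurable_solitonF hρ v).aestronglyMeasurable
    (Eventually.of_forall fun ξ => (norm_solitonF_le hv ξ).trans ?_)
  refine mul_le_mul_of_nonneg_left ?_ (by positivity)
  simp only [Pi.add_apply]
  by_cases hξ : ξ ∈ Metric.ball (0 : E3) 1
  · rw [Set.indicator_of_mem hξ]
    have := mul_le_mul_of_nonneg_right (hC ξ) (by positivity : 0 ≤ (‖ξ‖ ^ 2)⁻¹)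
    have : 0 ≤ ‖𝓕 (chargeC ρ) ξ‖ ^ 2 + 16 * ((1 + ‖ξ‖) ^ 4)⁻¹ := by positivity
    linarith
  · rw [Set.indicator_of_notMem hξ]
    have h1 : 1 ≤ ‖ξ‖ := by simpa using hξ
    have := inv_pow_four_le h1
    nlinarith [sq_nonneg (‖𝓕 (chargeC ρ) ξ‖ - (‖ξ‖ ^ 2)⁻¹), sq_nonneg (‖𝓕 (chargeC ρ) ξ‖),
      sq_nonneg ((‖ξ‖ ^ 2)⁻¹)]

/-- The same splitting, with `|ξ| |ρ̂|` in place of `|ρ̂|` at high frequencies. This moment permits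
differentiating the soliton field under the integral. -/
lemma integrable_norm_mul_solitonF {ρ : E3 → ℝ} (hρ : IsCharge ρ) {v : E3} (hv : ‖v‖ < 1) :
    Integrable (fun ξ => ‖ξ‖ * ‖solitonF ρ v ξ‖) := by
  obtain ⟨C, hC0, hC⟩ := exists_bound_fourier (ρ := ρ)
  have hA := one_sub_sq_pos hv
  have hdom := ((integrable_dominator.const_mul C).add
    (hρ.integrable_sq_norm_mul_fourier.add (integrable_one_add_norm_inv.const_mul 16))).const_mul
      (4 * Real.pi ^ 2 * (1 - ‖v‖ ^ 2))⁻¹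
  refine hdom.mono'
    (measurable_norm.mul (measurable_solitonF hρ v).norm).aestronglyMeasurable
    (Eventually.of_forall fun ξ => ?_)
  rw [Real.norm_of_nonneg (by positivity)]
  refine (mul_le_mul_of_nonneg_left (norm_solitonF_le hv ξ) (norm_nonneg ξ)).trans ?_
  rw [mul_left_comm]
  refine mul_le_mul_of_nonneg_left ?_ (by positivity)
  simp only [Pi.add_apply]
  by_cases hξ : ξ ∈ Metric.ball (0 : E3) 1
  · rw [Set.indicator_of_mem hξ]
    have h1 : ‖ξ‖ ≤ 1 := by simpa using (mem_ball_zero_iff.1 hξ).le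
    have h2 := mul_le_mul_of_nonneg_right (hC ξ) (by positivity : 0 ≤ (‖ξ‖ ^ 2)⁻¹)
    have h3 : ‖ξ‖ * (‖𝓕 (chargeC ρ) ξ‖ * (‖ξ‖ ^ 2)⁻¹) ≤ ‖𝓕 (chargeC ρ) ξ‖ * (‖ξ‖ ^ 2)⁻¹ :=
      mul_le_of_le_one_left (by positivity) h1
    have : 0 ≤ ‖ξ‖ ^ 2 * ‖𝓕 (chargeC ρ) ξ‖ ^ 2 + 16 * ((1 + ‖ξ‖) ^ 4)⁻¹ := by positivity
    linarith
  · rw [Set.indicator_of_notMem hξ]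
    have h1 : 1 ≤ ‖ξ‖ := by simpa using hξ
    have := inv_pow_four_le h1
    rw [← mul_assoc, ← mul_pow]
    nlinarith [sq_nonneg (‖ξ‖ * ‖𝓕 (chargeC ρ) ξ‖ - (‖ξ‖ ^ 2)⁻¹),
      sq_nonneg (‖ξ‖ * ‖𝓕 (chargeC ρ) ξ‖), sq_nonneg ((‖ξ‖ ^ 2)⁻¹)]

/-- The Fourier transform of a partial derivative of the soliton field. -/
noncomputable def solitonDF (ρ : E3 → ℝ) (v : E3) (j : Fin 3) (ξ : E3) : ℂ :=
  2 * Real.pi * Complex.I * (ξ j : ℂ) * solitonF ρ v ξ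

lemma norm_solitonDF_le (ρ : E3 → ℝ) (v : E3) (j : Fin 3) (ξ : E3) :
    ‖solitonDF ρ v j ξ‖ ≤ 2 * Real.pi * (‖ξ‖ * ‖solitonF ρ v ξ‖) := by
  simp only [solitonDF, norm_mul, Complex.norm_I, Complex.norm_real, Complex.norm_ofNat,
    Real.norm_of_nonneg Real.pi_pos.le, one_mul, mul_assoc]
  gcongr
  exact PiLp.norm_apply_le ξ j

lemma measurable_solitonDF {ρ : E3 → ℝ} (hρ : IsCharge ρ) (v : E3) (j : Fin 3) :
    Measurable (solitonDF ρ v j) := by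
  have h1 := measurable_solitonF hρ v
  have h2 : Continuous (fun ξ : E3 => 2 * Real.pi * Complex.I * (ξ j : ℂ)) := by fun_prop
  exact h2.measurable.mul h1

lemma integrable_solitonDF {ρ : E3 → ℝ} (hρ : IsCharge ρ) {v : E3} (hv : ‖v‖ < 1) (j : Fin 3) :
    Integrable (solitonDF ρ v j) :=
  ((integrable_norm_mul_solitonF hρ hv).const_mul (2 * Real.pi)).mono'
    (measurable_solitonDF hρ v j).aestronglyMeasurable
    (Eventually.of_forall fun ξ => norm_solitonDF_le ρ v j ξ)

/-- The squared modulus is at most a multiple of `|ρ̂|² |ξ|⁻²`, integrable at the origin in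
dimension three and dominated by `|ρ̂|²` outside the unit ball. Square integrability is what
Parseval against `∇ρ` requires. -/
lemma memLp_solitonDF {ρ : E3 → ℝ} (hρ : IsCharge ρ) {v : E3} (hv : ‖v‖ < 1) (j : Fin 3) :
    MemLp (solitonDF ρ v j) 2 := by
  obtain ⟨C, hC0, hC⟩ := exists_bound_fourier (ρ := ρ)
  have hA := one_sub_sq_pos hv
  rw [← memLp_norm_iff (measurable_solitonDF hρ v j).aestronglyMeasurable,
    memLp_two_iff_integrable_sq (measurable_solitonDF hρ v j).norm.aestronglyMeasurable]
  set A := 2 * Real.pi * (4 * Real.pi ^ 2 * (1 - ‖v‖ ^ 2))⁻¹ with hAdef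
  have hA0 : 0 ≤ A := by positivity
  have hdom := ((integrable_dominator.const_mul (C ^ 2)).add hρ.integrable_sq_fourier).const_mul
    (A ^ 2)
  refine hdom.mono' ((measurable_solitonDF hρ v j).norm.pow_const 2).aestronglyMeasurable
    (Eventually.of_forall fun ξ => ?_)
  rw [Real.norm_of_nonneg (by positivity)]
  have hb : ‖solitonDF ρ v j ξ‖ ≤ A * (‖𝓕 (chargeC ρ) ξ‖ * ‖ξ‖⁻¹) := by
    refine (norm_solitonDF_le ρ v j ξ).trans ?_
    rcases eq_or_ne ξ 0 with hξ | hξ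
    · simp [hξ]
    have h2 : 0 < ‖ξ‖ := norm_pos_iff.2 hξ
    have h3 := mul_le_mul_of_nonneg_left (mul_le_mul_of_nonneg_left
      (norm_solitonF_le (ρ := ρ) hv ξ) (norm_nonneg ξ)) (Real.two_pi_pos.le)
    refine h3.trans (le_of_eq ?_)
    rw [hAdef]
    field_simp
  refine (pow_le_pow_left₀ (norm_nonneg _) hb 2).trans ?_
  rw [mul_pow]
  refine mul_le_mul_of_nonneg_left ?_ (by positivity)
  simp only [Pi.add_apply]
  rw [mul_pow, inv_pow]
  by_cases hξ : ξ ∈ Metric.ball (0 : E3) 1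
  · rw [Set.indicator_of_mem hξ]
    have h2 := mul_le_mul_of_nonneg_right (pow_le_pow_left₀ (norm_nonneg _) (hC ξ) 2)
      (by positivity : 0 ≤ (‖ξ‖ ^ 2)⁻¹)
    have : 0 ≤ ‖𝓕 (chargeC ρ) ξ‖ ^ 2 := by positivity
    linarith
  · rw [Set.indicator_of_notMem hξ]
    have h1 : 1 ≤ ‖ξ‖ := by simpa using hξ
    have h3 : (‖ξ‖ ^ 2)⁻¹ ≤ 1 := inv_le_one_of_one_le₀ (one_le_pow₀ h1)
    have := mul_le_of_le_one_right (sq_nonneg ‖𝓕 (chargeC ρ) ξ‖) h3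
    linarith

lemma ae_ne_zero : ∀ᵐ ξ : E3, ξ ≠ 0 := by simp [ae_iff]

/-- The pairing of the soliton field with the charge. -/
lemma integral_partialD_soliton {ρ : E3 → ℝ} (hρ : IsCharge ρ) {v : E3} (hv : ‖v‖ < 1)
    (j l : Fin 3) :
    ∫ x, partialD j (soliton ρ v) x * ((weakPartial l ρ x : ℝ) : ℂ)
      = -∫ ξ : E3, ((ξ j * ξ l * ‖𝓕 (chargeC ρ) ξ‖ ^ 2 / qform v ξ : ℝ) : ℂ) := by
  have h1 := integral_conj_mul_fourierInv (hρ.memLp_gradC l) (integrable_solitonDF hρ hv j)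
    (memLp_solitonDF hρ hv j)
  have h2 : ∀ x, partialD j (soliton ρ v) x = 𝓕⁻ (solitonDF ρ v j) x := fun x => by
    rw [soliton_eq]
    exact hasFDerivAt_fourierInv (integrable_solitonF hρ hv) (integrable_norm_mul_solitonF hρ hv) j x
  simp only [h2]
  have e : ∫ x, 𝓕⁻ (solitonDF ρ v j) x * ((weakPartial l ρ x : ℝ) : ℂ)
      = ∫ x, (starRingEnd ℂ) (gradC ρ l x) * 𝓕⁻ (solitonDF ρ v j) x := by
    simp only [gradC, Complex.conj_ofReal, mul_comm]
  rw [e, h1, ← integral_neg]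
  refine integral_congr_ae ?_
  filter_upwards [hρ.fourier_gradC l, ae_ne_zero] with ξ hξ h0
  have hq : (qform v ξ : ℂ) ≠ 0 := Complex.ofReal_ne_zero.2 (qform_pos hv h0).ne'
  have hπ : (Real.pi : ℂ) ≠ 0 := Complex.ofReal_ne_zero.2 Real.pi_pos.ne'
  rw [hξ, solitonDF, solitonF]
  simp only [map_mul, Complex.conj_ofReal, Complex.conj_I, Complex.ofReal_mul, Complex.ofReal_div,
    Complex.ofReal_pow, map_ofNat, Complex.ofReal_ofNat]
  have hn : (‖𝓕 (chargeC ρ) ξ‖ : ℂ) ^ 2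
      = 𝓕 (chargeC ρ) ξ * (starRingEnd ℂ) (𝓕 (chargeC ρ) ξ) := by
    rw [Complex.mul_conj']
  rw [hn]
  field_simp
  linear_combination (4 * ((ξ j : ℂ) * (ξ l : ℂ))) * Complex.I_sq * (𝓕 (chargeC ρ) ξ * (starRingEnd ℂ) (𝓕 (chargeC ρ) ξ))

/-! ### Absence of eigenvalues -/

lemma B_form_eq (v : E3) (P : Fin 3 → ℂ) :
    ∑ i, (starRingEnd ℂ) (P i) * (B v).mulVec P i
      = ((Real.sqrt (1 - ‖v‖ ^ 2) * ((∑ i, ‖P i‖ ^ 2) - ‖∑ i, (v i : ℂ) * P i‖ ^ 2) : ℝ) : ℂ) := by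
  have h1 : ∀ z : ℂ, ((‖z‖ ^ 2 : ℝ) : ℂ) = z * (starRingEnd ℂ) z := fun z => by
    rw [Complex.mul_conj', Complex.ofReal_pow]
  rw [Complex.ofReal_mul, Complex.ofReal_sub, Complex.ofReal_sum, h1]
  simp only [h1, B, Matrix.mulVec, dotProduct, Matrix.of_apply, Complex.ofReal_mul,
    Complex.ofReal_sub, Fin.sum_univ_three, map_add, map_mul, Complex.conj_ofReal]
  simp
  ring

/-- Cauchy–Schwarz for `v·P`. -/
lemma B_form_lower (v : E3) (P : Fin 3 → ℂ) :
    (1 - ‖v‖ ^ 2) * ∑ i, ‖P i‖ ^ 2 ≤ (∑ i, ‖P i‖ ^ 2) - ‖∑ i, (v i : ℂ) * P i‖ ^ 2 := by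
  have h1 : ‖∑ i, (v i : ℂ) * P i‖ ≤ ∑ i, ‖v i‖ * ‖P i‖ := by
    refine (norm_sum_le _ _).trans (le_of_eq ?_)
    simp
  have h2 := Finset.sum_mul_sq_le_sq_mul_sq Finset.univ (fun i => ‖v i‖) (fun i => ‖P i‖)
  rw [← EuclideanSpace.norm_sq_eq] at h2
  have h3 := pow_le_pow_left₀ (norm_nonneg _) h1 2
  linarith

/-- The matrix `B v` is positive definite. -/
lemma eq_zero_of_B_form_nonpos {v : E3} (hv : ‖v‖ < 1) {P : Fin 3 → ℂ}
    (h : (∑ i, (starRingEnd ℂ) (P i) * (B v).mulVec P i).re ≤ 0) : P = 0 := by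
  rw [B_form_eq, Complex.ofReal_re] at h
  have hA := one_sub_sq_pos hv
  have hs : 0 < Real.sqrt (1 - ‖v‖ ^ 2) := Real.sqrt_pos.2 hA
  have h1 : (∑ i, ‖P i‖ ^ 2) - ‖∑ i, (v i : ℂ) * P i‖ ^ 2 ≤ 0 := by
    by_contra hc
    exact absurd h (not_le.2 (mul_pos hs (not_le.1 hc)))
  have h2 := B_form_lower v P
  have h3 : ∑ i, ‖P i‖ ^ 2 ≤ 0 := by
    by_contra hc
    have := mul_pos hA (not_le.1 hc)
    linarith
  have h4 : ∑ i, ‖P i‖ ^ 2 = 0 := le_antisymm h3 (Finset.sum_nonneg fun _ _ => by positivity)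
  funext i
  have := (Finset.sum_eq_zero_iff_of_nonneg (fun i _ => by positivity)).1 h4 i (Finset.mem_univ i)
  simpa using this

/-- An eigenpair with `Q = 0` vanishes. -/
lemma IsEigenpair.trivial_of_Q {ρ : E3 → ℝ} (hρ : IsCharge ρ) {v : E3} {lam : ℂ} (hlam : lam ≠ 0)
    {Ψ Pi : E3 → ℂ} {Q P : Fin 3 → ℂ} (h : IsEigenpair ρ v lam Ψ Pi Q P) (hQ : Q = 0)
    (hs : ∀ᵐ ξ, symb v lam ξ ≠ 0) :
    Ψ =ᵐ[volume] 0 ∧ Pi =ᵐ[volume] 0 ∧ Q = 0 ∧ P = 0 := by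
  obtain ⟨hΨ2, hF⟩ := h.fourier hρ hlam
  have hΨF : fourierL2 hΨ2 =ᵐ[volume] 0 := by
    filter_upwards [hF, hs] with ξ h1 h2
    have := h1.1
    rw [hQ] at this
    simp only [dotQ, _root_.Pi.zero_apply, zero_mul, Finset.sum_const_zero, mul_zero, mul_eq_zero] at this
    exact this.resolve_left h2
  have hΨ := ae_eq_zero_of_fourierL2 hΨ2 hΨF
  have hPi := ae_eq_zero_of_fourierL2 h.memPi (by
    filter_upwards [hF, hΨF] with ξ h1 h2
    rw [h1.2, h2]; simp)
  refine ⟨hΨ, hPi, hQ, ?_⟩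
  funext j
  have e := h.eqP j
  have e1 : ∫ x, Ψ x * ((weakPartial j ρ x : ℝ) : ℂ) = 0 := by
    rw [integral_eq_zero_of_ae]
    filter_upwards [hΨ] with x hx
    simp [hx]
  rw [e1, hQ] at e
  simp only [_root_.Pi.zero_apply, zero_mul, Finset.sum_const_zero, add_zero] at e
  simpa [hlam] using e.symm

/-! ### Eigenvalues on the imaginary axis. -/

lemma symb_imag (v : E3) {om : ℝ} (hom : om ≠ 0) : ∃ (u : E3) (s : ℝ), ‖u‖ = ‖v‖ ∧ 0 < s ∧
    ∀ ξ, symb v (Complex.I * om) ξ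
      = ((4 * Real.pi ^ 2 * ((beta u ξ - s) * (beta (-u) ξ + s)) : ℝ) : ℂ) := by
  -- At `λ = iω` the symbol is the real difference of squares `4π²(|ξ|² - (ω/2π - ξ·v)²)`.
  have key : ∀ ξ, symb v (Complex.I * om) ξ = ((4 * Real.pi ^ 2 * ((beta (-v) ξ - om / (2 * Real.pi))
      * (beta v ξ + om / (2 * Real.pi))) : ℝ) : ℂ) := by
    intro ξ
    rw [symb, beta, beta, inner_neg_right]
    have hπ : (Real.pi : ℂ) ≠ 0 := Complex.ofReal_ne_zero.2 Real.pi_pos.ne'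
    push_cast
    field_simp
    linear_combination 4 * ((om : ℂ) - 2 * Real.pi * (⟪ξ, v⟫_ℝ : ℂ)) ^ 2 * Complex.I_sq
  -- The sign of `ω` decides which factor can vanish; `u = ±v` is chosen so that `s = |ω|/2π` is
  -- positive.
  rcases lt_or_gt_of_ne hom with h | h
  · refine ⟨v, -om / (2 * Real.pi), rfl, div_pos (by linarith) Real.two_pi_pos, fun ξ => ?_⟩
    rw [key]
    congr 1
    ring
  · refine ⟨-v, om / (2 * Real.pi), norm_neg v, div_pos h Real.two_pi_pos, fun ξ => ?_⟩
    rw [key, neg_neg]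

lemma beta_nonneg {v : E3} (hv : ‖v‖ < 1) (k : E3) : 0 ≤ beta v k :=
  (mul_nonneg (by linarith) (norm_nonneg k)).trans (le_beta v k)

/-- Bounds for the norm on a shell. -/
lemma norm_bounds_of_shell {u : E3} (hu : ‖u‖ < 1) {s ε : ℝ} (hε : ε ≤ s / 2) {k : E3}
    (h1 : s - ε ≤ beta u k) (h2 : beta u k < s + ε) :
    s / 4 ≤ ‖k‖ ∧ ‖k‖ ≤ 2 * s / (1 - ‖u‖) := by
  have a1 := le_beta u k
  have a2 := beta_le u k
  have a3 := norm_nonneg k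
  constructor
  · nlinarith
  · rw [le_div_iff₀ (by linarith)]
    have : 0 ≤ s := by
      have := beta_nonneg hu k
      by_contra hc
      linarith
    linarith

/-- Within `ε` of the ellipsoid `β_u = s` the symbol is at most `Cε`, so the equation forces `|Ψ̂|²`
to be at least a constant times `|Q·ξ|² / ε²`; the Wiener condition keeps the source from vanishing
there. The shell has `|Q·ξ|²`-mass at least `cε`, so for `Q ≠ 0` the integral of `|Ψ̂|²` would be at
least of order `1/ε`, contradicting `Ψ ∈ L²`. -/
lemma IsEigenpair.Q_eq_zero_of_imag {ρ : E3 → ℝ} (hρ : IsCharge ρ) (hW : Wiener ρ) {v : E3}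
    (hv : ‖v‖ < 1) {om : ℝ} (hom : om ≠ 0) {Ψ Pi : E3 → ℂ} {Q P : Fin 3 → ℂ}
    (h : IsEigenpair ρ v (Complex.I * om) Ψ Pi Q P) : Q = 0 := by
  by_contra hQ
  have hlam : Complex.I * (om : ℂ) ≠ 0 := mul_ne_zero Complex.I_ne_zero (Complex.ofReal_ne_zero.2 hom)
  obtain ⟨hΨ2, hF⟩ := h.fourier hρ hlam
  obtain ⟨u, s, huv, hs, hsym⟩ := symb_imag v hom
  have hu : ‖u‖ < 1 := huv ▸ hv
  obtain ⟨c, hc, hshell⟩ := exists_shell_lower_bound hu hQ hs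
  set b := 2 * s / (1 - ‖u‖) with hb
  have hb0 : 0 < b := div_pos (by linarith) (by linarith)
  -- The shell lies in the annulus `s/4 ≤ |ξ| ≤ b`; the factors `2π` appear because `hat` is
  -- evaluated at `-2πξ`.
  obtain ⟨m, hm, hlow⟩ := hρ.exists_hat_lower_bound hW (a := 2 * Real.pi * (s / 4))
    (b := 2 * Real.pi * b) (by positivity)
  have hπ := Real.two_pi_pos
  -- The factor of the symbol that does not vanish satisfies `β_{-u} + s ≤ 2|ξ| + s ≤ 2b + s` on the
  -- shell.
  set C := 4 * Real.pi ^ 2 * (2 * b + s) with hC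
  have hC0 : 0 < C := by positivity
  set m' := 4 * Real.pi ^ 2 * (m / c0 ^ 2) with hm'
  have hm'0 : 0 < m' := by have := c0_pos; positivity
  set I := ∫⁻ ξ, ENNReal.ofReal (‖fourierL2 hΨ2 ξ‖ ^ 2) with hI
  have hIfin : I ≠ ⊤ := by
    have hint : Integrable (fun ξ => ‖fourierL2 hΨ2 ξ‖ ^ 2) :=
      (memLp_fourierL2 hΨ2).integrable_norm_pow (by norm_num)
    exact (lintegral_ofReal_ne_top_iff_integrable hint.1
      (Eventually.of_forall fun _ => by positivity)).2 hint
  have main : ∀ ε : ℝ, 0 < ε → ε ≤ s / 2 → c * ε ≤ C ^ 2 * ε ^ 2 / m' * I.toReal := by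
    intro ε hε hεs
    have h1 := hshell ε hε (by linarith)
    have h2 : ∫⁻ k in {k | s - ε ≤ beta u k ∧ beta u k < s + ε}, ENNReal.ofReal (‖dotQ Q k‖ ^ 2)
        ≤ ENNReal.ofReal (C ^ 2 * ε ^ 2 / m') * I := by
      refine (lintegral_mono_ae (g := fun ξ => ENNReal.ofReal (C ^ 2 * ε ^ 2 / m') *
        ENNReal.ofReal (‖fourierL2 hΨ2 ξ‖ ^ 2)) ?_).trans ?_
      · filter_upwards [ae_restrict_of_ae hF, ae_restrict_mem (measurableSet_shell u _ _)]
          with ξ hξ hmem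
        rw [← ENNReal.ofReal_mul (by positivity)]
        refine ENNReal.ofReal_le_ofReal ?_
        obtain ⟨n1, n2⟩ := norm_bounds_of_shell hu hεs hmem.1 hmem.2
        have hr : m / c0 ^ 2 ≤ ‖𝓕 (chargeC ρ) ξ‖ ^ 2 := by
          have := hlow (-(2 * Real.pi) • ξ)
            (by rw [norm_smul, norm_neg, Real.norm_of_nonneg hπ.le]; gcongr)
            (by rw [norm_smul, norm_neg, Real.norm_of_nonneg hπ.le]; gcongr)
          rw [hat_eq_fourier, norm_mul, Complex.norm_real, Real.norm_of_nonneg c0_pos.le,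
            mul_pow] at this
          rw [div_le_iff₀ (pow_pos c0_pos 2)]
          linarith
        have hsy : ‖symb v (Complex.I * om) ξ‖ ≤ C * ε := by
          have hb1 := beta_le (-u) ξ
          have hb2 := beta_nonneg (v := -u) (by rwa [norm_neg]) ξ
          rw [norm_neg] at hb1
          have hp0 : (0 : ℝ) ≤ 4 * Real.pi ^ 2 := by positivity
          rw [hsym, Complex.norm_real, norm_mul, Real.norm_of_nonneg hp0, norm_mul,
            show C * ε = 4 * Real.pi ^ 2 * ((2 * b + s) * ε) by rw [hC]; ring]
          refine mul_le_mul_of_nonneg_left ?_ hp0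
          rw [mul_comm]
          have hbs : 0 ≤ 2 * b + s := by positivity
          refine mul_le_mul ?_ ?_ (norm_nonneg _) hbs
          · rw [Real.norm_of_nonneg (by linarith)]
            nlinarith [norm_nonneg ξ]
          · rw [Real.norm_eq_abs, abs_le]
            constructor <;> linarith [hmem.1, hmem.2]
        have e := congrArg (fun z => ‖z‖ ^ 2) hξ.1
        simp only [norm_mul, Complex.norm_I, Complex.norm_real, Complex.norm_ofNat, mul_pow,
          Real.norm_of_nonneg Real.pi_pos.le] at e
        rw [div_mul_eq_mul_div, le_div_iff₀ hm'0]
        calc ‖dotQ Q ξ‖ ^ 2 * m' ≤ ‖dotQ Q ξ‖ ^ 2 * (4 * Real.pi ^ 2 * ‖𝓕 (chargeC ρ) ξ‖ ^ 2) := by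
              rw [hm']; gcongr
          _ = ‖symb v (Complex.I * om) ξ‖ ^ 2 * ‖fourierL2 hΨ2 ξ‖ ^ 2 := by rw [e]; ring
          _ ≤ (C * ε) ^ 2 * ‖fourierL2 hΨ2 ξ‖ ^ 2 := by gcongr
          _ = C ^ 2 * ε ^ 2 * ‖fourierL2 hΨ2 ξ‖ ^ 2 := by ring
      · rw [lintegral_const_mul' _ _ ENNReal.ofReal_ne_top]
        gcongr
        exact setLIntegral_le_lintegral _ _
    have h3 := h1.trans h2
    rw [← ENNReal.ofReal_toReal hIfin, ← ENNReal.ofReal_mul (by positivity)] at h3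
    exact (ENNReal.ofReal_le_ofReal_iff (by positivity)).1 h3
  set D := C ^ 2 / m' * I.toReal with hD
  have hD0 : 0 ≤ D := by positivity
  have main' : ∀ ε : ℝ, 0 < ε → ε ≤ s / 2 → c ≤ D * ε := by
    intro ε hε hεs
    have := main ε hε hεs
    have e : C ^ 2 * ε ^ 2 / m' * I.toReal = (D * ε) * ε := by rw [hD]; ring
    rw [e] at this
    exact le_of_mul_le_mul_right this hε
  -- The second entry makes `D ε < c`, the first keeps the shell inside the annulus.
  have hε0 : 0 < min (s / 2) (c / (2 * (D + 1))) := lt_min (by positivity) (by positivity)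
  have h4 := main' _ hε0 (min_le_left _ _)
  have h5 : D * min (s / 2) (c / (2 * (D + 1))) ≤ D * (c / (2 * (D + 1))) := by
    gcongr; exact min_le_right _ _
  have h6 : D * (c / (2 * (D + 1))) < c := by
    rw [← mul_div_assoc, div_lt_iff₀ (by positivity)]
    nlinarith
  linarith

lemma not_isEigenvalue_imag {ρ : E3 → ℝ} (hρ : IsCharge ρ) (hW : Wiener ρ) {v : E3}
    (hv : ‖v‖ < 1) {om : ℝ} (hom : om ≠ 0) : ¬ IsEigenvalue ρ v (Complex.I * om) := by
  rintro ⟨Ψ, Pi, Q, P, h, hne⟩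
  have hlam : Complex.I * (om : ℂ) ≠ 0 := mul_ne_zero Complex.I_ne_zero (Complex.ofReal_ne_zero.2 hom)
  refine hne (h.trivial_of_Q hρ hlam (h.Q_eq_zero_of_imag hρ hW hv hom) ?_)
  obtain ⟨u, s, huv, hs, hsym⟩ := symb_imag v hom
  have hu : ‖u‖ < 1 := huv ▸ hv
  -- The second factor of the symbol is positive, so the symbol vanishes only on the ellipsoid `β_u
  -- = s`, a null set.
  filter_upwards [ae_beta_ne hu hs] with ξ hξ
  rw [hsym, Complex.ofReal_ne_zero]
  have := beta_nonneg (v := -u) (by rwa [norm_neg]) ξ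
  have h1 : beta (-u) ξ + s ≠ 0 := by linarith
  have h2 : beta u ξ - s ≠ 0 := sub_ne_zero.2 hξ
  have := Real.pi_ne_zero
  positivity

/-! ### Eigenvalues on the real axis. -/

lemma symb_real_re (v : E3) (lam : ℝ) (ξ : E3) :
    (symb v lam ξ).re = 4 * Real.pi ^ 2 * qform v ξ + lam ^ 2 := by
  have : symb v lam ξ = ((4 * Real.pi ^ 2 * qform v ξ + lam ^ 2 : ℝ) : ℂ)
      + ((-(4 * Real.pi * lam * ⟪ξ, v⟫_ℝ) : ℝ) : ℂ) * Complex.I := by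
    rw [symb, qform]
    push_cast
    linear_combination (4 * (Real.pi : ℂ) ^ 2 * (⟪ξ, v⟫_ℝ : ℂ) ^ 2) * Complex.I_sq
  rw [this, Complex.add_re, Complex.ofReal_re, Complex.re_ofReal_mul, Complex.I_re, mul_zero,
    add_zero]

lemma re_inv_le {z : ℂ} (hz : 0 < z.re) : (z⁻¹).re ≤ z.re⁻¹ := by
  have h1 : 0 < z.re * z.re + z.im * z.im := by nlinarith [mul_self_nonneg z.im]
  rw [Complex.inv_re, inv_eq_one_div, Complex.normSq_apply, div_le_div_iff₀ h1 hz]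
  nlinarith [mul_self_nonneg z.im]

/-- By Parseval, `Q̄·λP` is the integral of `|Q·ξ|² |ρ̂|² (4π²/symb - 1/q)` with `q = |ξ|² -
(ξ·v)²`. Since `Re symb = 4π² q + λ²`, its real part is nonpositive. As `λ` is real and `B_v P =
λQ`, its conjugate is `P̄·B_v P`, so positive definiteness gives `P = 0` and then `λQ = 0`. -/
lemma IsEigenpair.Q_eq_zero_of_real {ρ : E3 → ℝ} (hρ : IsCharge ρ) {v : E3}
    (hv : ‖v‖ < 1) {lam : ℝ} (hlam : lam ≠ 0) {Ψ Pi : E3 → ℂ} {Q P : Fin 3 → ℂ}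
    (h : IsEigenpair ρ v lam Ψ Pi Q P) : Q = 0 := by
  have hlamC : (lam : ℂ) ≠ 0 := Complex.ofReal_ne_zero.2 hlam
  obtain ⟨hΨ2, hF⟩ := h.fourier hρ hlamC
  set r : E3 → ℂ := 𝓕 (chargeC ρ) with hr
  -- the two contributions to the momentum equation
  let f : Fin 3 → E3 → ℂ := fun j ξ =>
    4 * Real.pi ^ 2 * (ξ j : ℂ) * dotQ Q ξ * (‖r ξ‖ : ℂ) ^ 2 / symb v lam ξ
  let g : Fin 3 → Fin 3 → E3 → ℂ := fun j l ξ => ((ξ j * ξ l * ‖r ξ‖ ^ 2 / qform v ξ : ℝ) : ℂ)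
  have hsre : ∀ ξ, 0 < (symb v lam ξ).re := fun ξ => by
    rw [symb_real_re]
    have := (mul_nonneg (one_sub_sq_pos hv).le (sq_nonneg ‖ξ‖)).trans (le_qform v ξ)
    have : 0 < lam ^ 2 := by positivity
    positivity
  have hs0 : ∀ ξ, symb v lam ξ ≠ 0 := fun ξ h0 => by
    have := hsre ξ; rw [h0] at this; simp at this
  have hfae : ∀ j, (fun ξ => (starRingEnd ℂ) (fourierL2 (hρ.memLp_gradC j) ξ) * fourierL2 hΨ2 ξ)
      =ᵐ[volume] f j := by
    intro j
    filter_upwards [hF, hρ.fourier_gradC j] with ξ h1 h2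
    have h3 : fourierL2 hΨ2 ξ = 2 * Real.pi * Complex.I * dotQ Q ξ * r ξ / symb v lam ξ := by
      rw [eq_div_iff (hs0 ξ), mul_comm, h1.1]
    rw [h2, h3]
    simp only [f, map_mul, Complex.conj_ofReal, Complex.conj_I, map_ofNat]
    rw [← Complex.mul_conj']
    linear_combination (-(4 * Real.pi ^ 2 * (ξ j : ℂ) * dotQ Q ξ *
      (r ξ * (starRingEnd ℂ) (r ξ)) / symb v lam ξ)) * Complex.I_sq
  have hfi : ∀ j, Integrable (f j) := fun j => by
    have h1 : MemLp (fun ξ => (starRingEnd ℂ) (fourierL2 (hρ.memLp_gradC j) ξ)) 2 :=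
      (memLp_fourierL2 (hρ.memLp_gradC j)).star
    exact (integrable_mul_of_memLp_two h1 (memLp_fourierL2 hΨ2)).congr (hfae j)
  have hgi : ∀ j l, Integrable (g j l) := fun j l => by
    refine Integrable.ofReal (𝕜 := ℂ) (f := fun ξ : E3 => ξ j * ξ l * ‖r ξ‖ ^ 2 / qform v ξ) ?_
    refine (hρ.integrable_sq_fourier.const_mul (1 - ‖v‖ ^ 2)⁻¹).mono' ?_
      (Eventually.of_forall fun ξ => ?_)
    · have h1 := (continuous_fourier_chargeC hρ).measurable.norm
      have h2 := (continuous_qform v).measurable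
      have h3 : Measurable (fun ξ : E3 => ξ j * ξ l) := by
        have : Continuous (fun ξ : E3 => ξ j * ξ l) := by fun_prop
        exact this.measurable
      exact ((h3.mul (h1.pow_const 2)).div h2).aestronglyMeasurable
    · rcases eq_or_ne ξ 0 with h0 | h0
      · have := one_sub_sq_pos hv
        simp only [h0, PiLp.zero_apply, zero_mul, zero_div, norm_zero]
        positivity
      have hq := qform_pos hv h0
      have hp := one_sub_sq_pos hv
      rw [norm_div, norm_mul, norm_mul, Real.norm_of_nonneg hq.le, Real.norm_of_nonneg (sq_nonneg _),
        div_le_iff₀ hq]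
      have a1 : ‖ξ j‖ * ‖ξ l‖ ≤ ‖ξ‖ ^ 2 := by
        rw [sq]
        exact mul_le_mul (PiLp.norm_apply_le ξ j) (PiLp.norm_apply_le ξ l) (norm_nonneg _)
          (norm_nonneg _)
      have a2 : ‖ξ‖ ^ 2 ≤ (1 - ‖v‖ ^ 2)⁻¹ * qform v ξ := by
        rw [inv_mul_eq_div, le_div_iff₀ hp]
        linarith [le_qform v ξ]
      calc ‖ξ j‖ * ‖ξ l‖ * ‖r ξ‖ ^ 2 ≤ ((1 - ‖v‖ ^ 2)⁻¹ * qform v ξ) * ‖r ξ‖ ^ 2 :=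
            mul_le_mul_of_nonneg_right (a1.trans a2) (sq_nonneg _)
        _ = _ := by ring
  -- The momentum equation in Fourier variables; the soliton term enters with the opposite sign.
  have hP : ∀ j, (lam : ℂ) * P j = (∫ ξ, f j ξ) - ∑ l, Q l * ∫ ξ, g j l ξ := by
    intro j
    rw [← h.eqP j]
    have e1 : ∫ x, Ψ x * ((weakPartial j ρ x : ℝ) : ℂ) = ∫ ξ, f j ξ := by
      rw [← integral_congr_ae (hfae j), integral_conj_mul_fourierL2]
      simp only [gradC, Complex.conj_ofReal, mul_comm]
    simp only [e1, integral_partialD_soliton hρ hv, mul_neg, Finset.sum_neg_distrib, g, hr]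
    ring
  have hsumP : ∑ j, (starRingEnd ℂ) (Q j) * ((lam : ℂ) * P j)
      = ∫ ξ, ∑ j, (starRingEnd ℂ) (Q j) * (f j ξ - ∑ l, Q l * g j l ξ) := by
    have hi : ∀ j, Integrable (fun ξ => ∑ l, Q l * g j l ξ) := fun j =>
      integrable_finsetSum _ fun l _ => (hgi j l).const_mul _
    rw [integral_finsetSum]
    · refine Finset.sum_congr rfl fun j _ => ?_
      rw [integral_const_mul, integral_sub (hfi j) (hi j), integral_finsetSum, hP j]
      · simp only [integral_const_mul]
      · intro l _; exact (hgi j l).const_mul _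
    · intro j _; exact ((hfi j).sub (hi j)).const_mul _
  have hneg : (∑ j, (starRingEnd ℂ) (Q j) * ((lam : ℂ) * P j)).re ≤ 0 := by
    rw [hsumP]
    have hi : Integrable (fun ξ => ∑ j, (starRingEnd ℂ) (Q j) * (f j ξ - ∑ l, Q l * g j l ξ)) :=
      integrable_finsetSum _ fun j _ => ((hfi j).sub (integrable_finsetSum _ fun l _ =>
        (hgi j l).const_mul _)).const_mul _
    have := integral_re hi
    simp only [RCLike.re_to_complex] at this
    rw [← this]
    refine integral_nonpos_of_ae ?_
    filter_upwards [ae_ne_zero] with ξ h0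
    have hq := qform_pos hv h0
    have e : ∑ j, (starRingEnd ℂ) (Q j) * (f j ξ - ∑ l, Q l * g j l ξ)
        = ((‖dotQ Q ξ‖ ^ 2 * ‖r ξ‖ ^ 2 : ℝ) : ℂ) *
          (((4 * Real.pi ^ 2 : ℝ) : ℂ) * (symb v lam ξ)⁻¹ - ((qform v ξ)⁻¹ : ℝ)) := by
      have hn : ((‖dotQ Q ξ‖ ^ 2 : ℝ) : ℂ) = dotQ Q ξ * (starRingEnd ℂ) (dotQ Q ξ) := by
        rw [Complex.mul_conj', Complex.ofReal_pow]
      have hc : (starRingEnd ℂ) (dotQ Q ξ) = ∑ j, (starRingEnd ℂ) (Q j) * (ξ j : ℂ) := by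
        simp [dotQ]
      rw [Complex.ofReal_mul, hn, hc]
      simp only [f, g]
      generalize (symb v lam ξ) = S
      simp only [Fin.sum_univ_three, dotQ]
      push_cast
      ring
    simp only [_root_.Pi.zero_apply]
    rw [e, Complex.re_ofReal_mul, Complex.sub_re, Complex.re_ofReal_mul, Complex.ofReal_re]
    refine mul_nonpos_of_nonneg_of_nonpos (by positivity) ?_
    have h1 := re_inv_le (hsre ξ)
    have h2 : ((symb v lam ξ).re)⁻¹ ≤ (4 * Real.pi ^ 2 * qform v ξ)⁻¹ := by
      refine inv_anti₀ (by positivity) ?_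
      rw [symb_real_re]
      nlinarith [sq_nonneg lam]
    have h3 : 4 * Real.pi ^ 2 * (symb v lam ξ)⁻¹.re
        ≤ 4 * Real.pi ^ 2 * (4 * Real.pi ^ 2 * qform v ξ)⁻¹ := by
      gcongr; exact h1.trans h2
    have h4 : 4 * Real.pi ^ 2 * (4 * Real.pi ^ 2 * qform v ξ)⁻¹ = (qform v ξ)⁻¹ := by
      have := Real.pi_ne_zero
      field_simp
    linarith
  have hBP : (∑ i, (starRingEnd ℂ) (P i) * (B v).mulVec P i).re ≤ 0 := by
    rw [h.eqQ]
    have e : ∑ i, (starRingEnd ℂ) (P i) * ((lam : ℂ) • Q) i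
        = (starRingEnd ℂ) (∑ j, (starRingEnd ℂ) (Q j) * ((lam : ℂ) * P j)) := by
      simp only [map_sum, map_mul, Complex.conj_conj, Complex.conj_ofReal, _root_.Pi.smul_apply,
        smul_eq_mul]
      exact Finset.sum_congr rfl fun i _ => by ring
    rw [e, Complex.conj_re]
    exact hneg
  have hP0 := eq_zero_of_B_form_nonpos hv hBP
  have := h.eqQ
  rw [hP0, Matrix.mulVec_zero] at this
  exact (smul_eq_zero.1 this.symm).resolve_left hlamC

lemma not_isEigenvalue_real {ρ : E3 → ℝ} (hρ : IsCharge ρ) {v : E3}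
    (hv : ‖v‖ < 1) {lam : ℝ} (hlam : lam ≠ 0) : ¬ IsEigenvalue ρ v lam := by
  rintro ⟨Ψ, Pi, Q, P, h, hne⟩
  refine hne (h.trivial_of_Q hρ (Complex.ofReal_ne_zero.2 hlam)
    (h.Q_eq_zero_of_real hρ hv hlam) (Eventually.of_forall fun ξ h0 => ?_))
  have h1 := symb_real_re v lam ξ
  rw [h0, Complex.zero_re] at h1
  have h2 := (mul_nonneg (one_sub_sq_pos hv).le (sq_nonneg ‖ξ‖)).trans (le_qform v ξ)
  have h3 : 0 < lam ^ 2 := by positivity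
  have h4 : 0 ≤ 4 * Real.pi ^ 2 * qform v ξ := by positivity
  linarith

lemma not_isEigenvalue {ρ : E3 → ℝ} (hρ : IsCharge ρ) (hW : Wiener ρ) {v : E3} (hv : ‖v‖ < 1)
    {lam : ℂ} (hlam : lam ≠ 0) (h : lam.re = 0 ∨ lam.im = 0) : ¬ IsEigenvalue ρ v lam := by
  rcases h with h | h
  · have e : lam = Complex.I * (lam.im : ℂ) := by
      apply Complex.ext <;> simp [h]
    have : lam.im ≠ 0 := fun h0 => hlam (Complex.ext h h0)
    rw [e]
    exact not_isEigenvalue_imag hρ hW hv this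
  · have e : lam = (lam.re : ℂ) := by
      apply Complex.ext <;> simp [h]
    have : lam.re ≠ 0 := fun h0 => hlam (Complex.ext h0 h)
    rw [e]
    exact not_isEigenvalue_real hρ hv this

/-! ### The strong Huygens principle for the charge -/

/-- A function on `ℝ³` whose radial integrals vanish has vanishing integral. -/
lemma integral_eq_zero_of_radial {f : E3 → ℝ}
    (h : ∀ θ : E3, ‖θ‖ = 1 → ∫ r in Set.Ioi (0 : ℝ), r ^ 2 * f (r • θ) = 0) : ∫ k, f k = 0 := by
  -- The integral of a nonintegrable function is zero by convention, so polar coordinates are needed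
  -- only for integrable `f`.
  by_cases hf : Integrable f
  swap
  · exact integral_undef hf
  have hmp := (volume : Measure E3).measurePreserving_homeomorphUnitSphereProd
  let e := homeomorphUnitSphereProd E3
  let F : Metric.sphere (0 : E3) 1 × Set.Ioi (0 : ℝ) → ℝ := fun p => f ((p.2 : ℝ) • (p.1 : E3))
  have hFe : ∀ x : ({0}ᶜ : Set E3), F (e x) = f x := by
    intro x
    have := homeomorphUnitSphereProd_symm_apply_coe E3 (e x)
    rw [Homeomorph.symm_apply_apply] at this
    simp only [F]
    rw [← this]
  have h1 : ∫ k, f k = ∫ p, F p ∂((volume : Measure E3).toSphere.prod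
      (Measure.volumeIoiPow (Module.finrank ℝ E3 - 1))) := by
    rw [← hmp.integral_comp (Homeomorph.measurableEmbedding _)]
    have : ∀ x : ({0}ᶜ : Set E3), F ((homeomorphUnitSphereProd E3) x) = f x := hFe
    simp only [this]
    rw [integral_subtype_comap (measurableSet_singleton _).compl fun x => f x,
      restrict_compl_singleton]
  have hFi : Integrable F ((volume : Measure E3).toSphere.prod
      (Measure.volumeIoiPow (Module.finrank ℝ E3 - 1))) := by
    rw [← hmp.integrable_comp_emb (Homeomorph.measurableEmbedding _)]
    have : F ∘ (homeomorphUnitSphereProd E3) = f ∘ ((↑) : ({0}ᶜ : Set E3) → E3) := funext hFe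
    rw [this, ← integrableOn_iff_comap_subtypeVal (measurableSet_singleton _).compl]
    exact hf.integrableOn
  rw [h1, integral_prod _ hFi]
  refine integral_eq_zero_of_ae (Eventually.of_forall fun θ => ?_)
  have hθ : ‖(θ : E3)‖ = 1 := by simp
  simp only [F, Measure.volumeIoiPow, ENNReal.ofReal, Pi.zero_apply]
  rw [integral_withDensity_eq_integral_smul
    (Measurable.real_toNNReal (by fun_prop))]
  refine Eq.trans ?_ (h θ hθ)
  rw [← integral_subtype_comap measurableSet_Ioi
    (fun r : ℝ => r ^ 2 * f (r • (θ : E3)))]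
  refine integral_congr_ae (Eventually.of_forall fun r => ?_)
  have hr : (0 : ℝ) < r := r.2
  simp only [finrank_euclideanSpace_fin, NNReal.smul_def, smul_eq_mul]
  rw [Real.coe_toNNReal _ (by positivity)]

lemma hat_eq_integral (ρ : E3 → ℝ) (k : E3) :
    hat ρ k = c0 * ∫ x, Complex.exp (Complex.I * ((⟪k, x⟫_ℝ : ℝ) : ℂ)) * (ρ x : ℂ) := rfl

/-- `|ρ̂|²` is the Fourier transform of the autocorrelation of the charge. -/
lemma norm_hat_sq_eq (ρ : E3 → ℝ) (k : E3) :
    ((‖hat ρ k‖ ^ 2 : ℝ) : ℂ) = c0 ^ 2 * ∫ p : E3 × E3,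
      Complex.exp (Complex.I * ((⟪k, p.1 - p.2⟫_ℝ : ℝ) : ℂ)) * ((ρ p.1 : ℂ) * (ρ p.2 : ℂ)) := by
  have h1 : ((‖hat ρ k‖ ^ 2 : ℝ) : ℂ) = hat ρ k * (starRingEnd ℂ) (hat ρ k) := by
    rw [Complex.mul_conj', Complex.ofReal_pow]
  rw [h1, hat_eq_integral, map_mul, Complex.conj_ofReal, ← integral_conj]
  have h2 := integral_prod_mul (μ := (volume : Measure E3)) (ν := (volume : Measure E3))
    (fun x => Complex.exp (Complex.I * ((⟪k, x⟫_ℝ : ℝ) : ℂ)) * (ρ x : ℂ))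
    (fun x => (starRingEnd ℂ) (Complex.exp (Complex.I * ((⟪k, x⟫_ℝ : ℝ) : ℂ)) * (ρ x : ℂ)))
  rw [mul_mul_mul_comm, ← h2, ← sq]
  congr 1
  refine integral_congr_ae (Eventually.of_forall fun p => ?_)
  simp only [map_mul, Complex.conj_ofReal, ← Complex.exp_conj, Complex.conj_I]
  rw [mul_mul_mul_comm, ← Complex.exp_add, inner_sub_right]
  congr 2
  push_cast
  ring

/-- The profile `ξ³ |ρ̂(2πξθ)|²` on a line. -/
noncomputable def lineProfile (ρ : E3 → ℝ) (θ : E3) (ξ : ℝ) : ℝ :=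
  ξ ^ 3 * ‖hat ρ ((2 * Real.pi * ξ) • θ)‖ ^ 2

lemma lineProfile_neg {ρ : E3 → ℝ} (hρ : IsCharge ρ) (θ : E3) (ξ : ℝ) :
    lineProfile ρ θ (-ξ) = -lineProfile ρ θ ξ := by
  rw [lineProfile, lineProfile, mul_neg, neg_smul, hρ.hat_neg]; ring

/-- In polar coordinates, integrability of `|k| |ρ̂|²` on space gives that of `r³ |ρ̂|²` on the
half-line, since `ρ̂` is radial; the odd extension covers the other half. -/
lemma integrable_lineProfile {ρ : E3 → ℝ} (hρ : IsCharge ρ) {θ : E3} (hθ : ‖θ‖ = 1) :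
    Integrable (lineProfile ρ θ) := by
  have h1 : IntegrableOn (fun r : ℝ => r ^ 3 * ‖hat ρ (r • θ)‖ ^ 2) (Set.Ioi 0) := by
    have := (integrable_fun_norm_addHaar (E := E3) volume
      (f := fun r : ℝ => r * ‖hat ρ (r • θ)‖ ^ 2)).1 (by
        refine hρ.integrable_norm_mul_hat.congr (Eventually.of_forall fun k => ?_)
        simp only
        rw [hρ.hat_eq_of_norm_eq (k := k) (l := ‖k‖ • θ)]
        rw [norm_smul, hθ, norm_norm, mul_one])
    refine this.congr_fun (fun r _ => ?_) measurableSet_Ioi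
    simp only [finrank_euclideanSpace_fin, smul_eq_mul]
    ring
  have h2 : Integrable ((Set.Ioi (0:ℝ)).indicator (fun r : ℝ => r ^ 3 * ‖hat ρ (r • θ)‖ ^ 2)) :=
    (integrable_indicator_iff measurableSet_Ioi).2 h1
  have h3 : Integrable (fun r : ℝ => r ^ 3 * ‖hat ρ (r • θ)‖ ^ 2) := by
    refine (h2.sub h2.comp_neg).congr (Eventually.of_forall fun r => ?_)
    rcases lt_trichotomy r 0 with hr | hr | hr
    · simp only [Pi.sub_apply, Set.indicator, Set.mem_Ioi, not_lt.2 hr.le, if_false, neg_smul,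
        hρ.hat_neg]
      rw [if_pos (by linarith)]
      ring
    · simp [hr]
    · simp only [Pi.sub_apply, Set.indicator, Set.mem_Ioi, hr, if_true]
      rw [if_neg (by linarith)]
      ring
  have h4 := (h3.comp_mul_left' (R := 2 * Real.pi) (by positivity)).const_mul ((2 * Real.pi) ^ 3)⁻¹
  refine h4.congr (Eventually.of_forall fun ξ => ?_)
  have := Real.pi_ne_zero
  simp only [lineProfile]
  field_simp

lemma deriv_schwartz_eq_zero {u : 𝓢(ℝ, ℂ)} {U : Set ℝ} (hU : IsClosed U) (h : ∀ x ∉ U, u x = 0) :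
    ∀ x ∉ U, SchwartzMap.derivCLM ℂ ℂ u x = 0 := by
  intro x hx
  have : (u : ℝ → ℂ) =ᶠ[𝓝 x] fun _ => 0 := by
    filter_upwards [hU.isOpen_compl.mem_nhds hx] with y hy using h y hy
  rw [SchwartzMap.derivCLM_apply, this.deriv_eq, deriv_const]

lemma fourier_deriv_schwartz (u : 𝓢(ℝ, ℂ)) (ξ : ℝ) :
    𝓕 (SchwartzMap.derivCLM ℂ ℂ u : ℝ → ℂ) ξ
      = 2 * Real.pi * Complex.I * ξ * 𝓕 (u : ℝ → ℂ) ξ := by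
  have h := Real.fourier_deriv u.integrable u.differentiable
    (SchwartzMap.derivCLM ℂ ℂ u).integrable
  exact (congrFun h ξ).trans (smul_eq_mul _ _)

/-- The Fourier transform of the line profile is supported in `[-2R, 2R]`. -/
lemma fourier_lineProfile_eq_zero {ρ : E3 → ℝ} (hρ : IsCharge ρ) {R : ℝ}
    (hR : ∀ x, R ≤ ‖x‖ → ρ x = 0) {θ : E3} (hθ : ‖θ‖ = 1) {τ : ℝ} (hτ : 2 * R < |τ|) :
    𝓕 (fun ξ => (lineProfile ρ θ ξ : ℂ)) τ = 0 := by
  have hint : Integrable (fun ξ => (lineProfile ρ θ ξ : ℂ)) := (integrable_lineProfile hρ hθ).ofReal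
  have hcont : Continuous (𝓕 (fun ξ => (lineProfile ρ θ ξ : ℂ))) :=
    VectorFourier.fourierIntegral_continuous Real.continuous_fourierChar continuous_inner hint
  set U : Set ℝ := {τ | 2 * R < |τ|} with hUdef
  have hU : IsOpen U := isOpen_lt continuous_const continuous_abs
  have hae : ∀ᵐ τ : ℝ, τ ∈ U → 𝓕 (fun ξ => (lineProfile ρ θ ξ : ℂ)) τ = 0 := by
    refine hU.ae_eq_zero_of_integral_contDiff_smul_eq_zero
      (hcont.locallyIntegrable.locallyIntegrableOn _) fun φ h1 h2 h3 => ?_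
    let u : 𝓢(ℝ, ℂ) := (h2.comp_left (g := fun r : ℝ => (r : ℂ)) Complex.ofReal_zero).toSchwartzMap
      (Complex.ofRealCLM.contDiff.comp h1)
    have hu : ∀ x, u x = φ x := fun _ => rfl
    -- The factor `ξ³` of the profile is absorbed by taking `w = u'''`, because `𝓕 w = (2πiξ)³ 𝓕 u`;
    -- the support does not grow.
    let w : 𝓢(ℝ, ℂ) := SchwartzMap.derivCLM ℂ ℂ (SchwartzMap.derivCLM ℂ ℂ
      (SchwartzMap.derivCLM ℂ ℂ u))
    have hu0 : ∀ x ∉ tsupport φ, u x = 0 := fun x hx => by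
      rw [hu, image_eq_zero_of_notMem_tsupport hx]; simp
    have hcl : IsClosed (tsupport φ) := isClosed_tsupport φ
    have hw0 : ∀ x ∉ tsupport φ, w x = 0 :=
      deriv_schwartz_eq_zero hcl (deriv_schwartz_eq_zero hcl (deriv_schwartz_eq_zero hcl hu0))
    have hwF : ∀ ξ : ℝ, 𝓕 (w : ℝ → ℂ) ξ = (2 * Real.pi * Complex.I * ξ) ^ 3 * 𝓕 (u : ℝ → ℂ) ξ := by
      intro ξ
      simp only [w, fourier_deriv_schwartz]
      ring
    have hwFi : Integrable (𝓕 (w : ℝ → ℂ)) := by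
      rw [← SchwartzMap.fourier_coe]; exact (𝓕 w : 𝓢(ℝ, ℂ)).integrable
    have e2 := VectorFourier.integral_fourierIntegral_smul_eq_flip (μ := volume) (ν := volume)
      (L := innerₗ ℝ) (f := u) (g := fun ξ => (lineProfile ρ θ ξ : ℂ)) Real.continuous_fourierChar
      continuous_inner u.integrable hint
    have e3 : ∫ x, φ x • 𝓕 (fun ξ => (lineProfile ρ θ ξ : ℂ)) x
        = ∫ ξ, 𝓕 (u : ℝ → ℂ) ξ * (lineProfile ρ θ ξ : ℂ) := by
      refine Eq.trans ?_ (e2.symm.trans ?_)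
      · simp only [flip_innerₗ, hu, smul_eq_mul, Complex.real_smul]
        rfl
      · rfl
    have hc : (2 * Real.pi * Complex.I : ℂ) ≠ 0 := by
      simp [Real.pi_ne_zero]
    have e4 : ∀ ξ : ℝ, 𝓕 (u : ℝ → ℂ) ξ * (lineProfile ρ θ ξ : ℂ)
        = ((2 * Real.pi * Complex.I) ^ 3)⁻¹ * c0 ^ 2 * ∫ p : E3 × E3,
          Complex.exp (Complex.I * ((⟪(2 * Real.pi * ξ) • θ, p.1 - p.2⟫_ℝ : ℝ) : ℂ))
            * ((ρ p.1 : ℂ) * (ρ p.2 : ℂ)) * 𝓕 (w : ℝ → ℂ) ξ := by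
      intro ξ
      rw [integral_mul_const, hwF, lineProfile, Complex.ofReal_mul, norm_hat_sq_eq]
      field_simp
      push_cast
      ring
    rw [e3]
    simp only [e4]
    rw [integral_const_mul]
    have hρp : Integrable (fun p : E3 × E3 => (ρ p.1 : ℂ) * (ρ p.2 : ℂ)) :=
      hρ.integrableC.mul_prod hρ.integrableC
    have hprod : Integrable (fun q : ℝ × (E3 × E3) =>
        Complex.exp (Complex.I * ((⟪(2 * Real.pi * q.1) • θ, q.2.1 - q.2.2⟫_ℝ : ℝ) : ℂ))
            * ((ρ q.2.1 : ℂ) * (ρ q.2.2 : ℂ)) * 𝓕 (w : ℝ → ℂ) q.1) := by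
      have h0 : Integrable (fun q : ℝ × (E3 × E3) =>
        𝓕 (w : ℝ → ℂ) q.1 * ((ρ q.2.1 : ℂ) * (ρ q.2.2 : ℂ))) := hwFi.mul_prod hρp
      have hm : Continuous (fun q : ℝ × (E3 × E3) =>
        Complex.exp (Complex.I * ((⟪(2 * Real.pi * q.1) • θ, q.2.1 - q.2.2⟫_ℝ : ℝ) : ℂ))) := by
        fun_prop
      refine (h0.bdd_mul (c := 1) hm.aestronglyMeasurable (Eventually.of_forall fun q => ?_)).congr
        (Eventually.of_forall fun q => ?_)
      · rw [mul_comm, Complex.norm_exp_ofReal_mul_I]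
      · simp only; ring
    rw [integral_integral_swap hprod]
    have e5 : ∀ p : E3 × E3, ∫ ξ : ℝ,
        Complex.exp (Complex.I * ((⟪(2 * Real.pi * ξ) • θ, p.1 - p.2⟫_ℝ : ℝ) : ℂ))
            * ((ρ p.1 : ℂ) * (ρ p.2 : ℂ)) * 𝓕 (w : ℝ → ℂ) ξ = 0 := by
      intro p
      by_cases hp1 : R ≤ ‖p.1‖
      · simp [hR _ hp1]
      by_cases hp2 : R ≤ ‖p.2‖
      · simp [hR _ hp2]
      push Not at hp1 hp2
      -- Integrating in `ξ` first gives, by Fourier inversion, the value of `w` at `θ·(x - y)`. Both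
      -- points lie in the ball of radius `R`, so this number has modulus at most `2R`, where `w`
      -- vanishes.
      have hinv : 𝓕⁻ (𝓕 (w : ℝ → ℂ)) = w :=
        w.continuous.fourierInv_fourier_eq w.integrable hwFi
      have hs : |⟪θ, p.1 - p.2⟫_ℝ| ≤ 2 * R := by
        refine (abs_real_inner_le_norm _ _).trans ?_
        rw [hθ, one_mul]
        refine (norm_sub_le _ _).trans ?_
        linarith
      have hw1 : w (⟪θ, p.1 - p.2⟫_ℝ) = 0 := hw0 _ fun hmem =>
        absurd (h3 hmem) (not_lt.2 hs)
      have := congrFun hinv (⟪θ, p.1 - p.2⟫_ℝ)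
      rw [hw1, Real.fourierInv_eq'] at this
      have e6 : ∀ ξ : ℝ, Complex.exp (Complex.I * ((⟪(2 * Real.pi * ξ) • θ, p.1 - p.2⟫_ℝ : ℝ) : ℂ))
            * ((ρ p.1 : ℂ) * (ρ p.2 : ℂ)) * 𝓕 (w : ℝ → ℂ) ξ = ((ρ p.1 : ℂ) * (ρ p.2 : ℂ)) *
          (Complex.exp (((2 * Real.pi * ⟪ξ, ⟪θ, p.1 - p.2⟫_ℝ⟫_ℝ : ℝ) : ℂ) * Complex.I)
            • 𝓕 (w : ℝ → ℂ) ξ) := by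
        intro ξ
        rw [real_inner_smul_left, smul_eq_mul]
        have : Complex.I * ((2 * Real.pi * ξ * ⟪θ, p.1 - p.2⟫_ℝ : ℝ) : ℂ)
          = ((2 * Real.pi * ⟪ξ, ⟪θ, p.1 - p.2⟫_ℝ⟫_ℝ : ℝ) : ℂ) * Complex.I := by
          simp
          ring
        rw [this]
        ring
      simp only [e6]
      rw [integral_const_mul, this, mul_zero]
    simp only [e5, integral_zero, mul_zero]
  -- Continuity upgrades vanishing almost everywhere on the open set to vanishing everywhere on it.
  have heq : Set.EqOn (𝓕 (fun ξ => (lineProfile ρ θ ξ : ℂ))) (fun _ => 0) U := by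
    refine Measure.eqOn_open_of_ae_eq (μ := volume) ?_ hU hcont.continuousOn continuousOn_const
    rw [EventuallyEq, ae_restrict_iff' hU.measurableSet]
    exact hae
  exact heq hτ

/-- The sine transform of `r³ |ρ̂|²` vanishes beyond the diameter of the charge. -/
lemma sine_transform_eq_zero {ρ : E3 → ℝ} (hρ : IsCharge ρ) {R : ℝ}
    (hR : ∀ x, R ≤ ‖x‖ → ρ x = 0) {θ : E3} (hθ : ‖θ‖ = 1) {τ : ℝ} (hτ : 2 * R < |τ|) :
    ∫ r in Set.Ioi (0 : ℝ), r ^ 3 * ‖hat ρ (r • θ)‖ ^ 2 * Real.sin (r * τ) = 0 := by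
  have h0 := fourier_lineProfile_eq_zero hρ hR hθ hτ
  rw [Real.fourier_real_eq_integral_exp_smul] at h0
  have hint : Integrable (fun ξ : ℝ => Complex.exp (((-2 * Real.pi * ξ * τ : ℝ) : ℂ) * Complex.I) •
      (lineProfile ρ θ ξ : ℂ)) := by
    have hm : Continuous (fun ξ : ℝ =>
      Complex.exp (((-2 * Real.pi * ξ * τ : ℝ) : ℂ) * Complex.I)) := by fun_prop
    have hl : Integrable (fun ξ => (lineProfile ρ θ ξ : ℂ)) :=
      (integrable_lineProfile hρ hθ).ofReal
    refine hl.bdd_mul (c := 1) hm.aestronglyMeasurable (Eventually.of_forall fun ξ => ?_)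
    rw [Complex.norm_exp_ofReal_mul_I]
  have h1 := congrArg Complex.im h0
  have h2 := integral_im hint
  simp only [RCLike.im_to_complex] at h2
  rw [← h2, Complex.zero_im] at h1
  -- The profile and the sine are both odd, so the imaginary part of the integrand is even and the
  -- full integral is twice the half-line integral.
  have h3 : ∀ ξ : ℝ, (Complex.exp (((-2 * Real.pi * ξ * τ : ℝ) : ℂ) * Complex.I) •
      (lineProfile ρ θ ξ : ℂ)).im
      = (fun ξ => -(lineProfile ρ θ ξ * Real.sin (2 * Real.pi * ξ * τ))) |ξ| := by
    intro ξ
    rw [smul_eq_mul, Complex.im_mul_ofReal, Complex.exp_ofReal_mul_I_im]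
    have : Real.sin (-2 * Real.pi * ξ * τ) = -Real.sin (2 * Real.pi * ξ * τ) := by
      rw [← Real.sin_neg]; congr 1; ring
    rw [this]
    rcases abs_choice ξ with h | h
    · simp only [h]; ring
    · simp only [h, lineProfile_neg hρ]
      rw [show 2 * Real.pi * -ξ * τ = -(2 * Real.pi * ξ * τ) by ring, Real.sin_neg]
      ring
  simp only [h3] at h1
  rw [integral_comp_abs (f := fun ξ => -(lineProfile ρ θ ξ * Real.sin (2 * Real.pi * ξ * τ))),
    integral_neg] at h1
  have h4 : ∫ ξ in Set.Ioi (0:ℝ), lineProfile ρ θ ξ * Real.sin (2 * Real.pi * ξ * τ) = 0 := by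
    linarith
  have h5 := integral_comp_mul_left_Ioi
    (fun r => r ^ 3 * ‖hat ρ (r • θ)‖ ^ 2 * Real.sin (r * τ)) 0 Real.two_pi_pos
  rw [mul_zero] at h5
  have h6 : ∀ ξ : ℝ, (2 * Real.pi * ξ) ^ 3 * ‖hat ρ ((2 * Real.pi * ξ) • θ)‖ ^ 2
      * Real.sin (2 * Real.pi * ξ * τ)
      = (2 * Real.pi) ^ 3 * (lineProfile ρ θ ξ * Real.sin (2 * Real.pi * ξ * τ)) := by
    intro ξ; rw [lineProfile]; ring
  simp only [h6] at h5
  rw [integral_const_mul, h4, mul_zero] at h5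
  have := h5.symm
  simpa [Real.pi_ne_zero] using this

/-! ### Analytic continuation of `H` -/

/-- The density `k_i k_j |ρ̂(k)|² / |k|`. -/
noncomputable def dens (ρ : E3 → ℝ) (i j : Fin 3) (k : E3) : ℝ :=
  k i * k j * ‖hat ρ k‖ ^ 2 / ‖k‖

lemma measurable_dens {ρ : E3 → ℝ} (hρ : IsCharge ρ) (i j : Fin 3) : Measurable (dens ρ i j) := by
  have h1 := hρ.continuous_hat
  have h2 : Continuous (fun k : E3 => k i * k j * ‖hat ρ k‖ ^ 2) := by fun_prop
  exact h2.measurable.div measurable_norm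

lemma norm_dens_le (ρ : E3 → ℝ) (i j : Fin 3) (k : E3) :
    ‖dens ρ i j k‖ ≤ ‖k‖ * ‖hat ρ k‖ ^ 2 := by
  rcases eq_or_ne k 0 with h0 | h0
  · simp [dens, h0]
  have hk : 0 < ‖k‖ := norm_pos_iff.2 h0
  rw [dens, norm_div, norm_mul, norm_mul, norm_norm, div_le_iff₀ hk, norm_pow, norm_norm]
  calc ‖k i‖ * ‖k j‖ * ‖hat ρ k‖ ^ 2 ≤ (‖k‖ * ‖k‖) * ‖hat ρ k‖ ^ 2 := by
        gcongr
        · exact PiLp.norm_apply_le k i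
        · exact PiLp.norm_apply_le k j
    _ = _ := by ring

lemma integrable_dens {ρ : E3 → ℝ} (hρ : IsCharge ρ) (i j : Fin 3) : Integrable (dens ρ i j) :=
  hρ.integrable_norm_mul_hat.mono' (measurable_dens hρ i j).aestronglyMeasurable
    (Eventually.of_forall fun k => norm_dens_le ρ i j k)

lemma dens_neg {ρ : E3 → ℝ} (hρ : IsCharge ρ) (i j : Fin 3) (k : E3) :
    dens ρ i j (-k) = dens ρ i j k := by
  simp [dens, hρ.hat_neg]

lemma beta_neg_neg (v k : E3) : beta (-v) (-k) = beta v k := by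
  simp [beta]

/-- The imaginary part of `b + I * lam` is `lam.re`. This bounds the denominators away from zero
uniformly in `k`. -/
lemma re_le_norm_add {lam : ℂ} (b : ℝ) : lam.re ≤ ‖(b : ℂ) + Complex.I * lam‖ := by
  refine le_trans ?_ (Complex.abs_im_le_norm _)
  simp [le_abs_self]

lemma re_le_norm_sub {lam : ℂ} (b : ℝ) : lam.re ≤ ‖(b : ℂ) - Complex.I * lam‖ := by
  refine le_trans ?_ (Complex.abs_im_le_norm _)
  simp [le_abs_self]

lemma add_ne_zero_of_re_pos {lam : ℂ} (h : 0 < lam.re) (b : ℝ) : (b : ℂ) + Complex.I * lam ≠ 0 :=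
  norm_pos_iff.1 (h.trans_le (re_le_norm_add b))

lemma sub_ne_zero_of_re_pos {lam : ℂ} (h : 0 < lam.re) (b : ℝ) : (b : ℂ) - Complex.I * lam ≠ 0 :=
  norm_pos_iff.1 (h.trans_le (re_le_norm_sub b))

lemma sq_add_sq_eq (b lam : ℂ) :
    b ^ 2 + lam ^ 2 = (b + Complex.I * lam) * (b - Complex.I * lam) := by
  linear_combination lam ^ 2 * Complex.I_sq

/-- An integrable density divided by a function bounded away from zero is integrable. -/
lemma integrable_div_of_le {f : E3 → ℝ} (hf : Integrable f) {g : E3 → ℂ} (hg : Measurable g)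
    {c : ℝ} (hc : 0 < c) (hgc : ∀ k, c ≤ ‖g k‖) : Integrable (fun k => (f k : ℂ) / g k) := by
  have : Integrable (fun k => (f k : ℂ) * (g k)⁻¹) := by
    refine (hf.ofReal (𝕜 := ℂ)).mul_bdd (c := c⁻¹) hg.inv.aestronglyMeasurable
      (Eventually.of_forall fun k => ?_)
    rw [norm_inv]
    exact inv_anti₀ hc (hgc k)
  simpa only [div_eq_mul_inv] using this

lemma measurable_beta_add (v : E3) (c : ℂ) : Measurable (fun k => (beta v k : ℂ) + c) :=
  ((Complex.continuous_ofReal.comp (continuous_beta v)).add continuous_const).measurable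

/-- The symmetrized integrand of `H`. -/
lemma H_eq_symm {ρ : E3 → ℝ} (hρ : IsCharge ρ) (v : E3) {lam : ℂ} (hlam : 0 < lam.re)
    (i j : Fin 3) :
    H ρ v lam i j
      = ∫ k, (dens ρ i j k : ℂ) * ((beta v k : ℂ) / ((beta v k : ℂ) ^ 2 + lam ^ 2)) := by
  have hI1 : Integrable (fun k => (dens ρ i j k : ℂ) / ((beta v k : ℂ) + Complex.I * lam)) :=
    integrable_div_of_le (integrable_dens hρ i j) (measurable_beta_add v _) hlam
      fun k => re_le_norm_add _
  have hI2 : ∀ w : E3,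
      Integrable (fun k => (dens ρ i j k : ℂ) / ((beta w k : ℂ) - Complex.I * lam)) := fun w =>
    integrable_div_of_le (integrable_dens hρ i j)
      (by simpa only [sub_eq_add_neg] using measurable_beta_add w (-(Complex.I * lam))) hlam
      fun k => re_le_norm_sub _
  have e1 : H ρ v lam i j
      = ∫ k, 2⁻¹ * ((dens ρ i j k : ℂ) / ((beta v k : ℂ) + Complex.I * lam)
        + (dens ρ i j k : ℂ) / ((beta (-v) k : ℂ) - Complex.I * lam)) := by
    rw [H, Matrix.of_apply]
    refine integral_congr_ae ?_
    filter_upwards [ae_ne_zero] with k hk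
    have hk0 : (‖k‖ : ℂ) ≠ 0 := Complex.ofReal_ne_zero.2 (norm_ne_zero_iff.2 hk)
    have h1 := add_ne_zero_of_re_pos hlam (beta v k)
    have h2 := sub_ne_zero_of_re_pos hlam (beta (-v) k)
    have hD : (((‖k‖ ^ 2 : ℝ) : ℂ) + (Complex.I * ((⟪k, v⟫_ℝ : ℝ) : ℂ) + lam) ^ 2)
        = ((beta v k : ℂ) + Complex.I * lam) * ((beta (-v) k : ℂ) - Complex.I * lam) := by
      simp only [beta, inner_neg_right]
      push_cast
      linear_combination (((⟪k, v⟫_ℝ : ℝ) : ℂ) ^ 2 + lam ^ 2) * Complex.I_sq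
    -- The two factors of the denominator add up to `2|k|`, whence `1/(XY) = (1/X + 1/Y)/(2|k|)`;
    -- this is the origin of the weight `1/|k|` in `dens`.
    have hsum : ((beta v k : ℂ) + Complex.I * lam) + ((beta (-v) k : ℂ) - Complex.I * lam)
        = 2 * ‖k‖ := by
      simp only [beta, inner_neg_right]
      push_cast
      ring
    rw [hD, div_add_div _ _ h1 h2, dens]
    push_cast
    generalize (beta v k : ℂ) + Complex.I * lam = X at *
    generalize (beta (-v) k : ℂ) - Complex.I * lam = Y at *
    field_simp
    linear_combination (-((k i : ℂ) * (k j : ℂ) * (‖hat ρ k‖ : ℂ) ^ 2)) * hsum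
  -- The reflection `k ↦ -k` exchanges `β_{-v}` with `β_v`, so a single phase function remains.
  have e2 : ∫ k, (dens ρ i j k : ℂ) / ((beta (-v) k : ℂ) - Complex.I * lam)
      = ∫ k, (dens ρ i j k : ℂ) / ((beta v k : ℂ) - Complex.I * lam) := by
    rw [← integral_neg_eq_self]
    simp only [dens_neg hρ, beta_neg_neg]
  rw [e1, integral_const_mul, integral_add hI1 (hI2 (-v)), e2, ← integral_add hI1 (hI2 v),
    ← integral_const_mul]
  refine integral_congr_ae (Eventually.of_forall fun k => ?_)
  have h1 := add_ne_zero_of_re_pos hlam (beta v k)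
  have h2 := sub_ne_zero_of_re_pos hlam (beta v k)
  simp only [sq_add_sq_eq]
  field_simp
  ring

/-- The Laplace transform of the sine. -/
lemma integral_exp_mul_sin {lam : ℂ} (hlam : 0 < lam.re) (b : ℝ) :
    ∫ t in Set.Ioi (0 : ℝ), Complex.exp (-lam * t) * (Real.sin (t * b) : ℂ)
      = (b : ℂ) / ((b : ℂ) ^ 2 + lam ^ 2) := by
  have hr1 : (-lam + Complex.I * b).re < 0 := by simp [hlam]
  have hr2 : (-lam - Complex.I * b).re < 0 := by simp [hlam]
  have i1 := integrableOn_exp_mul_complex_Ioi hr1 0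
  have i2 := integrableOn_exp_mul_complex_Ioi hr2 0
  have e : ∀ t : ℝ, Complex.exp (-lam * t) * (Real.sin (t * b) : ℂ)
      = (2 * Complex.I)⁻¹ * (Complex.exp ((-lam + Complex.I * b) * t)
        - Complex.exp ((-lam - Complex.I * b) * t)) := by
    intro t
    have a1 : Complex.exp ((-lam + Complex.I * b) * t)
        = Complex.exp (-lam * t) * Complex.exp ((t * b : ℂ) * Complex.I) := by
      rw [← Complex.exp_add]; congr 1; ring
    have a2 : Complex.exp ((-lam - Complex.I * b) * t)
        = Complex.exp (-lam * t) * Complex.exp (-(t * b : ℂ) * Complex.I) := by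
      rw [← Complex.exp_add]; congr 1; ring
    rw [a1, a2, Complex.ofReal_sin, Complex.sin]
    push_cast
    have := Complex.I_ne_zero
    field_simp
    linear_combination (Complex.exp (-((t : ℂ) * b * Complex.I))
      - Complex.exp ((t : ℂ) * b * Complex.I)) * Complex.I_sq
  simp only [e]
  rw [integral_const_mul, integral_sub i1 i2, integral_exp_mul_complex_Ioi hr1,
    integral_exp_mul_complex_Ioi hr2]
  have n1 : -lam + Complex.I * b ≠ 0 := fun h0 => by rw [h0] at hr1; simp at hr1
  have n2 : -lam - Complex.I * b ≠ 0 := fun h0 => by rw [h0] at hr2; simp at hr2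
  have n3 : (b : ℂ) ^ 2 + lam ^ 2 ≠ 0 := by
    rw [sq_add_sq_eq]
    exact mul_ne_zero (add_ne_zero_of_re_pos hlam b) (sub_ne_zero_of_re_pos hlam b)
  simp only [Complex.ofReal_zero, mul_zero, Complex.exp_zero]
  have := Complex.I_ne_zero
  field_simp
  linear_combination (2 * (b : ℂ) ^ 3 * Complex.I) * Complex.I_sq

/-- The memory kernel `W(t)`, whose Laplace transform is `H`. -/
noncomputable def memory (ρ : E3 → ℝ) (v : E3) (i j : Fin 3) (t : ℝ) : ℝ :=
  ∫ k, dens ρ i j k * Real.sin (t * beta v k)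

lemma continuous_memory {ρ : E3 → ℝ} (hρ : IsCharge ρ) (v : E3) (i j : Fin 3) :
    Continuous (memory ρ v i j) := by
  refine continuous_of_dominated (bound := fun k => ‖dens ρ i j k‖) (fun t => ?_) (fun t => ?_)
    (integrable_dens hρ i j).norm (Eventually.of_forall fun k => by fun_prop)
  · have := continuous_beta v
    have h2 : Continuous (fun k => Real.sin (t * beta v k)) := by fun_prop
    exact ((measurable_dens hρ i j).mul h2.measurable).aestronglyMeasurable
  · refine Eventually.of_forall fun k => ?_
    rw [norm_mul]
    exact mul_le_of_le_one_right (norm_nonneg _) (Real.abs_sin_le_one _)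

/-- Fubini applied to the Laplace transform of the sine: for `Re λ > 0` the product of `dens` and
`e^{-λt}` is absolutely integrable, and the sine is bounded. -/
lemma H_eq_laplace {ρ : E3 → ℝ} (hρ : IsCharge ρ) (v : E3) {lam : ℂ} (hlam : 0 < lam.re)
    (i j : Fin 3) :
    H ρ v lam i j
      = ∫ t in Set.Ioi (0 : ℝ), Complex.exp (-lam * t) * (memory ρ v i j t : ℂ) := by
  have hprod : Integrable (fun p : E3 × ℝ => (dens ρ i j p.1 : ℂ) *
      (Complex.exp (-lam * p.2) * (Real.sin (p.2 * beta v p.1) : ℂ)))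
      ((volume : Measure E3).prod (volume.restrict (Set.Ioi (0 : ℝ)))) := by
    have h1 : Integrable (fun t : ℝ => Complex.exp (-lam * t)) (volume.restrict (Set.Ioi (0:ℝ))) :=
      integrableOn_exp_mul_complex_Ioi (by simpa using hlam) 0
    have h0 : Integrable (fun p : E3 × ℝ => (dens ρ i j p.1 : ℂ) * Complex.exp (-lam * p.2))
        ((volume : Measure E3).prod (volume.restrict (Set.Ioi (0 : ℝ)))) :=
      ((integrable_dens hρ i j).ofReal (𝕜 := ℂ)).mul_prod h1
    have hb := continuous_beta v
    have hm : Continuous (fun p : E3 × ℝ => (Real.sin (p.2 * beta v p.1) : ℂ)) := by fun_prop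
    refine (h0.mul_bdd (c := 1) hm.aestronglyMeasurable (Eventually.of_forall fun p => ?_)).congr
      (Eventually.of_forall fun p => ?_)
    · rw [Complex.norm_real]; exact Real.abs_sin_le_one _
    · simp only; ring
  rw [H_eq_symm hρ v hlam]
  simp only [← integral_exp_mul_sin hlam, ← integral_const_mul]
  rw [integral_integral_swap hprod]
  refine integral_congr_ae (Eventually.of_forall fun t => ?_)
  simp only [memory]
  rw [← integral_complex_ofReal, ← integral_const_mul]
  refine integral_congr_ae (Eventually.of_forall fun k => ?_)
  simp only
  push_cast
  ring

/-- The memory kernel vanishes for large times. -/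
lemma memory_eq_zero {ρ : E3 → ℝ} (hρ : IsCharge ρ) {R : ℝ} (hR : ∀ x, R ≤ ‖x‖ → ρ x = 0)
    {v : E3} (i j : Fin 3) {t : ℝ} (ht0 : 0 < t) (ht : 2 * R < t * (1 - ‖v‖)) :
    memory ρ v i j t = 0 := by
  refine integral_eq_zero_of_radial fun θ hθ => ?_
  -- On the unit sphere `β` is bounded below, so one time threshold serves all directions.
  have hb : 1 - ‖v‖ ≤ beta v θ := by simpa [hθ] using le_beta v θ
  have hτ : 2 * R < |t * beta v θ| :=
    ht.trans_le ((mul_le_mul_of_nonneg_left hb ht0.le).trans (le_abs_self _))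
  have h := sine_transform_eq_zero hρ hR hθ hτ
  have e : ∀ r ∈ Set.Ioi (0 : ℝ), r ^ 2 * (dens ρ i j (r • θ) * Real.sin (t * beta v (r • θ)))
      = (θ i * θ j) * (r ^ 3 * ‖hat ρ (r • θ)‖ ^ 2 * Real.sin (r * (t * beta v θ))) := by
    intro r hr
    have hr0 : (0 : ℝ) < r := hr
    rw [dens, beta_smul v θ hr0.le, norm_smul, hθ, Real.norm_of_nonneg hr0.le,
      show t * (r * beta v θ) = r * (t * beta v θ) by ring]
    simp only [PiLp.smul_apply, smul_eq_mul, mul_one]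
    field_simp
  rw [setIntegral_congr_fun measurableSet_Ioi e, integral_const_mul, h, mul_zero]

/-- The entire continuation of `H`. -/
noncomputable def Hext (ρ : E3 → ℝ) (v : E3) (T : ℝ) (lam : ℂ) : Matrix (Fin 3) (Fin 3) ℂ :=
  Matrix.of fun i j => ∫ t in Set.Ioc (0 : ℝ) T, Complex.exp (-lam * t) * (memory ρ v i j t : ℂ)

lemma exists_Hext {ρ : E3 → ℝ} (hρ : IsCharge ρ) {v : E3} (hv : ‖v‖ < 1) :
    ∃ T : ℝ, ∀ lam : ℂ, 0 < lam.re → H ρ v lam = Hext ρ v T lam := by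
  obtain ⟨R, hR⟩ := hρ.support
  have hv' : 0 < 1 - ‖v‖ := by linarith
  -- The threshold is that of `memory_eq_zero`; `|R|` is used because the radius in `support`
  -- carries no sign condition.
  refine ⟨2 * |R| / (1 - ‖v‖), fun lam hlam => ?_⟩
  ext i j
  rw [H_eq_laplace hρ v hlam, Hext, Matrix.of_apply]
  refine setIntegral_eq_of_subset_of_forall_sdiff_eq_zero measurableSet_Ioi
    Set.Ioc_subset_Ioi_self fun t ht => ?_
  have h0 : 0 < t := ht.1
  have h1 : 2 * |R| / (1 - ‖v‖) < t := by
    by_contra hc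
    exact ht.2 ⟨h0, not_lt.1 hc⟩
  rw [div_lt_iff₀ hv'] at h1
  rw [memory_eq_zero hρ hR i j h0 (lt_of_le_of_lt (by linarith [le_abs_self R]) h1)]
  simp

/-- Over a bounded time interval the kernel is bounded and `e^{-λt}` is bounded locally uniformly in
`λ`, so differentiation under the integral needs no condition on `Re λ`. -/
lemma differentiable_Hext {ρ : E3 → ℝ} (hρ : IsCharge ρ) (v : E3) (T : ℝ) (i j : Fin 3) :
    Differentiable ℂ (fun lam => Hext ρ v T lam i j) := by
  intro lam
  have hW := continuous_memory hρ v i j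
  have hfin : IsFiniteMeasure (volume.restrict (Set.Ioc (0 : ℝ) T)) := ⟨by simp⟩
  obtain ⟨C, hC⟩ := (isCompact_Icc (a := (0 : ℝ)) (b := T)).exists_bound_of_continuousOn
    hW.continuousOn
  have hcont : ∀ lam : ℂ, Continuous
      (fun t : ℝ => Complex.exp (-lam * t) * (memory ρ v i j t : ℂ)) := fun lam => by fun_prop
  have key := hasDerivAt_integral_of_dominated_loc_of_deriv_le
    (μ := volume.restrict (Set.Ioc (0 : ℝ) T)) (𝕜 := ℂ) (x₀ := lam) (s := Metric.ball lam 1)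
    (F := fun lam t => Complex.exp (-lam * t) * (memory ρ v i j t : ℂ))
    (F' := fun lam t => -t * Complex.exp (-lam * t) * (memory ρ v i j t : ℂ))
    (bound := fun _ => |T| * Real.exp ((‖lam‖ + 1) * |T|) * |C|)
    (Metric.ball_mem_nhds lam one_pos)
    (Eventually.of_forall fun l => (hcont l).aestronglyMeasurable)
    (((hcont lam).integrableOn_Icc (a := 0) (b := T)).mono_set Set.Ioc_subset_Icc_self)
    (Continuous.aestronglyMeasurable (by fun_prop)) ?_ (integrable_const _) ?_
  · exact key.2.differentiableAt
  · filter_upwards [ae_restrict_mem measurableSet_Ioc] with t ht l hl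
    have ht0 : 0 < t := ht.1
    have htT : t ≤ |T| := ht.2.trans (le_abs_self T)
    have hl' : ‖l‖ ≤ ‖lam‖ + 1 := by
      have : ‖l - lam‖ < 1 := by simpa [dist_eq_norm] using hl
      have := norm_le_norm_add_norm_sub' l lam
      linarith
    rw [norm_mul, norm_mul, norm_neg, Complex.norm_real, Complex.norm_real, Complex.norm_exp,
      Real.norm_of_nonneg ht0.le]
    have hre : (-l * t).re ≤ (‖lam‖ + 1) * |T| := by
      refine (Complex.re_le_norm _).trans ?_
      rw [norm_mul, norm_neg, Complex.norm_real, Real.norm_of_nonneg ht0.le]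
      gcongr
    gcongr
    exact (hC t ⟨ht0.le, ht.2⟩).trans (le_abs_self C)
  · refine Eventually.of_forall fun t l _ => ?_
    have h1 : HasDerivAt (fun l : ℂ => -l * (t : ℂ)) (-(t : ℂ)) l := by
      simpa using ((hasDerivAt_id l).neg.mul_const (t : ℂ))
    have h2 := (h1.cexp).mul_const (memory ρ v i j t : ℂ)
    refine h2.congr_deriv ?_
    ring

/-! ### Invertibility on the imaginary axis -/

/-- The hermitian form of a `3 × 3` matrix. -/
noncomputable def hform (A : Matrix (Fin 3) (Fin 3) ℂ) (Q : Fin 3 → ℂ) : ℂ :=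
  ∑ i, (starRingEnd ℂ) (Q i) * A.mulVec Q i

/-- The density `|Q·k|² |ρ̂(k)|² / |k|`. -/
noncomputable def densQ (ρ : E3 → ℝ) (Q : Fin 3 → ℂ) (k : E3) : ℝ :=
  ‖dotQ Q k‖ ^ 2 * ‖hat ρ k‖ ^ 2 / ‖k‖

lemma sum_dens_eq (ρ : E3 → ℝ) (Q : Fin 3 → ℂ) (k : E3) :
    ∑ i, (starRingEnd ℂ) (Q i) * ∑ j, (dens ρ i j k : ℂ) * Q j = (densQ ρ Q k : ℂ) := by
  have hn : ((‖dotQ Q k‖ ^ 2 : ℝ) : ℂ) = dotQ Q k * (starRingEnd ℂ) (dotQ Q k) := by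
    rw [Complex.mul_conj', Complex.ofReal_pow]
  have hc : (starRingEnd ℂ) (dotQ Q k) = ∑ j, (starRingEnd ℂ) (Q j) * (k j : ℂ) := by
    simp [dotQ]
  rw [densQ, Complex.ofReal_div, Complex.ofReal_mul, hn, hc]
  simp only [dens, dotQ, Fin.sum_univ_three]
  push_cast
  ring

lemma integrable_dens_mul {ρ : E3 → ℝ} (hρ : IsCharge ρ) (v : E3) {lam : ℂ}
    (hlam : 0 < lam.re) (i j : Fin 3) :
    Integrable (fun k => (dens ρ i j k : ℂ) *
      ((beta v k : ℂ) / ((beta v k : ℂ) ^ 2 + lam ^ 2))) := by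
  have hI1 : Integrable (fun k => (dens ρ i j k : ℂ) / ((beta v k : ℂ) + Complex.I * lam)) :=
    integrable_div_of_le (integrable_dens hρ i j) (measurable_beta_add v _) hlam
      fun k => re_le_norm_add _
  have hI2 : Integrable (fun k => (dens ρ i j k : ℂ) / ((beta v k : ℂ) - Complex.I * lam)) :=
    integrable_div_of_le (integrable_dens hρ i j)
      (by simpa only [sub_eq_add_neg] using measurable_beta_add v (-(Complex.I * lam))) hlam
      fun k => re_le_norm_sub _
  refine ((hI1.add hI2).const_mul 2⁻¹).congr (Eventually.of_forall fun k => ?_)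
  have h1 := add_ne_zero_of_re_pos hlam (beta v k)
  have h2 := sub_ne_zero_of_re_pos hlam (beta v k)
  simp only [sq_add_sq_eq, Pi.add_apply]
  field_simp
  ring

/-- Contracting `dens` with `Q̄` and `Q` gives the nonnegative density `densQ`, so the form of `H`
is governed by a single scalar kernel. -/
lemma hform_H {ρ : E3 → ℝ} (hρ : IsCharge ρ) (v : E3) {lam : ℂ}
    (hlam : 0 < lam.re) (Q : Fin 3 → ℂ) :
    Integrable (fun k => (densQ ρ Q k : ℂ) * ((beta v k : ℂ) / ((beta v k : ℂ) ^ 2 + lam ^ 2))) ∧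
    hform (H ρ v lam) Q
      = ∫ k, (densQ ρ Q k : ℂ) * ((beta v k : ℂ) / ((beta v k : ℂ) ^ 2 + lam ^ 2)) := by
  have hi := integrable_dens_mul hρ v hlam
  have e : ∀ k, (densQ ρ Q k : ℂ) * ((beta v k : ℂ) / ((beta v k : ℂ) ^ 2 + lam ^ 2))
      = ∑ i, ∑ j, ((starRingEnd ℂ) (Q i) * Q j) * ((dens ρ i j k : ℂ) *
        ((beta v k : ℂ) / ((beta v k : ℂ) ^ 2 + lam ^ 2))) := by
    intro k
    rw [← sum_dens_eq, Finset.sum_mul]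
    refine Finset.sum_congr rfl fun i _ => ?_
    rw [mul_assoc, Finset.sum_mul, Finset.mul_sum]
    exact Finset.sum_congr rfl fun j _ => by ring
  simp only [e]
  refine ⟨integrable_finsetSum _ fun i _ => integrable_finsetSum _ fun j _ =>
    (hi i j).const_mul _, ?_⟩
  rw [integral_finsetSum _ fun i _ => integrable_finsetSum _ fun j _ => (hi i j).const_mul _, hform]
  refine Finset.sum_congr rfl fun i _ => ?_
  rw [integral_finsetSum _ fun j _ => (hi i j).const_mul _, Matrix.mulVec, dotProduct,
    Finset.mul_sum]
  refine Finset.sum_congr rfl fun j _ => ?_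
  rw [integral_const_mul, H_eq_symm hρ v hlam]
  ring

/-- The denominator is `((b - |ω|)² + ε²)((b + |ω|)² + ε²)`, at most `2ε² · 9ω²` on the shell. The
kernel thus has height of order `1/ε` on a shell of width of order `ε`, like an approximate delta
function. -/
lemma shell_kernel_bound {om ε b : ℝ} (hε : 0 < ε) (hε2 : ε ≤ |om| / 2) (h1 : |om| - ε ≤ b)
    (h2 : b < |om| + ε) :
    1 / (18 * ε * om ^ 2) ≤
      2 * ε / Complex.normSq ((b : ℂ) ^ 2 + (Complex.I * om + ε) ^ 2) := by
  have hs : 0 < |om| := by linarith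
  have hom2 : 0 < om ^ 2 := by rw [← sq_abs]; positivity
  have hb : 0 < b := by linarith
  have hN : Complex.normSq ((b : ℂ) ^ 2 + (Complex.I * om + ε) ^ 2)
      = ((b - |om|) ^ 2 + ε ^ 2) * ((b + |om|) ^ 2 + ε ^ 2) := by
    have e : (b : ℂ) ^ 2 + (Complex.I * om + ε) ^ 2
        = ((b ^ 2 - om ^ 2 + ε ^ 2 : ℝ) : ℂ) + ((2 * om * ε : ℝ) : ℂ) * Complex.I := by
      push_cast
      linear_combination (om : ℂ) ^ 2 * Complex.I_sq
    rw [e, Complex.normSq_add_mul_I]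
    have := sq_abs om
    rw [← this]
    have h4 : (2 * om * ε) ^ 2 = (2 * |om| * ε) ^ 2 := by
      rw [mul_pow, mul_pow, mul_pow, mul_pow, sq_abs]
    rw [h4]
    ring
  have b1 : (b - |om|) ^ 2 + ε ^ 2 ≤ 2 * ε ^ 2 := by
    have : (b - |om|) ^ 2 ≤ ε ^ 2 := sq_le_sq' (by linarith) (by linarith)
    linarith
  have b2 : (b + |om|) ^ 2 + ε ^ 2 ≤ 9 * om ^ 2 := by
    rw [← sq_abs om]
    nlinarith
  have hpos : 0 < ((b - |om|) ^ 2 + ε ^ 2) * ((b + |om|) ^ 2 + ε ^ 2) := by positivity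
  rw [hN, div_le_div_iff₀ (by positivity) hpos]
  have : ((b - |om|) ^ 2 + ε ^ 2) * ((b + |om|) ^ 2 + ε ^ 2) ≤ (2 * ε ^ 2) * (9 * om ^ 2) := by
    gcongr
  nlinarith [mul_pos (mul_pos hε hε) hom2]

/-- The imaginary part of the form of `H(iω+ε)` stays away from zero. -/
lemma exists_im_hform_lower {ρ : E3 → ℝ} (hρ : IsCharge ρ) (hW : Wiener ρ) {v : E3}
    (hv : ‖v‖ < 1) {om : ℝ} (hom : om ≠ 0) {Q : Fin 3 → ℂ} (hQ : Q ≠ 0) :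
    ∃ κ : ℝ, 0 < κ ∧ ∀ ε : ℝ, 0 < ε → ε ≤ |om| / 2 →
      κ ≤ -(hform (H ρ v (Complex.I * om + ε)) Q).im / om := by
  set s := |om| with hsdef
  have hs : 0 < s := abs_pos.2 hom
  have hom2 : 0 < om ^ 2 := by positivity
  obtain ⟨c, hc, hshell⟩ := exists_shell_lower_bound hv hQ hs
  set b := 2 * s / (1 - ‖v‖) with hb
  have hb0 : 0 < b := div_pos (by linarith) (by linarith)
  obtain ⟨m, hm, hlow⟩ := hρ.exists_hat_lower_bound hW (a := s / 4) (b := b) (by positivity)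
  -- The factors bound, in order, `|ρ̂|²/|k|`, `β`, the kernel without its `1/ε`, and the shell mass
  -- without its `ε`; these two powers of `ε` cancel.
  refine ⟨m / b * (s / 2) * (1 / (18 * om ^ 2)) * c, by positivity, fun ε hε hεs => ?_⟩
  set lam : ℂ := Complex.I * om + ε with hlamdef
  have hlam : 0 < lam.re := by simp [hlamdef, hε]
  obtain ⟨hint, hform_eq⟩ := hform_H hρ v hlam Q
  -- the imaginary part as the integral of a nonnegative function
  set G : E3 → ℝ := fun k => densQ ρ Q k * (beta v k *
    (2 * ε / Complex.normSq ((beta v k : ℂ) ^ 2 + lam ^ 2))) with hG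
  have him : ∀ k, ((densQ ρ Q k : ℂ) * ((beta v k : ℂ) / ((beta v k : ℂ) ^ 2 + lam ^ 2))).im
      = -om * G k := by
    intro k
    rw [Complex.im_ofReal_mul, div_eq_mul_inv, Complex.im_ofReal_mul, Complex.inv_im]
    have : ((beta v k : ℂ) ^ 2 + lam ^ 2).im = 2 * om * ε := by
      rw [hlamdef, sq, sq]
      simp
      ring
    rw [this, hG]
    ring
  have hGi : Integrable G := by
    refine (hint.im.const_mul (-om)⁻¹).congr (Eventually.of_forall fun k => ?_)
    simp only [RCLike.im_to_complex, him]
    rw [inv_mul_cancel_left₀ (neg_ne_zero.2 hom)]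
  have hdens0 : ∀ k, 0 ≤ densQ ρ Q k := fun k => by unfold densQ; positivity
  have hG0 : ∀ k, 0 ≤ G k := fun k => by
    have := beta_nonneg hv k
    have := hdens0 k
    have := Complex.normSq_nonneg ((beta v k : ℂ) ^ 2 + lam ^ 2)
    simp only [hG]
    positivity
  have hval : -(hform (H ρ v lam) Q).im / om = ∫ k, G k := by
    have h2 := integral_im hint
    simp only [RCLike.im_to_complex, him] at h2
    rw [hform_eq, ← h2, integral_const_mul]
    field_simp
  rw [hval]
  have hlow2 : ∀ k, s - ε ≤ beta v k ∧ beta v k < s + ε →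
      m / b * (s / 2) * (1 / (18 * ε * om ^ 2)) * ‖dotQ Q k‖ ^ 2 ≤ G k := by
    intro k hk
    obtain ⟨n1, n2⟩ := norm_bounds_of_shell hv hεs hk.1 hk.2
    have hk0 : 0 < ‖k‖ := lt_of_lt_of_le (by positivity) n1
    have a1 := shell_kernel_bound (om := om) hε hεs hk.1 hk.2
    have a2 : s / 2 ≤ beta v k := by linarith [hk.1]
    have a3 : m / b * ‖dotQ Q k‖ ^ 2 ≤ densQ ρ Q k := by
      rw [densQ, div_mul_eq_mul_div, mul_comm m]
      exact div_le_div₀ (by positivity) (by gcongr; exact hlow k n1 n2) hk0 n2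
    simp only [hG]
    calc m / b * (s / 2) * (1 / (18 * ε * om ^ 2)) * ‖dotQ Q k‖ ^ 2
        = (m / b * ‖dotQ Q k‖ ^ 2) * ((s / 2) * (1 / (18 * ε * om ^ 2))) := by ring
      _ ≤ _ := by
        refine mul_le_mul a3 (mul_le_mul a2 a1 (by positivity) (by linarith)) (by positivity)
          (hdens0 k)
  have hL : ENNReal.ofReal (m / b * (s / 2) * (1 / (18 * om ^ 2)) * c)
      ≤ ENNReal.ofReal (∫ k, G k) := by
    rw [ofReal_integral_eq_lintegral_ofReal hGi (Eventually.of_forall hG0)]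
    calc ENNReal.ofReal (m / b * (s / 2) * (1 / (18 * om ^ 2)) * c)
        = ENNReal.ofReal (m / b * (s / 2) * (1 / (18 * ε * om ^ 2))) * ENNReal.ofReal (c * ε) := by
          rw [← ENNReal.ofReal_mul (by positivity)]
          congr 1
          field_simp
      _ ≤ ENNReal.ofReal (m / b * (s / 2) * (1 / (18 * ε * om ^ 2))) *
          ∫⁻ k in {k | s - ε ≤ beta v k ∧ beta v k < s + ε}, ENNReal.ofReal (‖dotQ Q k‖ ^ 2) := by
          gcongr
          exact hshell ε hε (by linarith)
      _ = ∫⁻ k in {k | s - ε ≤ beta v k ∧ beta v k < s + ε},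
          ENNReal.ofReal (m / b * (s / 2) * (1 / (18 * ε * om ^ 2)) * ‖dotQ Q k‖ ^ 2) := by
          rw [← lintegral_const_mul' _ _ ENNReal.ofReal_ne_top]
          refine lintegral_congr fun k => ?_
          rw [← ENNReal.ofReal_mul (by positivity)]
      _ ≤ ∫⁻ k in {k | s - ε ≤ beta v k ∧ beta v k < s + ε}, ENNReal.ofReal (G k) :=
          setLIntegral_mono' (measurableSet_shell v _ _) fun k hk =>
            ENNReal.ofReal_le_ofReal (hlow2 k hk)
      _ ≤ ∫⁻ k, ENNReal.ofReal (G k) := setLIntegral_le_lintegral _ _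
  exact (ENNReal.ofReal_le_ofReal_iff (integral_nonneg hG0)).1 hL

lemma continuous_Hext {ρ : E3 → ℝ} (hρ : IsCharge ρ) (v : E3) (T : ℝ) :
    Continuous (Hext ρ v T) :=
  continuous_matrix fun i j => (differentiable_Hext hρ v T i j).continuous

lemma tendsto_imag_axis (om : ℝ) :
    Tendsto (fun ε : ℝ => Complex.I * (om : ℂ) + (ε : ℂ)) (𝓝[>] 0) (𝓝 (Complex.I * (om : ℂ))) := by
  have : Continuous (fun ε : ℝ => Complex.I * (om : ℂ) + (ε : ℂ)) := by fun_prop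
  have h := (this.tendsto 0).mono_left (nhdsWithin_le_nhds (s := Set.Ioi 0))
  simpa using h

/-- The imaginary part of the form of the continuation of `H` is definite on the imaginary axis. -/
lemma im_hform_Hext_ne_zero {ρ : E3 → ℝ} (hρ : IsCharge ρ) (hW : Wiener ρ) {v : E3}
    (hv : ‖v‖ < 1) {T : ℝ} (hT : ∀ lam : ℂ, 0 < lam.re → H ρ v lam = Hext ρ v T lam)
    {om : ℝ} (hom : om ≠ 0) {Q : Fin 3 → ℂ} (hQ : Q ≠ 0) :
    (hform (Hext ρ v T (Complex.I * om)) Q).im ≠ 0 := by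
  obtain ⟨κ, hκ, hbound⟩ := exists_im_hform_lower hρ hW hv hom hQ
  have hc : Continuous (fun lam => -(hform (Hext ρ v T lam) Q).im / om) := by
    have h1 := continuous_Hext hρ v T
    have h2 : Continuous (fun lam => hform (Hext ρ v T lam) Q) := by
      unfold hform
      refine continuous_finsetSum _ fun i _ => continuous_const.mul ?_
      exact (continuous_apply i).comp (h1.matrix_mulVec continuous_const)
    exact ((Complex.continuous_im.comp h2).neg).div_const om
  have hlim := (hc.tendsto (Complex.I * om)).comp (tendsto_imag_axis om)
  have hs : 0 < |om| / 2 := by have := abs_pos.2 hom; positivity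
  -- The lower bound does not depend on `ε`, so it survives the limit onto the imaginary axis.
  have hge : κ ≤ -(hform (Hext ρ v T (Complex.I * om)) Q).im / om := by
    refine ge_of_tendsto hlim ?_
    filter_upwards [Ioc_mem_nhdsGT hs] with ε hε
    have := hbound ε hε.1 hε.2
    rwa [hT _ (by simp [hε.1])] at this
  intro h0
  rw [h0] at hge
  simp at hge
  linarith

/-- `K` is real and symmetric, hence hermitian. -/
lemma im_hform_K (ρ : E3 → ℝ) (v : E3) (Q : Fin 3 → ℂ) : (hform (K ρ v) Q).im = 0 := by
  have hsymm : ∀ i j, K ρ v i j = K ρ v j i := by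
    intro i j
    simp only [K, Matrix.of_apply]
    congr 2
    funext k
    rw [mul_comm (k i)]
  have hreal : ∀ i j, (starRingEnd ℂ) (K ρ v i j) = K ρ v i j := fun i j => by
    simp only [K, Matrix.of_apply, Complex.conj_ofReal]
  rw [← Complex.conj_eq_iff_im]
  simp only [hform, Matrix.mulVec, dotProduct, map_sum, map_mul, Complex.conj_conj, hreal,
    Finset.mul_sum]
  rw [Finset.sum_comm]
  refine Finset.sum_congr rfl fun i _ => Finset.sum_congr rfl fun j _ => ?_
  rw [hsymm j i]
  ring

/-- The entire continuation of `M`. -/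
noncomputable def Mext (ρ : E3 → ℝ) (v : E3) (T : ℝ) (lam : ℂ) :
    Matrix (Fin 3 ⊕ Fin 3) (Fin 3 ⊕ Fin 3) ℂ :=
  Matrix.fromBlocks (lam • 1) (-B v) (-(Hext ρ v T lam - K ρ v)) (lam • 1)

lemma continuous_Mext {ρ : E3 → ℝ} (hρ : IsCharge ρ) (v : E3) (T : ℝ) :
    Continuous (Mext ρ v T) := by
  have h := continuous_Hext hρ v T
  exact Continuous.matrix_fromBlocks (continuous_id.smul continuous_const) continuous_const
    (h.sub continuous_const).neg (continuous_id.smul continuous_const)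

/-- A kernel vector satisfies `iωQ = B_v P` and `iωP = F Q`. Since `P̄·B_v P` is real, so is `Q̄·F
Q`, which is minus its conjugate. The form of `K` is real as well, so the form of the continued `H`
at `Q` has no imaginary part. This forces `Q = 0`, and then `P = 0`. -/
lemma isUnit_Mext {ρ : E3 → ℝ} (hρ : IsCharge ρ) (hW : Wiener ρ) {v : E3}
    (hv : ‖v‖ < 1) {T : ℝ} (hT : ∀ lam : ℂ, 0 < lam.re → H ρ v lam = Hext ρ v T lam)
    {om : ℝ} (hom : om ≠ 0) : IsUnit (Mext ρ v T (Complex.I * om)) := by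
  rw [← Matrix.mulVec_injective_iff_isUnit]
  refine (injective_iff_map_eq_zero (Matrix.mulVecLin (Mext ρ v T (Complex.I * om)))).2
    fun X hX => ?_
  have hX' : (Mext ρ v T (Complex.I * om)).mulVec X = 0 := hX
  set Q : Fin 3 → ℂ := X ∘ Sum.inl with hQdef
  set P : Fin 3 → ℂ := X ∘ Sum.inr with hPdef
  rw [Mext, Matrix.fromBlocks_mulVec] at hX'
  have h1 : (Complex.I * (om : ℂ)) • Q = (B v).mulVec P := by
    have := congrArg (fun f => f ∘ Sum.inl) hX'
    simp only [Sum.elim_comp_inl, Matrix.smul_mulVec, Matrix.one_mulVec, Matrix.neg_mulVec] at this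
    exact add_neg_eq_zero.1 this
  have h2 : (Complex.I * (om : ℂ)) • P = (Hext ρ v T (Complex.I * om) - K ρ v).mulVec Q := by
    have := congrArg (fun f => f ∘ Sum.inr) hX'
    simp only [Sum.elim_comp_inr, Matrix.smul_mulVec, Matrix.one_mulVec, Matrix.neg_mulVec] at this
    exact (neg_add_eq_zero.1 this).symm
  have hlam : Complex.I * (om : ℂ) ≠ 0 :=
    mul_ne_zero Complex.I_ne_zero (Complex.ofReal_ne_zero.2 hom)
  -- the form of `F` at `Q` equals minus the form of `B` at `P`
  have hBP := B_form_eq v P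
  rw [← h1] at hBP
  have hconj : hform (Hext ρ v T (Complex.I * om) - K ρ v) Q
      = -(starRingEnd ℂ) (∑ i, (starRingEnd ℂ) (P i) * ((Complex.I * (om : ℂ)) • Q) i) := by
    rw [hform, ← h2]
    simp only [map_sum, map_mul, Complex.conj_conj, Pi.smul_apply, smul_eq_mul, Complex.conj_I,
      Complex.conj_ofReal, ← Finset.sum_neg_distrib]
    exact Finset.sum_congr rfl fun i _ => by ring
  have him : (hform (Hext ρ v T (Complex.I * om)) Q).im = 0 := by
    have e : hform (Hext ρ v T (Complex.I * om)) Q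
        = hform (Hext ρ v T (Complex.I * om) - K ρ v) Q + hform (K ρ v) Q := by
      simp only [hform, Matrix.sub_mulVec, Pi.sub_apply, mul_sub, Finset.sum_sub_distrib]
      ring
    rw [e, Complex.add_im, im_hform_K, hconj, hBP, Complex.conj_ofReal, Complex.neg_im,
      Complex.ofReal_im]
    simp
  have hQ0 : Q = 0 := by
    by_contra hQ
    exact im_hform_Hext_ne_zero hρ hW hv hT hom hQ him
  have hP0 : P = 0 := by
    rw [hQ0, Matrix.mulVec_zero] at h2
    exact (smul_eq_zero.1 h2).resolve_left hlam
  funext x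
  rcases x with i | i
  · exact congrFun hQ0 i
  · exact congrFun hP0 i

/-! ### Analyticity of the inverse of a matrix family. -/

lemma analyticAt_det {n : Type*} [Fintype n] [DecidableEq n] {A : ℝ → Matrix n n ℂ} {x : ℝ}
    (hA : ∀ i j, AnalyticAt ℝ (fun t => A t i j) x) : AnalyticAt ℝ (fun t => (A t).det) x := by
  simp only [Matrix.det_apply']
  refine Finset.analyticAt_fun_sum _ fun σ _ => analyticAt_const.mul ?_
  exact Finset.analyticAt_fun_prod _ fun i _ => hA _ _

/-- The entries of the inverse of an analytic family of invertible matrices are analytic. -/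
lemma analyticAt_inv_apply {n : Type*} [Fintype n] [DecidableEq n] {A : ℝ → Matrix n n ℂ} {x : ℝ}
    (hA : ∀ i j, AnalyticAt ℝ (fun t => A t i j) x) (hx : IsUnit (A x)) (i j : n) :
    AnalyticAt ℝ (fun t => (A t)⁻¹ i j) x := by
  have hdet : (A x).det ≠ 0 := ((Matrix.isUnit_iff_isUnit_det _).1 hx).ne_zero
  have hadj : AnalyticAt ℝ (fun t => (A t).adjugate i j) x := by
    simp only [Matrix.adjugate_apply]
    refine analyticAt_det fun a b => ?_
    by_cases h : a = j
    · simp only [Matrix.updateRow_apply, h, if_true]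
      exact analyticAt_const
    · simp only [Matrix.updateRow_apply, h, if_false]
      exact hA a b
  -- Cramer's formula writes the entry as a polynomial in the entries of `A t` divided by the
  -- determinant.
  have : (fun t => (A t)⁻¹ i j) = fun t => ((A t).det)⁻¹ * (A t).adjugate i j := by
    funext t
    rw [Matrix.inv_def, Matrix.smul_apply, Ring.inverse_eq_inv', smul_eq_mul]
  rw [this]
  exact ((analyticAt_det hA).inv hdet).mul hadj

lemma analyticAt_Mext_imag {ρ : E3 → ℝ} (hρ : IsCharge ρ) (v : E3) (T : ℝ) (x : ℝ)
    (i j : Fin 3 ⊕ Fin 3) :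
    AnalyticAt ℝ (fun om : ℝ => Mext ρ v T (Complex.I * (om : ℂ)) i j) x := by
  have hdiff : Differentiable ℂ (fun lam => Mext ρ v T lam i j) := by
    have hH := differentiable_Hext hρ v T
    rcases i with i | i <;> rcases j with j | j
    · simp only [Mext, Matrix.fromBlocks_apply₁₁, Matrix.smul_apply, smul_eq_mul]
      fun_prop
    · simp only [Mext, Matrix.fromBlocks_apply₁₂]
      fun_prop
    · simp only [Mext, Matrix.fromBlocks_apply₂₁, Matrix.neg_apply, Matrix.sub_apply]
      exact ((hH i j).sub_const _).neg
    · simp only [Mext, Matrix.fromBlocks_apply₂₂, Matrix.smul_apply, smul_eq_mul]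
      fun_prop
  have h1 : AnalyticAt ℝ (fun lam => Mext ρ v T lam i j) (Complex.I * (x : ℂ)) :=
    (hdiff.analyticAt _).restrictScalars
  have h2 : AnalyticAt ℝ (fun om : ℝ => Complex.I * (om : ℂ)) x :=
    analyticAt_const.mul (Complex.ofRealCLM.analyticAt x)
  exact h1.comp_of_eq h2 rfl

end WaveParticle

/-! ### Boundary values of `M`, analyticity of the inverse, and absence of eigenvalues. -/

theorem proposition8p1 (ρ : WaveParticle.E3 → ℝ) (hρ : WaveParticle.IsCharge ρ)
    (hW : WaveParticle.Wiener ρ) (v : WaveParticle.E3) (hv : ‖v‖ < 1) :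
    (∃ Mb : ℝ → Matrix (Fin 3 ⊕ Fin 3) (Fin 3 ⊕ Fin 3) ℂ,
      (∀ om : ℝ, om ≠ 0 →
        Tendsto (fun ε : ℝ => WaveParticle.M ρ v (Complex.I * (om : ℂ) + (ε : ℂ)))
          (𝓝[>] 0) (𝓝 (Mb om))) ∧
      (∀ om : ℝ, om ≠ 0 → IsUnit (Mb om)) ∧
      (∀ i j, AnalyticOnNhd ℝ (fun om : ℝ => (Mb om)⁻¹ i j) {om : ℝ | om ≠ 0})) ∧
    (∀ lam : ℂ, lam ≠ 0 → lam.re = 0 ∨ lam.im = 0 →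
      ¬ WaveParticle.IsEigenvalue ρ v lam) := by
  refine ⟨?_, fun lam h0 h => WaveParticle.not_isEigenvalue hρ hW hv h0 h⟩
  obtain ⟨T, hT⟩ := WaveParticle.exists_Hext hρ hv
  have hunit : ∀ om : ℝ, om ≠ 0 → IsUnit (WaveParticle.Mext ρ v T (Complex.I * om)) :=
    fun om hom => WaveParticle.isUnit_Mext hρ hW hv hT hom
  -- The boundary value is the restriction of the entire continuation, which coincides with `M` at
  -- `iω + ε` for every `ε > 0`.
  refine ⟨fun om => WaveParticle.Mext ρ v T (Complex.I * om), fun om _ => ?_, hunit,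
    fun i j om hom => ?_⟩
  · have h := ((WaveParticle.continuous_Mext hρ v T).tendsto (Complex.I * om)).comp
      (WaveParticle.tendsto_imag_axis om)
    refine h.congr' ?_
    filter_upwards [self_mem_nhdsWithin] with ε hε
    have hre : 0 < (Complex.I * (om : ℂ) + (ε : ℂ)).re := by simpa using hε
    simp only [Function.comp_apply, WaveParticle.Mext, WaveParticle.M, WaveParticle.F, hT _ hre]
  · exact WaveParticle.analyticAt_inv_apply
      (WaveParticle.analyticAt_Mext_imag hρ v T om) (hunit om hom) i j
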